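/- **Notation.** $\mathbf{Loc}$ is the category of locales (the opposite of frames) and $\Omega:\mathbf{Top}\to\mathbf{Loc}$ sends a space to its frame of open sets. Let $I=[0,1]$, let $\partial I^n\subset I^n$ be the set of points with some coordinate equal to $0$ or $1$ (so $I^0=*$, $\partial I^0=\emptyset$), let $\Box\subset\mathbf{Top}$ be the full subcategory on all $I^n,\partial I^n$ ($n\ge 0$), and $\Box_{\le 2}$ the one on those with $n\le 2$. Let $i_n:\partial I^n\hookrightarrow I^n$ and $j_n:I^n\times\{0\}\hookrightarrow I^n\times I=I^{n+1}$ be the inclusions, $e_0,e_1$ the endpoint inclusions $*\to\partial I$, $*\to I$ (and the induced $A\to A\times\partial I$, $A\to A\times I$), and $(1)=(1,\dots,1)\in\partial I^{n}$ for $n\ge1$. For a class $\mathcal K$ of maps, $cell(\mathcal K)$ is the class of transfinite compositions of pushouts of coproducts of maps in $\mathcal K$, $cof(\mathcal K)$ the class of retracts of maps in $cell(\mathcal K)$, and $rlp(\mathcal K)$ the class of maps with the right lifting property against $\mathcal K$. $\hat\times$ is the pushout-product. Let $\mathcal C$ be a bicomplete category and $\iota:\Box\to\mathcal C$ a full embedding;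 identify $\Box$ with its image and put $\mathcal I=\{i_n\}_{n\ge0}$, $\mathcal J=\{j_n\}_{n\ge0}$. The pair $(\mathcal C,\iota)$ is a *good Q-structure* if: * (Q1) $\iota|_{\Box_{\le2}}$ makes $\mathcal C$ a category with intervals: (S1) $\emptyset$ is initial and $*$ terminal in $\mathcal C$; (S2) $I^2$ is the product $I\times I$ in $\mathcal C$; (S3) there are $a,b:I\to I$ with $a(0)=0$, $b(1)=1$ such that $a,b$ exhibit $I$ as the pushout of $I\xleftarrow{e_1}*\xrightarrow{e_0}I$ in $\Box_{\le 2}$, $\iota$ preserves this pushout, and $X\times-$ preserves the resulting pushout in $\mathcal C$ for every $X\in\mathcal C$; (S4) $\emptyset\times X\cong\emptyset$ for all $X$. * (Q2) $X\times\partial I$ is a coproduct $X\sqcup X$ with inclusions $\mathrm{id}_X\times e_k$, for all $X$. * (Q3) $\mathcal I\hat\times\mathcal I\subseteq cof(\mathcal I)$ and $\mathcal I\hat\times\mathcal J\subseteq cof(\mathcal J)$. * (Q4) $\mathcal J\subseteq cof(\mathcal I)$, and $\emptyset\to\partial I^n$ is in $cof(\mathcal I)$ for all $n\ge 0$. * (Q5)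 $-\times\partial I^n$ and $-\times I^n$ have right adjoints, for all $n\ge 0$. * (Q6) For all $n\ge 0$, $\partial I^n$ is small relative to $cell(\mathcal I)$ and $I^n$ is small relative to $cell(\mathcal J)$. * (Q7) $I^n$ is the $n$-fold product of $I$ via the coordinate projections, for $n\ge1$. * (Q8) For all $n\ge 0$ there are a pushout of $*\leftarrow\partial I^n\xrightarrow{e_1}\partial I^n\times I$ with vertex $I^n$ whose leg $\rho:\partial I^n\times I\to I^n$ satisfies $\rho e_0=i_n$, and a pushout of $*\leftarrow\partial I^n\xrightarrow{i_n}I^n$ with vertex $\partial I^{n+1}$ whose leg $*\to\partial I^{n+1}$ is $(1)$. A *homotopy* from $f$ to $g:X\to Y$ is a map $H:X\times I\to Y$ with $He_0=f$, $He_1=g$; it is *relative to* $i:A\to X$ if $H(i\times\mathrm{id})$ is the projection $A\times I\to A$ followed by $fi$. A map $f:X\to Y$ has the *weak right lifting property* against $i:A\to B$ if for all $u:A\to X$, $v:B\to Y$ with $fu=vi$ there is $h:B\to X$ with $hi=u$ and $fh\sim v$ relative to $A$. For a point $x:*\to X$ and $n\ge0$, $\pi_n(X,x)$ is the set of maps $\alpha:\partial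 I^{n+1}\to X$ with $\alpha(1)=x$ modulo homotopy relative to $(1)$. For $n\ge1$, through the second pushout in (Q8), such maps correspond to maps $I^n\to X$ that are constantly $x$ on $\partial I^n$, and concatenation of the latter in the last coordinate (with $a(t)=t/2$, $b(t)=(1+t)/2$) induces a group operation on $\pi_n(X,x)$. **Theorem.** $\mathbf{Loc}$ is bicomplete and, with $\iota=\Omega|_\Box$, is a good Q-structure. Let $\mathcal I_{\mathbf{Loc}}=\{\Omega i_n\}_{n\ge0}$ and $\mathcal J_{\mathbf{Loc}}=\{\Omega j_n\}_{n\ge0}$. There is a model structure on $\mathbf{Loc}$ whose cofibrations are the maps in $cof(\mathcal I_{\mathbf{Loc}})$, whose fibrations are the maps in $rlp(\mathcal J_{\mathbf{Loc}})$, and whose weak equivalences are the maps having the weak right lifting property against every map in $\mathcal I_{\mathbf{Loc}}$. Moreover, for $n\ge1$ concatenation makes every $\pi_n(X,x)$ a group, and a map $f:X\to Y$ of locales is a weak equivalence if and only if 1. $X$ has a point whenever $Y$ has one, and 2. for every point $x$ of $X$ the map $\pi_0(X,x)\to\pi_0(Y,fx)$ is a bijection and $\pi_n(X,x)\to\pi_n(Y,fx)$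 is a group isomorphism for every $n\ge1$. In particular, if $X$ has a point, then $f$ is a weak equivalence if and only if it induces isomorphisms on all homotopy groups at all points of $X$. -/

import Mathlib

open CategoryTheory Limits HomotopicalAlgebra

universe u v w

noncomputable section

namespace QModel

/-! ### Cubes and their boundaries as topological spaces -/

/-- The `n`-cube `I^n` (lifted to the universe `u`). -/
def cube (n : ℕ) : TopCat.{u} := TopCat.of (ULift.{u} (Fin n → unitInterval))

/-- The boundary `∂I^n`: the subspace of the points having some coordinate equal to `0` or `1`. -/
def bdry (n : ℕ) : TopCat.{u} := TopCat.of (ULift.{u} (Cube.boundary (Fin n)))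

/-- The map between cubes given by a continuous map. -/
def cubeMap {m n : ℕ} (f : C(Fin m → unitInterval, Fin n → unitInterval)) :
    cube.{u} m ⟶ cube.{u} n :=
  TopCat.ofHom ⟨fun x => ⟨f x.down⟩, by fun_prop⟩

/-- The inclusion `i_n : ∂I^n ⟶ I^n`. -/
def bdryIncl (n : ℕ) : bdry.{u} n ⟶ cube.{u} n :=
  TopCat.ofHom ⟨fun x => ⟨(x.down : Fin n → unitInterval)⟩, by fun_prop⟩

/-- The inclusion `j_n : I^n × {0} ⟶ I^n × I = I^(n+1)`; the last coordinate is that of `I`. -/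
def cylIncl (n : ℕ) : cube.{u} n ⟶ cube.{u} (n + 1) :=
  cubeMap ⟨fun x => Fin.snoc (α := fun _ => unitInterval) x 0,
    Continuous.finSnoc continuous_id continuous_const⟩

/-- The `k`-th coordinate `I^n ⟶ I`. -/
def coord (n : ℕ) (k : Fin n) : cube.{u} n ⟶ cube.{u} 1 :=
  cubeMap ⟨fun x _ => x k, by fun_prop⟩

/-- The point `t` of `I`, as a map `* ⟶ I`. -/
def intervalPt (t : unitInterval) : cube.{u} 0 ⟶ cube.{u} 1 :=
  cubeMap (ContinuousMap.const _ fun _ => t)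

/-- For `t ∈ {0, 1}`, the point `(t, …, t)` of `∂I^(n+1)`, as a map `* ⟶ ∂I^(n+1)`. -/
def bdryPt (n : ℕ) (t : unitInterval) (ht : t = 0 ∨ t = 1) : cube.{u} 0 ⟶ bdry.{u} (n + 1) :=
  TopCat.ofHom (ContinuousMap.const _ ⟨⟨fun _ => t, 0, ht⟩⟩)

/-- The unique map `X ⟶ * = I^0`. -/
def toPt (X : TopCat.{u}) : X ⟶ cube.{u} 0 :=
  TopCat.ofHom (ContinuousMap.const _ ⟨Fin.elim0⟩)

/-- The map `id × g : I^n × I ⟶ I^n × I` for `g : I → I`. -/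
def lastCoordMap (n : ℕ) (g : C(unitInterval, unitInterval)) :
    cube.{u} (n + 1) ⟶ cube.{u} (n + 1) :=
  cubeMap ⟨fun x => Fin.snoc (α := fun _ => unitInterval) (fun k => x k.castSucc)
      (g (x (Fin.last n))),
    Continuous.finSnoc (by fun_prop) (by fun_prop)⟩

/-- `t ↦ t / 2`. -/
def lowerHalf : C(unitInterval, unitInterval) where
  toFun t := ⟨(t : ℝ) / 2, by linarith [t.2.1], by linarith [t.2.2]⟩
  continuous_toFun := by fun_prop

/-- `t ↦ (1 + t) / 2`. -/
def upperHalf : C(unitInterval, unitInterval) where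
  toFun t := ⟨(1 + (t : ℝ)) / 2, by linarith [t.2.1], by linarith [t.2.2]⟩
  continuous_toFun := by fun_prop

/-! ### The category `□` of cubes and boundaries, and its subcategory in dimensions at most two -/

/-- The spaces `I^n` and `∂I^n`. -/
def isBox : ObjectProperty TopCat.{u} := fun X => ∃ n, X = cube n ∨ X = bdry n

/-- The spaces `∅ = ∂I^0`, `* = I^0`, `∂I`, `I`, `∂I^2`, `I^2`. -/
def isBoxTwo : ObjectProperty TopCat.{u} := fun X => ∃ n ≤ 2, X = cube n ∨ X = bdry n

lemma isBoxTwo_le : isBoxTwo.{u} ≤ isBox.{u} := fun _ ⟨n, _, h⟩ => ⟨n, h⟩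

/-- The full subcategory `□` of topological spaces on the cubes and their boundaries. -/
abbrev Box := isBox.{u}.FullSubcategory

/-- The full subcategory `□_{≤ 2}`. -/
abbrev BoxTwo := isBoxTwo.{u}.FullSubcategory

/-- The inclusion of `□_{≤ 2}` in `□`. -/
abbrev boxTwoIncl : BoxTwo.{u} ⥤ Box.{u} := ObjectProperty.ιOfLE isBoxTwo_le

/-- `I^n` as an object of `□`. -/
abbrev Box.I (n : ℕ) : Box.{u} := ⟨cube n, n, Or.inl rfl⟩

/-- `∂I^n` as an object of `□`. -/
abbrev Box.B (n : ℕ) : Box.{u} := ⟨bdry n, n, Or.inr rfl⟩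

/-- `∅ = ∂I^0` in `□_{≤ 2}`. -/
abbrev BoxTwo.empty : BoxTwo.{u} := ⟨bdry 0, 0, by decide, Or.inr rfl⟩

/-- `* = I^0` in `□_{≤ 2}`. -/
abbrev BoxTwo.point : BoxTwo.{u} := ⟨cube 0, 0, by decide, Or.inl rfl⟩

/-- `I` in `□_{≤ 2}`. -/
abbrev BoxTwo.interval : BoxTwo.{u} := ⟨cube 1, 1, by decide, Or.inl rfl⟩

/-- `I^2` in `□_{≤ 2}`. -/
abbrev BoxTwo.square : BoxTwo.{u} := ⟨cube 2, 2, by decide, Or.inl rfl⟩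

/-- The endpoint inclusion `* ⟶ I` at `t`, in `□_{≤ 2}`. -/
abbrev BoxTwo.pt (t : unitInterval) : BoxTwo.point.{u} ⟶ BoxTwo.interval.{u} :=
  ObjectProperty.homMk (intervalPt t)

/-- The `k`-th coordinate `I^2 ⟶ I`, in `□_{≤ 2}`. -/
abbrev BoxTwo.coord (k : Fin 2) : BoxTwo.square.{u} ⟶ BoxTwo.interval.{u} :=
  ObjectProperty.homMk (QModel.coord 2 k)

/-- The endpoint inclusion `* ⟶ I` at `t`, in `□`. -/
abbrev Box.pt (t : unitInterval) : Box.I.{u} 0 ⟶ Box.I.{u} 1 :=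
  ObjectProperty.homMk (intervalPt t)

/-- `i_n : ∂I^n ⟶ I^n` in `□`. -/
abbrev Box.i (n : ℕ) : Box.B.{u} n ⟶ Box.I.{u} n := ObjectProperty.homMk (bdryIncl n)

/-- `j_n : I^n × {0} ⟶ I^n × I` in `□`. -/
abbrev Box.j (n : ℕ) : Box.I.{u} n ⟶ Box.I.{u} (n + 1) := ObjectProperty.homMk (cylIncl n)

/-- The unique map to the point, in `□`. -/
abbrev Box.toPt (X : Box.{u}) : X ⟶ Box.I.{u} 0 := ObjectProperty.homMk (QModel.toPt X.obj)

/-- The endpoint `0` of `∂I`, in `□`. -/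
abbrev Box.e0 : Box.I.{u} 0 ⟶ Box.B.{u} 1 := ObjectProperty.homMk (bdryPt 0 0 (Or.inl rfl))

/-- The point `(1, …, 1)` of `∂I^(n+1)`, in `□`; for `n = 0` the endpoint `1` of `∂I`. -/
abbrev Box.one (n : ℕ) : Box.I.{u} 0 ⟶ Box.B.{u} (n + 1) :=
  ObjectProperty.homMk (bdryPt n 1 (Or.inr rfl))

variable {C : Type w} [Category.{v} C]

/-! ### Cell complexes, cofibrations, smallness, pushout-products -/

/-- `cell(K)`: transfinite compositions of pushouts of coproducts of maps in `K`. -/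
def cell (K : MorphismProperty C) : MorphismProperty C :=
  MorphismProperty.transfiniteCompositions.{v}
    (MorphismProperty.coproducts.{v} K).pushouts

/-- `cof(K)`: the retracts of maps in `cell(K)`. -/
def cof (K : MorphismProperty C) : MorphismProperty C := (cell K).retracts

/-- `A` is small relative to the class `W`: for some regular cardinal `κ`, the functor `Hom(A, -)`
preserves the colimit of every `κ`-filtered well-ordered continuous sequence whose successor maps
are in `W`. -/
def IsSmallRelativeTo (A : C) (W : MorphismProperty C) : Prop :=
  ∃ (κ : Cardinal.{v}) (_ : Fact κ.IsRegular),
    ∀ (J : Type v) [LinearOrder J] [SuccOrder J] [OrderBot J] [WellFoundedLT J]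
      [IsCardinalFiltered J κ] (X Y : C) (f : X ⟶ Y) (hf : W.TransfiniteCompositionOfShape J f),
      PreservesColimit hf.F (coyoneda.obj (Opposite.op A))

/-- The map `Y × A ⊔_{X × A} X × B ⟶ Y × B` induced by `f : X ⟶ Y` and `g : A ⟶ B`. -/
def pushoutProduct [HasBinaryProducts C] [HasPushouts C] {X Y A B : C} (f : X ⟶ Y) (g : A ⟶ B) :
    pushout (prod.map f (𝟙 A)) (prod.map (𝟙 X) g) ⟶ Y ⨯ B :=
  pushout.desc (prod.map (𝟙 Y) g) (prod.map f (𝟙 B)) (by simp)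

/-- `A` is exponentiable: `- × A` has a right adjoint. -/
def IsExponentiable [HasBinaryProducts C] (A : C) : Prop :=
  (prod.functor.flip.obj A).IsLeftAdjoint

/-! ### Categories with intervals and Q-structures -/

/-- A functor on `□_{≤ 2}` makes the bicomplete category `C` a category with intervals. -/
structure IsCategoryWithIntervals [HasLimits C] [HasColimits C] (ι : BoxTwo.{u} ⥤ C) : Prop where
  full : ι.Full
  faithful : ι.Faithful
  /-- `∅` goes to an initial and `*` to a terminal object. -/
  initial : Nonempty (IsInitial (ι.obj BoxTwo.empty))
  terminal : Nonempty (IsTerminal (ι.obj BoxTwo.point))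
  /-- `I^2` goes to the product of two copies of `I`. -/
  square : Nonempty (IsLimit (BinaryFan.mk (ι.map (BoxTwo.coord 0)) (ι.map (BoxTwo.coord 1))))
  /-- A pushout gluing two copies of `I` to `I`, end `1` of the first copy to end `0` of the second,
  is preserved by `ι`, and its image is preserved by `X × -`. -/
  gluing : ∃ a b : BoxTwo.interval.{u} ⟶ BoxTwo.interval.{u},
    BoxTwo.pt 0 ≫ a = BoxTwo.pt 0 ∧ BoxTwo.pt 1 ≫ b = BoxTwo.pt 1 ∧
    IsPushout (BoxTwo.pt 0) (BoxTwo.pt 1) b a ∧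
    IsPushout (ι.map (BoxTwo.pt 0)) (ι.map (BoxTwo.pt 1)) (ι.map b) (ι.map a) ∧
    ∀ X : C, IsPushout (prod.map (𝟙 X) (ι.map (BoxTwo.pt 0)))
      (prod.map (𝟙 X) (ι.map (BoxTwo.pt 1)))
      (prod.map (𝟙 X) (ι.map b)) (prod.map (𝟙 X) (ι.map a))
  /-- `∅ × X ≅ ∅`. -/
  initial_prod : ∀ X : C, Nonempty ((⊥_ C) ⨯ X ≅ ⊥_ C)

/-- The generating cofibrations `{ι(i_n)}`. -/
def genI (ι : Box.{u} ⥤ C) : MorphismProperty C :=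
  MorphismProperty.ofHoms fun n : ℕ => ι.map (Box.i n)

/-- The generating trivial cofibrations `{ι(j_n)}`. -/
def genJ (ι : Box.{u} ⥤ C) : MorphismProperty C :=
  MorphismProperty.ofHoms fun n : ℕ => ι.map (Box.j n)

/-- A functor on `□` makes the bicomplete category `C` a Q-structure. -/
structure IsQStructure [HasLimits C] [HasColimits C] (ι : Box.{u} ⥤ C) : Prop where
  full : ι.Full
  faithful : ι.Faithful
  intervals : IsCategoryWithIntervals (boxTwoIncl ⋙ ι)
  /-- `X × ∂I` is the coproduct of two copies of `X ≅ X × *`, with inclusions `id × e_k`. -/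
  coproduct : ∀ X : C, Nonempty (IsColimit (BinaryCofan.mk
    (prod.map (𝟙 X) (ι.map Box.e0)) (prod.map (𝟙 X) (ι.map (Box.one 0)))))
  pushoutProduct_I_I : ∀ m n : ℕ,
    cof (genI ι) (pushoutProduct (ι.map (Box.i m)) (ι.map (Box.i n)))
  pushoutProduct_I_J : ∀ m n : ℕ,
    cof (genJ ι) (pushoutProduct (ι.map (Box.i m)) (ι.map (Box.j n)))
  genJ_le : genJ ι ≤ cof (genI ι)
  bdry_cofibrant : ∀ n : ℕ, cof (genI ι) (initial.to (ι.obj (Box.B n)))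
  exponentiable_bdry : ∀ n : ℕ, IsExponentiable (ι.obj (Box.B n))
  exponentiable_cube : ∀ n : ℕ, IsExponentiable (ι.obj (Box.I n))
  small_bdry : ∀ n : ℕ, IsSmallRelativeTo (ι.obj (Box.B n)) (cell (genI ι))
  small_cube : ∀ n : ℕ, IsSmallRelativeTo (ι.obj (Box.I n)) (cell (genJ ι))

/-- `e_t : A ⟶ A × I`, for an object `A` in the image of `□`. -/
def cylEnd [HasBinaryProducts C] (ι : Box.{u} ⥤ C) (A : Box.{u}) (t : unitInterval) :
    ι.obj A ⟶ ι.obj A ⨯ ι.obj (Box.I 1) :=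
  prod.lift (𝟙 _) (ι.map (Box.toPt A ≫ Box.pt t))

/-- `σ : I^n ⟶ ∂I^(n+1)` exhibits `∂I^(n+1)`, pointed by `(1, …, 1)`, as the quotient
`I^n / ∂I^n`. -/
def IsCollapse (ι : Box.{u} ⥤ C) (n : ℕ) (σ : ι.obj (Box.I n) ⟶ ι.obj (Box.B (n + 1))) : Prop :=
  IsPushout (ι.map (Box.i n)) (ι.map (Box.toPt (Box.B n))) σ (ι.map (Box.one n))

/-- A functor on `□` makes the bicomplete category `C` a good Q-structure. -/
structure IsGoodQStructure [HasLimits C] [HasColimits C] (ι : Box.{u} ⥤ C) : Prop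
    extends IsQStructure ι where
  /-- `I^n` is the `n`-fold product of `I`. -/
  cube_product : ∀ n : ℕ, 0 < n → Nonempty (IsLimit (Fan.mk (ι.obj (Box.I n))
    fun k : Fin n => ι.map (ObjectProperty.homMk (coord n k) : Box.I n ⟶ Box.I 1)))
  /-- `I^n` is the cone on `∂I^n`, with base the boundary. -/
  cone : ∀ n : ℕ, ∃ (c : ι.obj (Box.I 0) ⟶ ι.obj (Box.I n))
    (ρ : ι.obj (Box.B n) ⨯ ι.obj (Box.I 1) ⟶ ι.obj (Box.I n)),
    IsPushout (cylEnd ι (Box.B n) 1) (ι.map (Box.toPt (Box.B n))) ρ c ∧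
      cylEnd ι (Box.B n) 0 ≫ ρ = ι.map (Box.i n)
  collapse : ∀ n : ℕ, ∃ σ, IsCollapse ι n σ

/-! ### Homotopies and weak equivalences -/

section Homotopy

variable [HasBinaryProducts C] (ι : Box.{u} ⥤ C)

/-- `H : X × I ⟶ Y` is a homotopy from `f` to `g`. The two ends of the cylinder are
`X × * ⟶ X × I`, where `*` is terminal, so that the first projection `X × * ⟶ X` is an
isomorphism. -/
def IsHomotopy {X Y : C} (H : X ⨯ ι.obj (Box.I 1) ⟶ Y) (f g : X ⟶ Y) : Prop :=
  prod.map (𝟙 X) (ι.map (Box.pt 0)) ≫ H = prod.fst ≫ f ∧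
    prod.map (𝟙 X) (ι.map (Box.pt 1)) ≫ H = prod.fst ≫ g

/-- `f` and `g` are homotopic relative to `i : A ⟶ X`. -/
def HomotopicRel {A X Y : C} (i : A ⟶ X) (f g : X ⟶ Y) : Prop :=
  ∃ H : X ⨯ ι.obj (Box.I 1) ⟶ Y, IsHomotopy ι H f g ∧
    prod.map i (𝟙 _) ≫ H = prod.fst ≫ i ≫ f

lemma HomotopicRel.postcomp {A X Y Z : C} {i : A ⟶ X} {f g : X ⟶ Y}
    (h : HomotopicRel ι i f g) (k : Y ⟶ Z) : HomotopicRel ι i (f ≫ k) (g ≫ k) := by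
  obtain ⟨H, ⟨h₀, h₁⟩, hA⟩ := h
  exact ⟨H ≫ k, ⟨by simp only [← Category.assoc, h₀], by simp only [← Category.assoc, h₁]⟩,
    by simp only [← Category.assoc, hA]⟩

/-- `f` has the weak right lifting property against `i`. -/
def WeakRLP {A B X Y : C} (f : X ⟶ Y) (i : A ⟶ B) : Prop :=
  ∀ (p : A ⟶ X) (q : B ⟶ Y), p ≫ f = i ≫ q →
    ∃ h : B ⟶ X, i ≫ h = p ∧ HomotopicRel ι i (h ≫ f) q

/-- The maps having the weak right lifting property against all `ι(i_n)`. -/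
def weakEquiv : MorphismProperty C := fun _ _ f => ∀ n : ℕ, WeakRLP ι f (ι.map (Box.i n))

/-! ### Homotopy groups -/

/-- The points of `X`. -/
abbrev Point (X : C) := ι.obj (Box.I 0) ⟶ X

/-- Based maps `(∂I^(n+1), (1)) ⟶ (X, x)`. -/
abbrev SphereMap (n : ℕ) {X : C} (x : Point ι X) :=
  { α : ι.obj (Box.B (n + 1)) ⟶ X // ι.map (Box.one n) ≫ α = x }

/-- `π_n(X, x)`: based maps `(∂I^(n+1), (1)) ⟶ (X, x)` up to homotopy relative to `(1)`. -/
def HomotopyGrp (n : ℕ) {X : C} (x : Point ι X) :=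
  Quot fun α β : SphereMap ι n x => HomotopicRel ι (ι.map (Box.one n)) α.1 β.1

/-- The class of a based map in `π_n(X, x)`. -/
def HomotopyGrp.mk {n : ℕ} {X : C} {x : Point ι X} (α : SphereMap ι n x) : HomotopyGrp ι n x :=
  Quot.mk _ α

/-- The map `π_n(X, x) → π_n(Y, f x)` induced by `f : X ⟶ Y`. -/
def HomotopyGrp.map (n : ℕ) {X Y : C} (f : X ⟶ Y) (x : Point ι X) :
    HomotopyGrp ι n x → HomotopyGrp ι n (x ≫ f) :=
  Quot.map (fun α => ⟨α.1 ≫ f, by rw [← Category.assoc, α.2]⟩)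
    fun _ _ h => HomotopicRel.postcomp ι h f

/-- `γ : I^n × I ⟶ X` is the concatenation of `α` and `β` in the last coordinate: it is `α` on
`I^n × [0, 1/2]` and `β` on `I^n × [1/2, 1]`, after reparametrization. -/
def IsConcat {n : ℕ} {X : C} (α β γ : ι.obj (Box.I (n + 1)) ⟶ X) : Prop :=
  ι.map (ObjectProperty.homMk (lastCoordMap n lowerHalf)) ≫ γ = α ∧
    ι.map (ObjectProperty.homMk (lastCoordMap n upperHalf)) ≫ γ = β

/-- The group structure `G` on `π_(n+1)(X, x)` is given by concatenation, where based maps on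
`∂I^(n+2)` are regarded, through `σ`, as maps on `I^(n+1)` that are constant on the boundary. -/
def IsConcatLaw (n : ℕ) (σ : ι.obj (Box.I (n + 1)) ⟶ ι.obj (Box.B (n + 2))) {X : C}
    (x : Point ι X) (G : Group (HomotopyGrp ι (n + 1) x)) : Prop :=
  ∀ α β : SphereMap ι (n + 1) x,
    (∃ γ : SphereMap ι (n + 1) x, IsConcat ι (σ ≫ α.1) (σ ≫ β.1) (σ ≫ γ.1)) ∧
    ∀ γ : SphereMap ι (n + 1) x, IsConcat ι (σ ≫ α.1) (σ ≫ β.1) (σ ≫ γ.1) →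
      HomotopyGrp.mk ι γ = G.mul (HomotopyGrp.mk ι α) (HomotopyGrp.mk ι β)

end Homotopy

/-! ### Locales -/

/-- The functor `Ω`, from the cubes and their boundaries to locales. -/
abbrev boxToLocale : Box.{u} ⥤ Locale.{u} := isBox.ι ⋙ topToLocale.{u}

end QModel

end

noncomputable section

namespace QModel

open Order TopologicalSpace

open Order

/-! ### Frames presented by generators and relations; limits and colimits of frames -/

/-! The generating maps have as domains and codomains locales of compact Hausdorff spaces, and the
adjunction between `topToLocale` and the space of points identifies maps from the locale of a space
`S` to `X` with continuous maps from `S` to the points of `X` (`cts`, `mor`). Moreover `topToLocale`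
preserves products with compact Hausdorff spaces (`bijective_desc_comap`), so a homotopy on such a
cylinder is a homotopy of continuous maps. Hence lifting against the generators, the weak lifting
property and homotopy groups depend only on the map induced on spaces of points (`genI_rlp_iff`,
`genJ_rlp_iff`, `weakEquiv_iff_isWE`). Two-out-of-three, the identification of trivial fibrations
and the description of weak equivalences by homotopy groups then become classical arguments with
cubes: homotopy extension, box filling, and the sphere as a cube with its boundary collapsed.

Points do not control colimits of locales or products with arbitrary locales, and three ingredients
need frames.

Products and exponentials: for compact Hausdorff `K`, an open of `L × K` is a function assigning to
an open `a` of `K` the largest open of `L` whose product with `closure a` lies inside (`Cyl`). A map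
from `X × K` to `Y` is then a family of opens of `X` subject to relations, and the universal such
family, given by generators and relations, is the exponential. Gluing axioms for `X × -` hold
because closed sublocales are stable under products and a cover by two of them is a pushout.

Smallness: the class `sepMaps` of relatively regular closed inclusions along which disjoint opens
extend contains the generators and is closed under coproducts, pushouts and transfinite composition.
Along a sufficiently long chain of such maps, a map from the locale of a space factors through a
stage (`exists_factor_of_chain`). This provides the small object argument.

Trivial cofibrations: the endpoint map of the path object lifts against the generating trivial
cofibrations, so any map with the left lifting property against fibrations is a strong deformation
retract (`exists_deformation`), hence a weak equivalence. The retract argument then yields the model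
structure. -/

/-- A frame structure from a top element, binary infima and arbitrary suprema. -/
@[reducible]
def frameOfSup (α : Type u) [PartialOrder α] (t : α) (ht : ∀ a, a ≤ t) (m : α → α → α)
    (hl : ∀ a b, m a b ≤ a) (hr : ∀ a b, m a b ≤ b) (hm : ∀ a b c, a ≤ b → a ≤ c → a ≤ m b c)
    (s : Set α → α) (hs : ∀ A, IsLUB A (s A))
    (hd : ∀ a A c, (∀ b ∈ A, m a b ≤ c) → m a (s A) ≤ c) : Frame α :=
  letI : SupSet α := ⟨s⟩
  letI : CompleteLattice α :=
    { completeLatticeOfSup α hs with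
      inf := m
      inf_le_left := hl
      inf_le_right := hr
      le_inf := hm
      top := t
      le_top := ht }
  Frame.ofMinimalAxioms ⟨fun a A => hd a A _ fun b hb => le_iSup₂_of_le b hb le_rfl⟩

lemma le_iff_of_injective {L M : Type*} [SemilatticeInf L] [SemilatticeInf M] {F : Type*}
    [FunLike F L M] [InfHomClass F L M] (f : F) (hf : Function.Injective f) {x y : L} :
    f x ≤ f y ↔ x ≤ y := by
  rw [← inf_eq_left, ← map_inf, hf.eq_iff, inf_eq_left]

section Presentation

variable {G : Type u} (R : ∀ L : Frm.{u}, (G → L) → Prop)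

/-- The finite meet of generators named by a list. -/
def evalList {L : Type*} [Frame L] (φ : G → L) (l : List G) : L := (l.map φ).foldr (· ⊓ ·) ⊤

/-- The join of finite meets named by a set of lists. -/
def termEval {L : Type*} [Frame L] (φ : G → L) (S : Set (List G)) : L := ⨆ l ∈ S, evalList φ l

lemma evalList_append {L : Type*} [Frame L] (φ : G → L) (l l' : List G) :
    evalList φ (l ++ l') = evalList φ l ⊓ evalList φ l' := by
  induction l with
  | nil => simp [evalList]
  | cons a l ih => simp only [evalList, List.cons_append, List.map_cons, List.foldr_cons] at *
                   rw [ih, inf_assoc]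

lemma map_evalList {L M : Type*} [Frame L] [Frame M] (f : FrameHom L M) (φ : G → L) (l : List G) :
    f (evalList φ l) = evalList (fun g => f (φ g)) l := by
  induction l with
  | nil => simp [evalList]
  | cons a l ih => simp only [evalList, List.map_cons, List.foldr_cons, map_inf] at *
                   rw [ih]

/-- The closure of a term: all finite meets lying below it in every model of the relations. -/
def closeTerm (S : Set (List G)) : Set (List G) :=
  { l | ∀ (L : Frm.{u}) (φ : G → L), R L φ → evalList φ l ≤ termEval φ S }

/-- The frame presented by the relations `R`. -/
def Presented : Type u := { S : Set (List G) // closeTerm R S = S }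

namespace Presented

variable {R}

lemma subset_closeTerm (S : Set (List G)) : S ⊆ closeTerm R S :=
  fun l hl _ φ _ => le_iSup₂_of_le (f := fun l _ => evalList φ l) l hl le_rfl

lemma termEval_closeTerm {L : Frm.{u}} (φ : G → L) (hφ : R L φ) (S : Set (List G)) :
    termEval φ (closeTerm R S) = termEval φ S :=
  le_antisymm (iSup₂_le fun _ hl => hl L φ hφ)
    (biSup_mono fun _ h => subset_closeTerm S h)

lemma closeTerm_closeTerm (S : Set (List G)) :
    closeTerm R (closeTerm R S) = closeTerm R S := by
  refine Set.Subset.antisymm (fun l hl L φ hφ => ?_) (subset_closeTerm _)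
  rw [← termEval_closeTerm φ hφ S]
  exact hl L φ hφ

variable (R) in
/-- The element named by a term. -/
def mk (S : Set (List G)) : Presented R := ⟨closeTerm R S, closeTerm_closeTerm S⟩

instance : PartialOrder (Presented R) := inferInstanceAs (PartialOrder (Subtype _))

/-- The value of an element of the presented frame in a model. -/
def eval {L : Type*} [Frame L] (φ : G → L) (x : Presented R) : L := termEval φ x.1

lemma eval_mono {L : Type*} [Frame L] (φ : G → L) {x y : Presented R} (h : x ≤ y) :
    eval φ x ≤ eval φ y := biSup_mono fun _ hl => h hl

/-- As `y` is closed, a finite meet belongs to it exactly when it lies below `y` in every model.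
Thus the models jointly reflect the order, and laws in `Presented R` can be checked after
evaluation. -/
lemma le_of_eval {x y : Presented R}
    (h : ∀ (L : Frm.{u}) (φ : G → L), R L φ → eval φ x ≤ eval φ y) : x ≤ y := by
  intro l hl
  rw [← y.2]
  intro L φ hφ
  exact (le_iSup₂_of_le (f := fun l _ => evalList φ l) l hl le_rfl).trans (h L φ hφ)

lemma eval_mk {L : Frm.{u}} (φ : G → L) (hφ : R L φ) (S : Set (List G)) :
    eval φ (mk R S) = termEval φ S := termEval_closeTerm φ hφ S

/-- Meets in the presented frame. -/
def inf (x y : Presented R) : Presented R := mk R { l | ∃ a ∈ x.1, ∃ b ∈ y.1, l = a ++ b }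

lemma eval_inf' {L : Frm.{u}} (φ : G → L) (hφ : R L φ) (x y : Presented R) :
    eval φ (inf x y) = eval φ x ⊓ eval φ y := by
  rw [inf, eval_mk φ hφ]
  simp only [eval, termEval, iSup_inf_eq, inf_iSup_eq]
  apply le_antisymm
  · refine iSup₂_le ?_
    rintro _ ⟨a, ha, b, hb, rfl⟩
    rw [evalList_append]
    exact le_iSup₂_of_le b hb (le_iSup₂_of_le a ha le_rfl)
  · refine iSup₂_le fun b hb => iSup₂_le fun a ha => ?_
    rw [← evalList_append]
    exact le_iSup₂_of_le (f := fun l _ => evalList φ l) (a ++ b) ⟨a, ha, b, hb, rfl⟩ le_rfl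

/-- Joins in the presented frame. -/
def sup (A : Set (Presented R)) : Presented R := mk R (⋃ x ∈ A, x.1)

lemma eval_sup' {L : Frm.{u}} (φ : G → L) (hφ : R L φ) (A : Set (Presented R)) :
    eval φ (sup A) = ⨆ x ∈ A, eval φ x := by
  rw [sup, eval_mk φ hφ]
  simp only [eval, termEval, Set.mem_iUnion]
  apply le_antisymm
  · refine iSup₂_le ?_
    rintro l ⟨x, hx, hl⟩
    exact le_iSup₂_of_le x hx (le_iSup₂_of_le l hl le_rfl)
  · exact iSup₂_le fun x hx => iSup₂_le fun l hl =>
      le_iSup₂_of_le (f := fun l _ => evalList φ l) l ⟨x, hx, hl⟩ le_rfl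

/-- Since `eval` commutes with `inf` and `sup` in every model, each frame axiom is inherited from
the models by `le_of_eval`. -/
instance : Frame (Presented R) :=
  frameOfSup _ (mk R Set.univ)
    (fun x => le_of_eval fun L φ hφ => by
      rw [eval_mk φ hφ]; exact biSup_mono fun _ _ => trivial)
    inf
    (fun x y => le_of_eval fun L φ hφ => by rw [eval_inf' φ hφ]; exact inf_le_left)
    (fun x y => le_of_eval fun L φ hφ => by rw [eval_inf' φ hφ]; exact inf_le_right)
    (fun x y z h h' => le_of_eval fun L φ hφ => by
      rw [eval_inf' φ hφ]; exact le_inf (eval_mono φ h) (eval_mono φ h'))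
    sup
    (fun A => ⟨fun x hx => le_of_eval fun L φ hφ => by
        rw [eval_sup' φ hφ]
        exact le_iSup₂_of_le x hx le_rfl,
      fun y hy => le_of_eval fun L φ hφ => by
        rw [eval_sup' φ hφ]
        exact iSup₂_le fun x hx => eval_mono φ (hy hx)⟩)
    (fun x A y h => le_of_eval fun L φ hφ => by
        rw [eval_inf' φ hφ, eval_sup' φ hφ, inf_iSup₂_eq]
        refine iSup₂_le fun z hz => ?_
        rw [← eval_inf' φ hφ]
        exact eval_mono φ (h z hz))

/-- The frame homomorphism out of the presented frame given by a model. -/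
def lift {L : Frm.{u}} (φ : G → L) (hφ : R L φ) : FrameHom (Presented R) L where
  toFun := eval φ
  map_inf' := eval_inf' φ hφ
  map_top' := by
    change eval φ (mk R Set.univ) = ⊤
    rw [eval_mk φ hφ]
    exact top_unique (le_iSup₂_of_le (f := fun l _ => evalList φ l) [] trivial (by simp [evalList]))
  map_sSup' A := by
    rw [sSup_image]
    exact eval_sup' φ hφ A

variable (R) in
/-- The generators of the presented frame. -/
def gen (g : G) : Presented R := mk R {[g]}

lemma lift_gen {L : Frm.{u}} (φ : G → L) (hφ : R L φ) (g : G) : lift φ hφ (gen R g) = φ g := by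
  change eval φ (mk R {[g]}) = φ g
  rw [eval_mk φ hφ]
  simp [termEval, evalList]

/-- Both sides have the same value in every model. So the generators generate, which gives
uniqueness of homomorphisms out of the presented frame. -/
lemma eq_termEval_gen (x : Presented R) : x = termEval (gen R) x.1 := by
  refine le_antisymm (le_of_eval fun L φ hφ => ?_) (le_of_eval fun L φ hφ => ?_) <;>
  · have h : eval φ (termEval (gen R) x.1) = eval φ x := by
      change lift φ hφ (termEval (gen R) x.1) = _
      simp only [termEval, map_iSup, map_evalList, lift_gen, eval]
    exact h.symm ▸ le_rfl

end Presented

/-- Relations between generators that are jointly reflected by jointly order-reflecting families of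
frame homomorphisms have a universal model. -/
theorem exists_universal_model
    (hrefl : ∀ (L : Frm.{u}) (φ : G → L) (ι : Type (u + 1)) (M : ι → Frm.{u})
      (f : ∀ i, FrameHom L (M i)), (∀ x y, (∀ i, f i x ≤ f i y) → x ≤ y) →
      (∀ i, R (M i) fun g => f i (φ g)) → R L φ) :
    ∃ (U : Frm.{u}) (η : G → U), R U η ∧ ∀ (L : Frm.{u}) (φ : G → L), R L φ →
      ∃! f : FrameHom U L, ∀ g, f (η g) = φ g := by
  refine ⟨Frm.of (Presented R), Presented.gen R, ?_, fun L φ hφ =>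
    ⟨Presented.lift φ hφ, Presented.lift_gen φ hφ, fun f hf => ?_⟩⟩
  -- The family of all models is indexed one universe up, although closed sets of lists form a type
  -- in universe `u`. It reflects the order, so `hrefl` shows that the generators themselves satisfy
  -- `R`.
  · refine hrefl _ _ (Σ L : Frm.{u}, { φ : G → L // R L φ }) (fun i => i.1)
      (fun i => Presented.lift i.2.1 i.2.2)
      (fun x y h => Presented.le_of_eval fun L φ hφ => h ⟨L, φ, hφ⟩) ?_
    rintro ⟨L, φ, hφ⟩
    simpa only [Presented.lift_gen] using hφ
  · ext x
    have hx : ∀ f : FrameHom (Presented R) L, (∀ g, f (Presented.gen R g) = φ g) →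
        f x = termEval φ x.1 := by
      intro f hf
      conv_lhs => rw [Presented.eq_termEval_gen x]
      simp only [termEval, map_iSup, map_evalList, hf]
    exact (hx f hf).trans (hx _ (Presented.lift_gen φ hφ)).symm

end Presentation

/-! ### Limits and colimits in the category of frames -/

section Colimits

/-- The laws of a frame homomorphism are equations and can be tested after a jointly injective
family of homomorphisms. This verifies the reflection hypothesis of `exists_universal_model` for
relations that ask certain functions to be homomorphisms. -/
lemma frameHom_sSup_eq_of_reflect {K L : Type*} [Frame K] [Frame L] (φ : K → L) {ι : Type*}
    (M : ι → Frm.{u}) (f : ∀ i, FrameHom L (M i)) (hf : ∀ x y, (∀ i, f i x = f i y) → x = y)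
    (g : ∀ i, FrameHom K (M i)) (hg : ∀ i x, g i x = f i (φ x)) :
    ∃ φ' : FrameHom K L, ⇑φ' = φ :=
  ⟨{ toFun := φ
     map_inf' := fun a b => hf _ _ fun i => by rw [map_inf, ← hg, ← hg, ← hg, map_inf]
     map_top' := hf _ _ fun i => by rw [← hg, map_top, map_top]
     map_sSup' := fun A => hf _ _ fun i => by
      rw [← hg, map_sSup, map_sSup, ← Set.image_comp]
      congr 1
      exact Set.image_congr fun x _ => hg i x }, rfl⟩

instance : HasColimitsOfSize.{u, u} Frm.{u} where
  has_colimits_of_shape J _ := ⟨fun F => by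
    -- The colimit is generated by all elements of all the frames; a model of the relations is
    -- exactly a cocone.
    let R : ∀ L : Frm.{u}, ((Σ j, F.obj j) → L) → Prop := fun L φ =>
      (∀ j, ∃ f : FrameHom (F.obj j) L, ∀ x, f x = φ ⟨j, x⟩) ∧
        ∀ {j j'} (k : j ⟶ j') (x : F.obj j), φ ⟨j', (F.map k).hom x⟩ = φ ⟨j, x⟩
    obtain ⟨U, η, hη, hU⟩ := exists_universal_model R
      (fun L φ ι M f hf h => by
        have hf' : ∀ x y, (∀ i, f i x = f i y) → x = y := fun x y h =>
          le_antisymm (hf _ _ fun i => (h i).le) (hf _ _ fun i => (h i).ge)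
        refine ⟨fun j => ?_, fun k x => hf' _ _ fun i => (h i).2 k x⟩
        choose g hg using fun i => (h i).1 j
        obtain ⟨φ', h'⟩ := frameHom_sSup_eq_of_reflect (fun x => φ ⟨j, x⟩) M f hf' g hg
        exact ⟨φ', fun x => congrFun h' x⟩)
    choose ψ hψ using hη.1
    let c : Cocone F :=
      { pt := U
        ι := 
          { app := fun j => Frm.ofHom (ψ j)
            naturality := fun j j' k => by
              ext x
              change ψ j' ((F.map k).hom x) = ψ j x
              rw [hψ, hψ, hη.2] } }
    have hs : ∀ s : Cocone F, R s.pt (fun p => (s.ι.app p.1).hom p.2) := fun s =>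
      ⟨fun j => ⟨(s.ι.app j).hom, fun x => rfl⟩, fun k x => by
        have := s.w k
        dsimp only
        rw [← this]
        rfl⟩
    exact ⟨⟨⟨c,
      { desc := fun s => Frm.ofHom (hU s.pt (fun p => (s.ι.app p.1).hom p.2) (hs s)).choose
        fac := fun s j => by
          ext x
          change (hU s.pt (fun p => (s.ι.app p.1).hom p.2) (hs s)).choose (ψ j x) = _
          rw [hψ]
          exact (hU s.pt (fun p => (s.ι.app p.1).hom p.2) (hs s)).choose_spec.1 ⟨j, x⟩
        uniq := fun s m hm => by
          apply Frm.hom_ext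
          refine (hU s.pt (fun p => (s.ι.app p.1).hom p.2) (hs s)).choose_spec.2 m.hom ?_
          rintro ⟨j, x⟩
          rw [← hψ, ← hm]
          rfl }⟩⟩⟩⟩

/-- The frame of compatible families for a diagram of frames. -/
abbrev Sections {J : Type u} [Category.{u} J] (F : J ⥤ Frm.{u}) : Type u :=
  { x : ∀ j, F.obj j // ∀ {j j'} (k : j ⟶ j'), (F.map k).hom (x j) = x j' }

instance {J : Type u} [Category.{u} J] (F : J ⥤ Frm.{u}) : Frame (Sections F) :=
  frameOfSup _ ⟨⊤, fun k => map_top _⟩ (fun a => le_top (a := a.1))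
    (fun a b => ⟨a.1 ⊓ b.1, fun k => by simp only [Pi.inf_apply, map_inf, a.2, b.2]⟩)
    (fun a b => inf_le_left (a := a.1)) (fun a b => inf_le_right (a := a.1))
    (fun a b c (h : a.1 ≤ b.1) (h' : a.1 ≤ c.1) => show a.1 ≤ b.1 ⊓ c.1 from le_inf h h')
    (fun A => ⟨⨆ a ∈ A, a.1, fun k => by
      simp only [iSup_apply, map_iSup]
      exact iSup_congr fun a => iSup_congr fun _ => a.2 k⟩)
    (fun A => ⟨fun a ha => show a.1 ≤ ⨆ a ∈ A, a.1 from le_iSup₂_of_le a ha le_rfl,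
      fun b hb => show ⨆ a ∈ A, a.1 ≤ b.1 from iSup₂_le fun a ha => hb ha⟩)
    (fun a A c h => show a.1 ⊓ (⨆ b ∈ A, b.1) ≤ c.1 by
      rw [inf_iSup₂_eq]
      exact iSup₂_le fun b hb => h b hb)

instance : HasLimitsOfSize.{u, u} Frm.{u} where
  has_limits_of_shape J _ := ⟨fun F => 
    let c : Cone F :=
      { pt := Frm.of (Sections F)
        π :=
          { app := fun j => Frm.ofHom
              { toFun := fun x => x.1 j
                map_inf' := fun _ _ => rfl
                map_top' := rfl
                map_sSup' := fun A => by
                  change (⨆ a ∈ A, (a : Sections F).1 : ∀ j, F.obj j) j = _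
                  simp only [iSup_apply, sSup_image] }
            naturality := fun j j' k => by
              ext x
              exact (x.2 k).symm } }
    ⟨⟨c,
      { lift := fun s => Frm.ofHom
          { toFun := fun x => ⟨fun j => (s.π.app j).hom x, fun k => by
              exact congrArg (fun f => f.hom x) (s.w k)⟩
            map_inf' := fun _ _ => Subtype.ext (funext fun j => map_inf _ _ _)
            map_top' := Subtype.ext (funext fun j => map_top _)
            map_sSup' := fun A => Subtype.ext (funext fun j => by
              change _ = (⨆ a ∈ _, (a : Sections F).1 : ∀ j, F.obj j) j
              simp only [map_sSup, iSup_apply, sSup_image, iSup_image]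
              rfl) }
        fac := fun s j => rfl
        uniq := fun s m hm => by
          apply Frm.hom_ext
          refine FrameHom.ext fun x => Subtype.ext (funext fun j => ?_)
          change _ = (s.π.app j).hom x
          rw [← hm]
          rfl }⟩⟩⟩

instance hasLimits_locale : HasLimits Locale.{u} := inferInstanceAs (HasLimits Frm.{u}ᵒᵖ)

instance hasColimits_locale : HasColimits Locale.{u} := inferInstanceAs (HasColimits Frm.{u}ᵒᵖ)

end Colimits

/-! ### Locale morphisms as frame homomorphisms -/

/-- The frame homomorphism underlying a morphism of locales. -/
def pull {X Y : Locale.{u}} (f : X ⟶ Y) : FrameHom Y X := (Quiver.Hom.unop f).hom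

/-- The morphism of locales given by a frame homomorphism. -/
def mkHom {X Y : Locale.{u}} (f : FrameHom Y X) : X ⟶ Y := Quiver.Hom.op (Frm.ofHom f)

@[simp] lemma pull_mkHom {X Y : Locale.{u}} (f : FrameHom Y X) : pull (mkHom f) = f := rfl

@[simp] lemma pull_comp {X Y Z : Locale.{u}} (f : X ⟶ Y) (g : Y ⟶ Z) (z : Z) :
    pull (f ≫ g) z = pull f (pull g z) := rfl

@[simp] lemma pull_id {X : Locale.{u}} (x : X) : pull (𝟙 X) x = x := rfl

lemma hom_ext_pull {X Y : Locale.{u}} {f g : X ⟶ Y} (h : ∀ y, pull f y = pull g y) : f = g :=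
  Quiver.Hom.unop_inj (Frm.ext h)

/-! ### The product of a locale with a compact Hausdorff space -/

section Cylinder

variable (K : Type u) [TopologicalSpace K]

/-- The open sublocales `W` of `L × K`, as functions sending an open `a` of `K` to the largest open
`x` of `L` such that `x × closure a` lies in `W`. -/
@[ext]
structure Cyl (L : Type*) [Frame L] where
  /-- The underlying function. -/
  toFun : Opens K → L
  prop : toFun ⊥ = ⊤ ∧ (∀ a b, toFun (a ⊔ b) = toFun a ⊓ toFun b) ∧
    ∀ a : Opens K, toFun a ≤ ⨆ (b : Opens K) (_ : closure (a : Set K) ⊆ b), toFun b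

namespace Cyl

variable {K} {L M : Type*} [Frame L] [Frame M]

instance : PartialOrder (Cyl K L) := PartialOrder.lift Cyl.toFun fun _ _ => Cyl.ext

lemma anti (f : Cyl K L) {a b : Opens K} (h : a ≤ b) : f.1 b ≤ f.1 a := by
  have := f.2.2.1 a b
  rw [sup_eq_right.2 h] at this
  rw [this]
  exact inf_le_left

lemma round (f : Cyl K L) (a : Opens K) :
    f.1 a = ⨆ (b : Opens K) (_ : closure (a : Set K) ⊆ b), f.1 b :=
  le_antisymm (f.2.2.2 a) (iSup₂_le fun _ h => f.anti (subset_closure.trans h))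

/-- Distributivity turns a meet of two suprema into a supremum over pairs, so roundness of a meet
can be checked on one pair of enlarged opens. -/
lemma round_inf {x y z : L} {P Q : Opens K → Prop} {g h : Opens K → L}
    (hx : x ≤ ⨆ (b : Opens K) (_ : P b), g b) (hy : y ≤ ⨆ (c : Opens K) (_ : Q c), h c)
    (H : ∀ b c, P b → Q c → g b ⊓ h c ≤ z) : x ⊓ y ≤ z := by
  refine (inf_le_inf hx hy).trans ?_
  simp only [iSup_inf_eq, inf_iSup_eq]
  exact iSup₂_le fun c hc => iSup₂_le fun b hb => H b c hb hc

/-- The union of the opens of `K` in a list of pairs. -/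
def cov {A : Type*} (l : List (A × Opens K)) : Opens K := (l.map Prod.snd).foldr (· ⊔ ·) ⊥

/-- The meet of the values of the pairs in a list. -/
def val {A : Type*} (e : A → Opens K → L) (l : List (A × Opens K)) : L :=
  (l.map fun p => e p.1 p.2).foldr (· ⊓ ·) ⊤

section
variable {A : Type*} (e : A → Opens K → L)

@[simp] lemma cov_nil : cov ([] : List (A × Opens K)) = ⊥ := rfl
@[simp] lemma val_nil : val e [] = ⊤ := rfl
@[simp] lemma cov_cons (p : A × Opens K) (l) : cov (p :: l) = p.2 ⊔ cov l := rfl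
@[simp] lemma val_cons (p : A × Opens K) (l) : val e (p :: l) = e p.1 p.2 ⊓ val e l := rfl

lemma cov_append (l l' : List (A × Opens K)) : cov (l ++ l') = cov l ⊔ cov l' := by
  induction l with
  | nil => simp
  | cons p l ih => simp [ih, sup_assoc]

lemma val_append (l l' : List (A × Opens K)) : val e (l ++ l') = val e l ⊓ val e l' := by
  induction l with
  | nil => simp
  | cons p l ih => simp [ih, inf_assoc]

/-- The value at `a` of the join of a family. -/
def supVal (a : Opens K) : L := ⨆ (l : List (A × Opens K)) (_ : a ≤ cov l), val e l

lemma le_supVal {a : Opens K} (l : List (A × Opens K)) (h : a ≤ cov l) : val e l ≤ supVal e a :=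
  le_iSup₂_of_le l h le_rfl

lemma map_supVal (g : FrameHom L M) (a : Opens K) :
    g (supVal e a) = supVal (fun i b => g (e i b)) a := by
  have : ∀ l, g (val e l) = val (fun i b => g (e i b)) l := fun l => by
    induction l with
    | nil => simp
    | cons p l ih => simp [ih]
  simp only [supVal, map_iSup, this]

/-- Enlarge the opens of the list one at a time; closure commutes with the finite union `cov l`.
This makes joins round. -/
lemma val_le_round (he : ∀ i (a : Opens K),
      e i a ≤ ⨆ (b : Opens K) (_ : closure (a : Set K) ⊆ b), e i b) (l : List (A × Opens K)) :
    val e l ≤ ⨆ (l' : List (A × Opens K)) (_ : closure (cov l : Set K) ⊆ cov l'), val e l' := by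
  induction l with
  | nil => exact le_iSup₂_of_le [] (by simp) le_rfl
  | cons p l ih =>
    refine (inf_le_inf (he p.1 p.2) ih).trans ?_
    simp only [iSup_inf_eq, inf_iSup_eq]
    refine iSup₂_le fun l' hl' => iSup₂_le fun b hb =>
      le_iSup₂_of_le ((p.1, b) :: l') ?_ le_rfl
    simp only [cov_cons, Opens.coe_sup, closure_union]
    exact Set.union_subset_union hb hl'

end

/-- The join of a set of open sublocales of `L × K`. -/
def sup (A : Set (Cyl K L)) : Cyl K L :=
  -- Finite lists are the right choice when `K` is compact: a tube over `closure a` inside a union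
  -- of opens is covered by finitely many tubes inside the members.
  ⟨supVal fun (f : A) => f.1.1,
    top_unique (le_supVal _ [] bot_le),
    fun a b => le_antisymm
      (le_inf (iSup₂_le fun l h => le_supVal _ l (le_sup_left.trans h))
        (iSup₂_le fun l h => le_supVal _ l (le_sup_right.trans h)))
      (by
        simp only [supVal, iSup_inf_eq, inf_iSup_eq]
        refine iSup₂_le fun l' hl' => iSup₂_le fun l hl => ?_
        rw [← val_append]
        exact le_supVal _ _ (by rw [cov_append]; exact sup_le_sup hl hl')),
    fun a => iSup₂_le fun l hl =>
      (val_le_round _ (fun f => f.1.2.2.2) l).trans (iSup₂_le fun l' hl' =>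
        le_iSup₂_of_le (cov l') ((closure_mono hl).trans hl') (le_supVal _ l' le_rfl))⟩

instance : Frame (Cyl K L) :=
  frameOfSup _ ⟨fun _ => ⊤, rfl, by simp, fun a => le_iSup₂_of_le ⊤ (Set.subset_univ _) le_rfl⟩
    (fun f => show f.1 ≤ _ from fun _ => le_top)
    (fun f g => ⟨fun a => f.1 a ⊓ g.1 a, by simp [f.2.1, g.2.1], fun a b => by
        rw [f.2.2.1, g.2.2.1]; exact inf_inf_inf_comm _ _ _ _,
      fun a => round_inf (f.2.2.2 a) (g.2.2.2 a) fun b c hb hc =>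
        le_iSup₂_of_le (b ⊓ c) (Set.subset_inter hb hc)
          (inf_le_inf (f.anti inf_le_left) (g.anti inf_le_right))⟩)
    (fun f g a => inf_le_left) (fun f g a => inf_le_right)
    (fun f g h h₁ h₂ a => le_inf (h₁ a) (h₂ a))
    sup
    (fun A => ⟨fun f hf a => by
        refine le_trans ?_ (le_supVal _ [(⟨f, hf⟩, a)] (by simp))
        simp,
      fun g hg a => iSup₂_le fun l hl => by
        refine le_trans ?_ (g.anti hl)
        clear hl
        induction l with
        | nil => simp [g.2.1]
        | cons p l ih =>
          rw [val_cons, cov_cons, g.2.2.1]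
          exact inf_le_inf (hg p.1.2 _) ih⟩)
    (fun f A g h a => by
      change f.1 a ⊓ supVal _ a ≤ g.1 a
      simp only [supVal, inf_iSup_eq]
      refine iSup₂_le fun l hl => ?_
      -- Since `f` is antitone, its value at `a` is below its value at each `a ⊓ p.2`, where `h`
      -- applies; `g` then turns the meets back into the value at a union.
      have key : f.1 a ⊓ val (fun (f : A) => f.1.1) l ≤ g.1 (a ⊓ cov l) := by
        clear hl
        induction l with
        | nil => simp [g.2.1]
        | cons p l ih =>
          rw [val_cons, cov_cons, inf_sup_left, g.2.2.1]
          refine le_inf ?_ ((inf_le_inf_left _ inf_le_right).trans ih)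
          refine le_trans ?_ (h p.1.1 p.1.2 _)
          exact inf_le_inf (f.anti inf_le_left) (inf_le_left.trans (p.1.1.anti inf_le_right))
      rwa [inf_eq_left.2 hl] at key)

lemma inf_apply (f g : Cyl K L) (a : Opens K) : (f ⊓ g).1 a = f.1 a ⊓ g.1 a := rfl
lemma top_apply (a : Opens K) : (⊤ : Cyl K L).1 a = ⊤ := rfl
lemma sSup_apply (A : Set (Cyl K L)) (a : Opens K) :
    (sSup A).1 a = supVal (fun f : A => f.1.1) a := rfl

/-- Lists over `A` give lists over `B` with the same cover and value, and surjectivity lifts lists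
back. This compares a join over a set with the join over its image. -/
lemma supVal_image {A B : Type*} (e : B → Opens K → L) (h : A → B) (hs : Function.Surjective h)
    (a : Opens K) : supVal (fun i => e (h i)) a = supVal e a := by
  have h1 : ∀ l : List (A × Opens K), cov (l.map fun p => (h p.1, p.2)) = cov l := fun l => by
    induction l with
    | nil => rfl
    | cons p l ih => simp [ih]
  have h2 : ∀ l : List (A × Opens K),
      val e (l.map fun p => (h p.1, p.2)) = val (fun i => e (h i)) l := fun l => by
    induction l with
    | nil => rfl
    | cons p l ih => simp [ih]
  refine le_antisymm (iSup₂_le fun l hl => ?_) (iSup₂_le fun l hl => ?_)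
  · rw [← h2]
    exact le_supVal _ _ (by rwa [h1])
  · obtain ⟨l, rfl⟩ : ∃ l' : List (A × Opens K), l'.map (fun p => (h p.1, p.2)) = l :=
      ⟨l.map fun p => ((hs p.1).choose, p.2), by
        rw [List.map_map]
        conv_rhs => rw [← List.map_id l]
        exact List.map_congr_left fun p _ => Prod.ext (hs p.1).choose_spec rfl⟩
    rw [h2]
    exact le_supVal _ _ (by rwa [← h1])

/-- Postcomposition with a frame homomorphism. -/
def mapFun (g : FrameHom L M) (f : Cyl K L) : Cyl K M :=
  ⟨fun a => g (f.1 a), by rw [f.2.1, map_top], fun a b => by rw [f.2.2.1, map_inf],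
    fun a => by
      rw [f.round]
      simp only [map_iSup]
      exact le_rfl⟩

/-- Functoriality of `Cyl K L` in the frame `L`. -/
def map (g : FrameHom L M) : FrameHom (Cyl K L) (Cyl K M) where
  toFun := mapFun g
  map_inf' f f' := Cyl.ext (funext fun a => map_inf g _ _)
  map_top' := Cyl.ext (funext fun a => map_top g)
  map_sSup' A := Cyl.ext (funext fun a => by
    change g (supVal _ a) = _
    rw [map_supVal]
    exact supVal_image (fun f : (mapFun g '' A : Set (Cyl K M)) => f.1.1)
      (fun f : A => ⟨_, f.1, f.2, rfl⟩)
      (by rintro ⟨_, f, hf, rfl⟩; exact ⟨⟨f, hf⟩, rfl⟩) a)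

variable (K L) in
/-- The open sublocales `x × K`. -/
def inl : FrameHom L (Cyl K L) where
  -- The second term raises the value at the empty open to `⊤`, since a product with the empty set
  -- lies in every open sublocale.
  toFun x := ⟨fun a => x ⊔ ⨆ _ : a = ⊥, ⊤, by simp, fun a b => by
      rw [← sup_inf_left]
      by_cases ha : a = ⊥ <;> by_cases hb : b = ⊥ <;> simp [ha, hb],
    fun a => by
      by_cases ha : a = ⊥
      · subst ha
        exact le_iSup₂_of_le ⊥ (by simp) le_rfl
      · simp only [ha, iSup_false, sup_bot_eq]
        exact le_iSup₂_of_le ⊤ (Set.subset_univ _) le_sup_left⟩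
  map_inf' x y := Cyl.ext (funext fun a => sup_inf_right _ _ _)
  map_top' := Cyl.ext (funext fun a => by simp [top_apply])
  map_sSup' A := by
    refine le_antisymm (fun a => ?_) (sSup_le ?_)
    · rw [sSup_apply]
      refine sup_le (sSup_le fun x hx => ?_) (iSup_le ?_)
      · refine le_trans ?_ (le_supVal _ [(⟨_, x, hx, rfl⟩, a)] (by simp))
        simp
      · rintro rfl
        exact le_supVal _ [] le_rfl
    · rintro _ ⟨x, hx, rfl⟩ a
      exact sup_le_sup_right (le_sSup hx) _

lemma inl_apply (x : L) (a : Opens K) : (inl K L x).1 a = x ⊔ ⨆ _ : a = ⊥, ⊤ := rfl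

/-! ### Rectangles and the universal property of the cylinder -/

section CompactHausdorff

variable [CompactSpace K] [T2Space K]

lemma exists_between {a : Set K} {b : Opens K} (h : closure a ⊆ b) :
    ∃ c : Opens K, closure a ⊆ c ∧ closure (c : Set K) ⊆ b := by
  obtain ⟨U, hU, hs, h'⟩ := normal_exists_closure_subset isClosed_closure b.2 h
  exact ⟨⟨U, hU⟩, hs, h'⟩

omit [T2Space K] in
/-- A cover of a closed set is refined by a finite cover by opens whose closures are contained in
members of the cover. -/
lemma exists_list_cover {A : Type*} {a : Set K} (P : A → Opens K → Prop)
    (h : ∀ k ∈ closure a, ∃ i b, P i b ∧ k ∈ b) :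
    ∃ l : List (A × Opens K), closure a ⊆ cov l ∧ ∀ p ∈ l, P p.1 p.2 := by
  refine isClosed_closure.isCompact.induction_on
    (p := fun s : Set K => ∃ l : List (A × Opens K), s ⊆ (cov l : Set K) ∧ ∀ p ∈ l, P p.1 p.2)
    ⟨[], by simp, by simp⟩ (fun s t hst ⟨l, hl, h⟩ => ⟨l, hst.trans hl, h⟩)
    (fun s t ⟨l, hl, h⟩ ⟨l', hl', h'⟩ => ⟨l ++ l', by
        rw [cov_append]; exact Set.union_subset_union hl hl', fun p hp =>
        (List.mem_append.1 hp).elim (h p) (h' p)⟩)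
    fun k hk => ?_
  obtain ⟨i, b, hP, hb⟩ := h k hk
  exact ⟨b, mem_nhdsWithin_of_mem_nhds (b.2.mem_nhds hb), [(i, b)], by simp, by simpa using hP⟩

omit [CompactSpace K] [T2Space K] in
lemma val_eq_top {A : Type*} {e : A → Opens K → L} {l : List (A × Opens K)}
    (h : ∀ p ∈ l, e p.1 p.2 = ⊤) : val e l = ⊤ := by
  induction l with
  | nil => rfl
  | cons p l ih =>
    rw [val_cons, h p (by simp), ih fun q hq => h q (by simp [hq]), inf_top_eq]

variable (K L) in
/-- The open sublocale `L × V`. -/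
def strip (V : Opens K) : Cyl K L :=
  ⟨fun a => ⨆ _ : closure (a : Set K) ⊆ V, ⊤, by simp, fun a b => by
      simp only [Opens.coe_sup, closure_union, Set.union_subset_iff]
      by_cases ha : closure (a : Set K) ⊆ V <;> by_cases hb : closure (b : Set K) ⊆ V <;>
        simp [ha, hb],
    fun a => iSup_le fun h => by
      obtain ⟨c, h1, h2⟩ := exists_between h
      exact le_iSup₂_of_le c h1 (le_iSup_of_le h2 le_rfl)⟩

variable (K L) in
/-- The open sublocales `L × V`. -/
def inr : FrameHom (Opens K) (Cyl K L) where
  toFun := strip K L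
  map_inf' V W := Cyl.ext (funext fun a => by
    change _ = (⨆ _, ⊤) ⊓ (⨆ _, ⊤)
    simp only [strip, Opens.coe_inf, Set.subset_inter_iff]
    by_cases ha : closure (a : Set K) ⊆ V <;> by_cases hb : closure (a : Set K) ⊆ W <;>
        simp [ha, hb])
  map_top' := Cyl.ext (funext fun a => by simp [top_apply, strip])
  map_sSup' A := by
    refine le_antisymm (fun a => iSup_le fun h => ?_) (sSup_le ?_)
    · rw [sSup_apply]
      obtain ⟨l, h1, h2⟩ := exists_list_cover (a := (a : Set K))
        (P := fun (f : (strip K L '' A : Set (Cyl K L))) b => f.1.1 b = ⊤) (fun k hk => by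
        have := h hk
        simp only [Opens.coe_sSup, Set.mem_iUnion] at this
        obtain ⟨V, hV, hk⟩ := this
        obtain ⟨c, hc1, hc2⟩ := exists_between (a := {k}) (b := V) (by simpa using hk)
        refine ⟨⟨_, V, hV, rfl⟩, c, ?_, by simpa using hc1⟩
        simp [hc2, strip])
      exact (val_eq_top (e := fun f : (strip K L '' A : Set (Cyl K L)) => f.1.1) h2).ge.trans
        (le_supVal _ l (subset_closure.trans h1))
    · rintro _ ⟨V, hV, rfl⟩ a
      exact iSup_mono' fun h => ⟨h.trans (by exact le_sSup (a := V) hV), le_rfl⟩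

lemma inr_apply (V : Opens K) (a : Opens K) :
    (inr K L V).1 a = ⨆ _ : closure (a : Set K) ⊆ V, ⊤ := rfl

/-- By roundness an open sublocale is the union of the rectangles `f a × a`. Hence the two factors
generate the frame, which gives uniqueness in the product property. -/
lemma eq_iSup (f : Cyl K L) : f = ⨆ a : Opens K, inl K L (f.1 a) ⊓ inr K L a := by
  refine le_antisymm (fun a => ?_) (iSup_le fun b a => ?_)
  · rw [f.round]
    refine iSup₂_le fun b hb => ?_
    have h : inl K L (f.1 b) ⊓ inr K L b ≤ ⨆ a : Opens K, inl K L (f.1 a) ⊓ inr K L a :=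
      le_iSup (fun a => inl K L (f.1 a) ⊓ inr K L a) b
    refine le_trans ?_ (h a)
    rw [inf_apply, inr_apply, inl_apply]
    simp [hb]
  · rw [inf_apply, inr_apply, inl_apply]
    simp only [inf_iSup_eq]
    refine iSup_le fun h => inf_le_left.trans (sup_le (f.anti (subset_closure.trans h))
      (iSup_le ?_))
    rintro rfl
    rw [f.2.1]

/-- The copairing of frame homomorphisms from `L` and from the opens of `K`. -/
def desc (g : FrameHom L M) (h : FrameHom (Opens K) M) : FrameHom (Cyl K L) M where
  toFun f := ⨆ a, g (f.1 a) ⊓ h a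
  map_top' := top_unique (le_iSup_of_le ⊤ (by simp [top_apply]))
  map_inf' f f' := by
    apply le_antisymm
    · exact iSup_le fun a => le_inf
        (le_iSup_of_le a (inf_le_inf_right _ (OrderHomClass.mono g inf_le_left)))
        (le_iSup_of_le a (inf_le_inf_right _ (OrderHomClass.mono g inf_le_right)))
    · simp only [iSup_inf_eq, inf_iSup_eq]
      refine iSup_le fun b => iSup_le fun a => le_iSup_of_le (a ⊓ b) ?_
      rw [inf_inf_inf_comm, inf_apply, map_inf, map_inf]
      exact inf_le_inf_right _ (inf_le_inf (OrderHomClass.mono g (f.anti inf_le_left))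
        (OrderHomClass.mono g (f'.anti inf_le_right)))
  map_sSup' A := by
    apply le_antisymm
    · refine iSup_le fun a => ?_
      rw [sSup_apply, map_supVal]
      simp only [supVal, iSup_inf_eq]
      refine iSup₂_le fun l hl => (inf_le_inf_left _ (OrderHomClass.mono h hl)).trans ?_
      clear hl
      induction l with
      | nil => simp
      | cons p l ih =>
        rw [val_cons, cov_cons, map_sup, inf_sup_left]
        refine sup_le ?_ ((inf_le_inf_right _ inf_le_right).trans ih)
        refine (inf_le_inf_right _ inf_le_left).trans (le_trans ?_ (le_sSup ⟨p.1.1, p.1.2, rfl⟩))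
        exact le_iSup (fun a => g (p.1.1.1 a) ⊓ h a) p.2
    · refine sSup_le ?_
      rintro _ ⟨f, hf, rfl⟩
      have := le_sSup hf
      exact iSup_mono fun a => inf_le_inf_right _ (OrderHomClass.mono g (this a))

omit [CompactSpace K] [T2Space K] in
lemma desc_apply (g : FrameHom L M) (h : FrameHom (Opens K) M) (f : Cyl K L) :
    desc g h f = ⨆ a, g (f.1 a) ⊓ h a := rfl

omit [CompactSpace K] [T2Space K] in
lemma desc_inl (g : FrameHom L M) (h : FrameHom (Opens K) M) (x : L) :
    desc g h (inl K L x) = g x := by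
  rw [desc_apply]
  refine le_antisymm (iSup_le fun a => ?_) (le_iSup_of_le ⊤ (by simp [inl_apply]))
  by_cases ha : a = ⊥
  · simp [ha]
  · simp [inl_apply, ha]

lemma desc_inr (g : FrameHom L M) (h : FrameHom (Opens K) M) (V : Opens K) :
    desc g h (inr K L V) = h V := by
  rw [desc_apply]
  -- Regularity of `K`. It is needed because the strip over `V` only sees opens whose closure lies
  -- in `V`.
  have hV : V = sSup { a : Opens K | closure (a : Set K) ⊆ V } := by
    refine le_antisymm (fun k hk => ?_) (sSup_le fun a ha => subset_closure.trans ha)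
    obtain ⟨c, hc1, hc2⟩ := exists_between (a := {k}) (b := V) (by simpa using hk)
    exact Opens.mem_sSup.2 ⟨c, hc2, by simpa using hc1⟩
  refine le_antisymm (iSup_le fun a => ?_) ?_
  · by_cases ha : closure (a : Set K) ⊆ V
    · simpa [inr_apply, ha] using OrderHomClass.mono h (show a ≤ V from subset_closure.trans ha)
    · simp [inr_apply, ha]
  · conv_lhs => rw [hV]
    rw [map_sSup, sSup_image]
    exact iSup₂_le fun a ha => le_iSup_of_le a (by
      rw [inr_apply]
      simp [show closure (a : Set K) ⊆ V from ha])

lemma hom_ext {f g : FrameHom (Cyl K L) M} (h₁ : ∀ x, f (inl K L x) = g (inl K L x))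
    (h₂ : ∀ V, f (inr K L V) = g (inr K L V)) : f = g := by
  ext x
  rw [eq_iSup x]
  simp only [map_iSup, map_inf, h₁, h₂]

end CompactHausdorff

end Cyl

end Cylinder

/-! ### Products with compact Hausdorff spaces, and their exponentiability -/

section Product

/-- The locale of a space. -/
abbrev Om (T : TopCat.{u}) : Locale.{u} := topToLocale.obj T

variable (K : TopCat.{u}) [CompactSpace K] [T2Space K]

/-- `Cyl K X` as a locale. -/
def cylObj (X : Locale.{u}) : Locale.{u} := Locale.of (Cyl K X)

/-- The projection to the first factor. -/
def cylFst (X : Locale.{u}) : cylObj K X ⟶ X := mkHom (X := cylObj K X) (Cyl.inl K X)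

/-- The projection to the second factor. -/
def cylSnd (X : Locale.{u}) : cylObj K X ⟶ Om K :=
  mkHom (X := cylObj K X) (Y := Om K) (Cyl.inr K X)

/-- Functoriality in the first factor. -/
def cylMap {X Y : Locale.{u}} (g : X ⟶ Y) : cylObj K X ⟶ cylObj K Y :=
  mkHom (X := cylObj K X) (Y := cylObj K Y) (Cyl.map (pull g))

/-- `Cyl K X` is the product of `X` and `K`. -/
def cylFanIsLimit (X : Locale.{u}) : IsLimit (BinaryFan.mk (cylFst K X) (cylSnd K X)) :=
  BinaryFan.IsLimit.mk _
    (fun {T} f g => mkHom (Y := cylObj K X) (Cyl.desc (pull f) (pull g)))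
    (fun f g => hom_ext_pull fun x => Cyl.desc_inl _ _ x)
    (fun f g => hom_ext_pull fun V => Cyl.desc_inr _ _ V)
    (fun {T} f g m h₁ h₂ => by
      apply hom_ext_pull
      refine fun y => DFunLike.congr_fun (?_ : pull m = Cyl.desc (pull f) (pull g)) y
      refine Cyl.hom_ext (fun x => ?_) (fun V => ?_)
      · exact Eq.trans (by rw [← h₁]; rfl) (Cyl.desc_inl (pull f) (pull g) x).symm
      · exact Eq.trans (by rw [← h₂]; rfl) (Cyl.desc_inr (pull f) (pull g) V).symm)

/-- The isomorphism between the chosen product and `Cyl K X`. -/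
def prodIsoCyl (X : Locale.{u}) : X ⨯ Om K ≅ cylObj K X :=
  (prodIsProd X (Om K)).conePointUniqueUpToIso (cylFanIsLimit K X)

lemma prodIsoCyl_fst (X : Locale.{u}) : (prodIsoCyl K X).hom ≫ cylFst K X = prod.fst :=
  (prodIsProd X (Om K)).conePointUniqueUpToIso_hom_comp (cylFanIsLimit K X) ⟨.left⟩

lemma prodIsoCyl_snd (X : Locale.{u}) : (prodIsoCyl K X).hom ≫ cylSnd K X = prod.snd :=
  (prodIsProd X (Om K)).conePointUniqueUpToIso_hom_comp (cylFanIsLimit K X) ⟨.right⟩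

omit [CompactSpace K] [T2Space K] in
lemma cylMap_fst {X Y : Locale.{u}} (g : X ⟶ Y) : cylMap K g ≫ cylFst K Y = cylFst K X ≫ g :=
  hom_ext_pull fun y => Cyl.ext (funext fun a => by
    change pull g (y ⊔ ⨆ _, ⊤) = pull g y ⊔ ⨆ _, ⊤
    simp only [map_sup, map_iSup, map_top])

lemma cylMap_snd {X Y : Locale.{u}} (g : X ⟶ Y) : cylMap K g ≫ cylSnd K Y = cylSnd K X :=
  hom_ext_pull fun V => Cyl.ext (funext fun a => by
    change pull g (⨆ _, ⊤) = (⨆ _, ⊤)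
    simp only [map_iSup, map_top])

lemma prodIsoCyl_naturality {X Y : Locale.{u}} (g : X ⟶ Y) :
    prod.map g (𝟙 (Om K)) ≫ (prodIsoCyl K Y).hom = (prodIsoCyl K X).hom ≫ cylMap K g := by
  refine BinaryFan.IsLimit.hom_ext (cylFanIsLimit K Y) ?_ ?_
  · change (_ ≫ _) ≫ cylFst K Y = (_ ≫ _) ≫ cylFst K Y
    simp only [Category.assoc, prodIsoCyl_fst, cylMap_fst, prod.map_fst]
    rw [← prodIsoCyl_fst, Category.assoc]
  · change (_ ≫ _) ≫ cylSnd K Y = (_ ≫ _) ≫ cylSnd K Y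
    simp only [Category.assoc, prodIsoCyl_snd, cylMap_snd, prod.map_snd, Category.comp_id]

/-- For compact Hausdorff `K`, the functor `Hom(- × K, Y)` on locales is representable. -/
lemma exists_exponential (Y : Locale.{u}) : ∃ (E : Locale.{u}) (ε : E ⨯ Om K ⟶ Y),
    ∀ (X : Locale.{u}) (f : X ⨯ Om K ⟶ Y), ∃! g : X ⟶ E, prod.map g (𝟙 _) ≫ ε = f := by
  -- A map from `X × K` to `Y` is a frame homomorphism from `Y` to `Cyl K X`, that is, a family of
  -- opens of `X` indexed by `Y × Opens K`. The conditions on it are reflected by order-reflecting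
  -- families of homomorphisms, so a universal family exists, and its frame is the exponential.
  let R : ∀ L : Frm.{u}, (Y × Opens K → L) → Prop := fun L φ =>
    ∃ h : FrameHom Y (Cyl K L), ∀ y a, (h y).1 a = φ (y, a)
  obtain ⟨U, η, ⟨η', hη'⟩, hU⟩ := exists_universal_model (G := Y × Opens K) R
    (fun L φ ι M f hf h => by
      have hf' : ∀ x y, (∀ i, f i x = f i y) → x = y := fun x y h =>
        le_antisymm (hf _ _ fun i => (h i).le) (hf _ _ fun i => (h i).ge)
      choose g hg' using h
      have hg : ∀ i y a, (g i y).1 a = f i (φ (y, a)) := hg'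
      let ψ : Y → Cyl K L := fun y => ⟨fun a => φ (y, a),
        hf' _ _ fun i => by rw [← hg, (g i y).2.1, map_top],
        fun a b => hf' _ _ fun i => by rw [map_inf, ← hg, ← hg, ← hg, (g i y).2.2.1],
        fun a => hf _ _ fun i => by
          simp only [map_iSup, ← hg]
          exact (g i y).2.2.2 a⟩
      obtain ⟨φ', h'⟩ := frameHom_sSup_eq_of_reflect ψ (fun i => Frm.of (Cyl K (M i)))
        (fun i => Cyl.map (f i))
        (fun x y h => Cyl.ext (funext fun a => hf' _ _ fun i =>
          congrArg (fun z : Cyl K (M i) => z.1 a) (h i)))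
        g (fun i x => Cyl.ext (funext fun a => hg i x a))
      exact ⟨φ', fun y a => by rw [h']⟩)
  let E : Locale.{u} := Opposite.op U
  let ε : cylObj K E ⟶ Y := mkHom (X := cylObj K E) η'
  refine ⟨E, (prodIsoCyl K E).hom ≫ ε, fun X f => ?_⟩
  let h : cylObj K X ⟶ Y := (prodIsoCyl K X).inv ≫ f
  have hh : f = (prodIsoCyl K X).hom ≫ h := ((prodIsoCyl K X).hom_inv_id_assoc f).symm
  have hiff : ∀ g : X ⟶ E, prod.map g (𝟙 _) ≫ (prodIsoCyl K E).hom ≫ ε = f ↔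
      ∀ p : Y × Opens K, pull g (η p) = (show Cyl K X from pull h p.1).1 p.2 := by
    intro g
    rw [hh, ← Category.assoc, prodIsoCyl_naturality, Category.assoc, cancel_epi]
    constructor
    · rintro H ⟨y, a⟩
      rw [← hη']
      exact congrArg (fun z => (show Cyl K X from pull z y).1 a) H
    · intro H
      refine hom_ext_pull fun y => Cyl.ext (funext fun a => ?_)
      refine Eq.trans ?_ (H (y, a))
      rw [← hη']
      rfl
  obtain ⟨k, hk, hk'⟩ := hU (Opposite.unop X)
    (fun p => (show Cyl K X from pull h p.1).1 p.2) ⟨pull h, fun _ _ => rfl⟩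
  refine ⟨mkHom (Y := E) k, (hiff _).2 hk, fun g hg => ?_⟩
  exact hom_ext_pull fun y => DFunLike.congr_fun (hk' (pull g) ((hiff g).1 hg)) y

/-- Compact Hausdorff spaces are exponentiable in locales. -/
theorem isExponentiable_of_compactHausdorff : IsExponentiable (Om K) := by
  -- A right adjoint exists once each category of arrows into a fixed `Y` has a terminal object;
  -- evaluation is this object.
  have key : ∀ Y : Locale.{u}, HasTerminal (CostructuredArrow (prod.functor.flip.obj (Om K)) Y) := by
    intro Y
    obtain ⟨E, ε, h⟩ := exists_exponential K Y
    have h' : ∀ A : CostructuredArrow (prod.functor.flip.obj (Om K)) Y, ∃! g : A.left ⟶ E,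
        (prod.functor.flip.obj (Om K)).map g ≫ ε = A.hom := fun A => h A.left A.hom
    refine (IsTerminal.ofUniqueHom (Y := CostructuredArrow.mk (S := prod.functor.flip.obj (Om K)) ε)
      (fun A => CostructuredArrow.homMk (h' A).choose (h' A).choose_spec.1)
      (fun A m => ?_)).hasTerminal
    ext
    exact (h' A).choose_spec.2 m.left (CostructuredArrow.w m)
  exact isLeftAdjoint_of_costructuredArrowTerminals _

end Product

/-! ### From spaces to locales: products with compact Hausdorff spaces -/

section Spaces

lemma isIso_mkHom_of_bijective {X Y : Locale.{u}} (f : FrameHom Y X) (hf : Function.Bijective f) :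
    IsIso (mkHom f) := by
  let e : Y ≃o X :=
    { toEquiv := Equiv.ofBijective f hf
      map_rel_iff' := le_iff_of_injective f hf.1 }
  refine ⟨mkHom (e.symm : FrameHom X Y), hom_ext_pull fun x => ?_, hom_ext_pull fun x => ?_⟩
  · exact e.apply_symm_apply x
  · exact e.symm_apply_apply x

variable (K T : TopCat.{u})

/-- The product of two spaces. -/
abbrev prodSpace : TopCat.{u} := TopCat.of (T × K)

/-- The first projection. -/
abbrev fstMap : prodSpace K T ⟶ T := TopCat.ofHom ⟨Prod.fst, continuous_fst⟩

/-- The second projection. -/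
abbrev sndMap : prodSpace K T ⟶ K := TopCat.ofHom ⟨Prod.snd, continuous_snd⟩

variable [CompactSpace K] [T2Space K]

/-- Injectivity is the tube lemma: if the rectangles of `g` cover a slice over `closure a`, finitely
many of them do. Surjectivity holds because rectangles form a base, even those whose second side has
its closure inside the given open. -/
lemma bijective_desc_comap : Function.Bijective
    (Cyl.desc (Opens.comap (fstMap K T).hom) (Opens.comap (sndMap K T).hom) :
      FrameHom (Cyl K (Opens T)) (Opens (T × K))) := by
  have hmem : ∀ (f : Cyl K (Opens T)) (p : T × K),
      p ∈ (Cyl.desc (Opens.comap (fstMap K T).hom) (Opens.comap (sndMap K T).hom) :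
      FrameHom (Cyl K (Opens T)) (Opens (T × K))) f ↔ ∃ a, p.1 ∈ f.1 a ∧ p.2 ∈ a := by
    intro f p
    rw [Cyl.desc_apply, Opens.mem_iSup]
    rfl
  constructor
  · have hle : ∀ f g : Cyl K (Opens T), (∀ p : T × K, (∃ a, p.1 ∈ f.1 a ∧ p.2 ∈ a) →
        ∃ a, p.1 ∈ g.1 a ∧ p.2 ∈ a) → f ≤ g := by
      intro f g h a t ht
      rw [f.round] at ht
      simp only [Opens.mem_iSup] at ht
      obtain ⟨b, hb, ht⟩ := ht
      obtain ⟨l, h1, h2⟩ := Cyl.exists_list_cover (A := Unit) (a := (a : Set K))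
        (P := fun _ c => t ∈ g.1 c) (fun k hk => by
          obtain ⟨c, hc⟩ := h (t, k) ⟨b, ht, hb hk⟩
          exact ⟨(), c, hc⟩)
      refine g.anti (subset_closure.trans h1 : a ≤ Cyl.cov l) ?_
      clear h1
      induction l with
      | nil => simp [g.2.1]
      | cons p l ih =>
        rw [Cyl.cov_cons, g.2.2.1]
        exact ⟨h2 p (by simp), ih fun q hq => h2 q (by simp [hq])⟩
    intro f g h
    have h' : ∀ p : T × K, (∃ a, p.1 ∈ f.1 a ∧ p.2 ∈ a) ↔ ∃ a, p.1 ∈ g.1 a ∧ p.2 ∈ a := fun p => by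
      rw [← hmem, ← hmem, h]
    exact le_antisymm (hle _ _ fun p => (h' p).1) (hle _ _ fun p => (h' p).2)
  · intro W
    refine ⟨sSup { f | ∀ p : T × K, (∃ a, p.1 ∈ f.1 a ∧ p.2 ∈ a) → p ∈ W }, ?_⟩
    rw [map_sSup]
    refine le_antisymm (sSup_le ?_) fun p hp => ?_
    · rintro _ ⟨f, hf, rfl⟩ p hp
      exact hf p ((hmem f p).1 hp)
    · obtain ⟨U, V, hU, hV, h1, h2, h3⟩ := isOpen_prod_iff.1 W.2 p.1 p.2 hp
      obtain ⟨c, hc1, hc2⟩ := Cyl.exists_between (a := {p.2}) (b := ⟨V, hV⟩) (by simpa using h2)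
      refine Opens.mem_sSup.2 ⟨_, ⟨Cyl.inl K (Opens T) ⟨U, hU⟩ ⊓ Cyl.inr K (Opens T) ⟨V, hV⟩, ?_, rfl⟩, ?_⟩
      · rintro ⟨t, k⟩ ⟨a, ⟨h4, h5⟩, h6⟩
        simp only [Cyl.inl_apply, Cyl.inr_apply, Opens.coe_sup, SetLike.mem_coe, Opens.mem_iSup,
          Set.mem_union] at h4 h5
        refine h3 ⟨?_, h5.1 (subset_closure h6)⟩
        rcases h4 with h4 | ⟨rfl, h4⟩
        · exact h4
        · exact absurd h6 (by simp)
      · rw [hmem]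
        refine ⟨c, ⟨?_, ?_⟩, by simpa using hc1⟩
        · rw [Cyl.inl_apply]
          exact Or.inl h1
        · rw [Cyl.inr_apply]
          simp only [SetLike.mem_coe, Opens.mem_iSup]
          exact ⟨hc2, trivial⟩

/-- The functor from spaces to locales preserves products with compact Hausdorff spaces. -/
def spaceFanIsLimit : IsLimit (BinaryFan.mk (topToLocale.map (fstMap K T))
    (topToLocale.map (sndMap K T))) := by
  let t : BinaryFan (Om T) (Om K) :=
    BinaryFan.mk (topToLocale.map (fstMap K T)) (topToLocale.map (sndMap K T))
  have : IsIso ((cylFanIsLimit K (Om T)).lift t) :=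
    isIso_mkHom_of_bijective (X := Om (prodSpace K T)) (Y := cylObj K (Om T)) _
      (bijective_desc_comap K T)
  exact IsLimit.ofPointIso (cylFanIsLimit K (Om T))

end Spaces

/-! ### Closed sublocales -/

/-- `c` is the inclusion of the closed complement of `u`. -/
structure IsClosedImm {C Z : Locale.{u}} (c : C ⟶ Z) (u : Z) : Prop where
  surjective : Function.Surjective (pull c)
  le_iff : ∀ x y, pull c x ≤ pull c y ↔ x ≤ y ⊔ u

namespace IsClosedImm

variable {C Z : Locale.{u}} {c : C ⟶ Z} {u : Z}

lemma pull_eq_bot (h : IsClosedImm c u) : pull c u = ⊥ := by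
  rw [← le_bot_iff, ← map_bot (pull c), h.le_iff]
  simp

/-- The frame of `C` is the quotient of that of `Z` identifying opens that agree after joining with
`u`. A map killing `u` respects the identification, so its inverse image can be computed on any
chosen preimages `r`. -/
lemma exists_factor (h : IsClosedImm c u) {W : Locale.{u}} (g : W ⟶ Z) (hg : pull g u = ⊥) :
    ∃ k : W ⟶ C, k ≫ c = g := by
  have hmono : ∀ x y, pull c x ≤ pull c y → pull g x ≤ pull g y := fun x y hxy => by
    have := OrderHomClass.mono (pull g) ((h.le_iff x y).1 hxy)
    rwa [map_sup, hg, sup_bot_eq] at this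
  have hcong : ∀ x y, pull c x = pull c y → pull g x = pull g y := fun x y hxy =>
    le_antisymm (hmono _ _ hxy.le) (hmono _ _ hxy.ge)
  choose r hr using h.surjective
  refine ⟨mkHom
    { toFun := fun s => pull g (r s)
      map_inf' := fun s t => by
        rw [← map_inf]
        exact hcong _ _ (by rw [hr, map_inf, hr, hr])
      map_top' := by
        rw [← map_top (pull g)]
        exact hcong _ _ (by rw [hr, map_top])
      map_sSup' := fun A => by
        have h : (fun s => pull g (r s)) '' A = pull g '' (r '' A) := Set.image_comp _ _ _
        rw [h, ← map_sSup (pull g) (r '' A)]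
        exact hcong _ _ (by
          rw [hr, map_sSup, ← Set.image_comp]
          congr 1
          conv_lhs => rw [← Set.image_id A]
          exact Set.image_congr fun s _ => (hr s).symm) }, ?_⟩
  exact hom_ext_pull fun z => hcong _ _ (hr _)

lemma mono (h : IsClosedImm c u) : Mono c := ⟨fun {W} k k' hk => hom_ext_pull fun s => by
  obtain ⟨z, rfl⟩ := h.surjective s
  exact congrArg (fun f => pull f z) hk⟩

/-- The opens above `u` form a frame, and joining with `u` is the quotient map onto it. Its bottom
is `u`, hence the extra `u` in the joins. -/
lemma exists_closedImm (Z : Locale.{u}) (u : Z) : ∃ (C : Locale.{u}) (c : C ⟶ Z), IsClosedImm c u := by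
  let _ : Frame { x : Z // u ≤ x } := frameOfSup _ ⟨⊤, le_top⟩ (fun a => le_top (a := a.1))
    (fun a b => ⟨a.1 ⊓ b.1, le_inf a.2 b.2⟩)
    (fun a b => inf_le_left (a := a.1)) (fun a b => inf_le_right (a := a.1))
    (fun a b c (h : a.1 ≤ b.1) (h' : a.1 ≤ c.1) => show a.1 ≤ b.1 ⊓ c.1 from le_inf h h')
    (fun A => ⟨u ⊔ ⨆ a ∈ A, a.1, le_sup_left⟩)
    (fun A => ⟨fun a ha => show a.1 ≤ u ⊔ ⨆ a ∈ A, a.1 from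
        le_sup_of_le_right (le_iSup₂_of_le a ha le_rfl),
      fun b hb => show u ⊔ ⨆ a ∈ A, a.1 ≤ b.1 from sup_le b.2 (iSup₂_le fun a ha => hb ha)⟩)
    (fun a A c h => show a.1 ⊓ (u ⊔ ⨆ b ∈ A, b.1) ≤ c.1 by
      rw [inf_sup_left, inf_iSup₂_eq]
      exact sup_le (inf_le_right.trans c.2) (iSup₂_le fun b hb => h b hb))
  refine ⟨Locale.of { x : Z // u ≤ x }, mkHom (X := Locale.of { x : Z // u ≤ x })
    { toFun := fun x => ⟨x ⊔ u, le_sup_right⟩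
      map_inf' := fun x y => Subtype.ext (sup_inf_right x y u)
      map_top' := Subtype.ext (top_sup_eq _)
      map_sSup' := fun A => Subtype.ext ?_ }, ?_, ?_⟩
  · change _ = u ⊔ ⨆ a ∈ _, (a : { x : Z // u ≤ x }).1
    apply le_antisymm
    · refine sup_le (sSup_le fun x hx => le_sup_of_le_right ?_) le_sup_left
      exact le_trans le_sup_left (le_iSup₂_of_le _ ⟨x, hx, rfl⟩ le_rfl)
    · refine sup_le le_sup_right (iSup₂_le ?_)
      rintro _ ⟨x, hx, rfl⟩
      exact sup_le_sup_right (le_sSup hx) _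
  · rintro ⟨x, hx⟩
    exact ⟨x, Subtype.ext (sup_eq_left.2 hx)⟩
  · intro x y
    change x ⊔ u ≤ y ⊔ u ↔ _
    simp

/-- The universal property of closed sublocales characterizes them. -/
lemma of_factor (hu : pull c u = ⊥)
    (h : ∀ {W : Locale.{u}} (g : W ⟶ Z), pull g u = ⊥ → ∃ k : W ⟶ C, k ≫ c = g)
    (hm : Mono c) : IsClosedImm c u := by
  obtain ⟨D, d, hd⟩ := exists_closedImm Z u
  obtain ⟨k, hk⟩ := h d hd.pull_eq_bot
  obtain ⟨l, hl⟩ := hd.exists_factor c hu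
  have hkl : l ≫ k = 𝟙 C := by
    rw [← cancel_mono c, Category.assoc, hk, hl, Category.id_comp]
  have hlk : ∀ s, pull k (pull l s) = s := fun s => by
    have := hd.mono
    have h2 : k ≫ l = 𝟙 D := by
      rw [← cancel_mono d, Category.assoc, hl, hk, Category.id_comp]
    exact congrArg (fun f => pull f s) h2
  constructor
  · intro s
    obtain ⟨z, hz⟩ := hd.surjective (pull k s)
    refine ⟨z, ?_⟩
    rw [← hl, pull_comp, hz]
    exact congrArg (fun f => pull f s) hkl
  · intro x y
    rw [← hd.le_iff]
    constructor
    · intro hxy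
      have := OrderHomClass.mono (pull k) hxy
      rw [← hk]
      exact this
    · intro hxy
      have := OrderHomClass.mono (pull l) hxy
      rw [← hl]
      exact this

/-- A map into `X ⨯ Z` factors through the closed sublocale exactly when its second component does,
so the universal property is stable under products. This makes the gluing and coproduct axioms
available for every locale `X`. -/
lemma prodMap (h : IsClosedImm c u) (X : Locale.{u}) :
    IsClosedImm (prod.map (𝟙 X) c) (pull (prod.snd : X ⨯ Z ⟶ Z) u) := by
  have := h.mono
  refine of_factor ?_ ?_ inferInstance
  · rw [← pull_comp, prod.map_snd, pull_comp, h.pull_eq_bot, map_bot]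
  · intro W g hg
    obtain ⟨k, hk⟩ := h.exists_factor (g ≫ prod.snd) hg
    refine ⟨prod.lift (g ≫ prod.fst) k, ?_⟩
    apply Limits.prod.hom_ext
    · rw [Category.assoc, prod.map_fst, Category.comp_id, prod.lift_fst]
    · rw [Category.assoc, prod.map_snd, prod.lift_snd_assoc, hk]

/-- Gluing of morphisms along a cover by two closed sublocales. -/
lemma existsUnique_glue {A B Z T : Locale.{u}} {a : A ⟶ Z} {b : B ⟶ Z} {u v : Z}
    (ha : IsClosedImm a u) (hb : IsClosedImm b v) (huv : u ⊓ v = ⊥) (s : A ⟶ T) (t : B ⟶ T)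
    (h : ∀ τ, ∃ z, pull a z = pull s τ ∧ pull b z = pull t τ) :
    ∃! m : Z ⟶ T, a ≫ m = s ∧ b ≫ m = t := by
  -- The condition `u ⊓ v = ⊥` says that the two closed sublocales cover `Z`, so restriction to both
  -- reflects the order.
  have hle : ∀ z z', pull a z ≤ pull a z' → pull b z ≤ pull b z' → z ≤ z' := fun z z' h1 h2 => by
    have := le_inf ((ha.le_iff _ _).1 h1) ((hb.le_iff _ _).1 h2)
    rwa [← sup_inf_left, huv, sup_bot_eq] at this
  have hinj : ∀ z z', pull a z = pull a z' → pull b z = pull b z' → z = z' := fun z z' h1 h2 =>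
    le_antisymm (hle _ _ h1.le h2.le) (hle _ _ h1.ge h2.ge)
  choose r hr using h
  obtain ⟨φ, hφ⟩ := frameHom_sSup_eq_of_reflect (ι := Bool) r
    (fun i => cond i (Opposite.unop A) (Opposite.unop B))
    (fun i => match i with | true => pull a | false => pull b)
    (fun x y hxy => hinj _ _ (hxy true) (hxy false))
    (fun i => match i with | true => pull s | false => pull t)
    (fun i x => match i with | true => (hr x).1.symm | false => (hr x).2.symm)
  refine ⟨mkHom φ, ⟨hom_ext_pull fun τ => ?_, hom_ext_pull fun τ => ?_⟩, ?_⟩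
  · refine Eq.trans ?_ (hr τ).1
    rw [← hφ]
    rfl
  · refine Eq.trans ?_ (hr τ).2
    rw [← hφ]
    rfl
  · rintro m ⟨h1, h2⟩
    refine hom_ext_pull fun τ => ?_
    have : pull m τ = r τ := by
      apply hinj
      · rw [(hr τ).1, ← h1]; rfl
      · rw [(hr τ).2, ← h2]; rfl
    rw [this, ← hφ]
    rfl

/-- A locale covered by two closed sublocales is their pushout along the intersection. -/
lemma isPushout {P A B Z : Locale.{u}} {f : P ⟶ A} {g : P ⟶ B} {a : A ⟶ Z} {b : B ⟶ Z} {u v : Z}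
    (w : f ≫ a = g ≫ b) (ha : IsClosedImm a u) (hb : IsClosedImm b v)
    (hab : IsClosedImm (f ≫ a) (u ⊔ v)) (huv : u ⊓ v = ⊥) : IsPushout f g a b := by
  have key : ∀ {T : Locale.{u}} (s : A ⟶ T) (t : B ⟶ T), f ≫ s = g ≫ t →
      ∃! m : Z ⟶ T, a ≫ m = s ∧ b ≫ m = t := by
    intro T s t hst
    refine existsUnique_glue ha hb huv s t fun τ => ?_
    obtain ⟨x, hx⟩ := ha.surjective (pull s τ)
    obtain ⟨y, hy⟩ := hb.surjective (pull t τ)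
    have hxy : pull (f ≫ a) x = pull (f ≫ a) y := by
      conv_rhs => rw [w]
      rw [pull_comp, pull_comp, hx, hy]
      exact congrArg (fun k => pull k τ) hst
    have h1 : x ≤ y ⊔ v ⊔ u := by
      have := (hab.le_iff _ _).1 hxy.le
      rwa [sup_comm u v, ← sup_assoc] at this
    have h2 : y ≤ x ⊔ u ⊔ v := by
      have := (hab.le_iff _ _).1 hxy.ge
      rwa [← sup_assoc] at this
    -- Joining with `u` does not affect the restriction to `A`, nor joining with `v` that to `B`. As
    -- `x` and `y` agree on the intersection, the meet restricts to `x` on `A` and to `y` on `B`.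
    refine ⟨(x ⊔ u) ⊓ (y ⊔ v), ?_, ?_⟩
    · rw [map_inf, map_sup, ha.pull_eq_bot, sup_bot_eq, ← hx]
      exact inf_eq_left.2 ((ha.le_iff _ _).2 h1)
    · rw [map_inf, map_sup (pull b) y v, hb.pull_eq_bot, sup_bot_eq, ← hy]
      exact inf_eq_right.2 ((hb.le_iff _ _).2 h2)
  exact ⟨⟨w⟩, ⟨PushoutCocone.IsColimit.mk w
    (fun s => (key s.inl s.inr s.condition).choose)
    (fun s => (key s.inl s.inr s.condition).choose_spec.1.1)
    (fun s => (key s.inl s.inr s.condition).choose_spec.1.2)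
    (fun s m h1 h2 => (key s.inl s.inr s.condition).choose_spec.2 m ⟨h1, h2⟩)⟩⟩

/-- A locale covered by two disjoint closed sublocales is their coproduct. -/
lemma isColimit_binaryCofan {A B Z : Locale.{u}} {a : A ⟶ Z} {b : B ⟶ Z} {u v : Z}
    (ha : IsClosedImm a u) (hb : IsClosedImm b v) (huv : u ⊓ v = ⊥) (huv' : u ⊔ v = ⊤) :
    Nonempty (IsColimit (BinaryCofan.mk a b)) := by
  have key : ∀ {T : Locale.{u}} (s : A ⟶ T) (t : B ⟶ T),
      ∃! m : Z ⟶ T, a ≫ m = s ∧ b ≫ m = t := by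
    intro T s t
    refine existsUnique_glue ha hb huv s t fun τ => ?_
    obtain ⟨x, hx⟩ := ha.surjective (pull s τ)
    obtain ⟨y, hy⟩ := hb.surjective (pull t τ)
    refine ⟨(x ⊔ u) ⊓ (y ⊔ v), ?_, ?_⟩
    · rw [map_inf, map_sup, ha.pull_eq_bot, sup_bot_eq, ← hx]
      exact inf_eq_left.2 ((ha.le_iff _ _).2 (by simp [sup_assoc, sup_comm v u, huv']))
    · rw [map_inf, map_sup (pull b) y v, hb.pull_eq_bot, sup_bot_eq, ← hy]
      exact inf_eq_right.2 ((hb.le_iff _ _).2 (by simp [sup_assoc, huv']))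
  exact ⟨BinaryCofan.isColimitMk (fun s => (key s.inl s.inr).choose)
    (fun s => (key s.inl s.inr).choose_spec.1.1)
    (fun s => (key s.inl s.inr).choose_spec.1.2)
    (fun s m h1 h2 => (key s.inl s.inr).choose_spec.2 m ⟨h1, h2⟩)⟩

/-- A closed embedding of spaces gives a closed sublocale. -/
lemma of_isClosedEmbedding {A B : TopCat.{u}} (i : A ⟶ B) (hi : Topology.IsClosedEmbedding i) :
    IsClosedImm (topToLocale.map i) (⟨(Set.range i)ᶜ, hi.isClosed_range.isOpen_compl⟩ : Opens B) := by
  constructor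
  · rintro ⟨U, hU⟩
    obtain ⟨V, hV, rfl⟩ := hi.isInducing.isOpen_iff.1 hU
    exact ⟨⟨V, hV⟩, rfl⟩
  · intro (x : Opens B) (y : Opens B)
    constructor
    · intro h b hb
      by_cases hr : b ∈ Set.range i
      · obtain ⟨a, rfl⟩ := hr
        exact Or.inl (h hb)
      · exact Or.inr hr
    · intro h a ha
      exact (h ha).resolve_right fun h' => h' ⟨a, rfl⟩

end IsClosedImm

/-! ### Hausdorff spaces as locales -/

section Sober

/-- Hausdorff spaces are sober: the union of all opens rejected by `p` is still rejected, and its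
complement is nonempty and, by separation of points, a single point, which represents `p`. -/
lemma exists_point {T : Type*} [TopologicalSpace T] [T2Space T] (p : FrameHom (Opens T) Prop) :
    ∃ t, ∀ U, p U ↔ t ∈ U := by
  have hsup : ∀ U V, p (U ⊔ V) ↔ p U ∨ p V := fun U V => by rw [map_sup]; rfl
  have hmono : ∀ {U V}, U ≤ V → p U → p V := fun h => OrderHomClass.mono p h
  let U₀ := sSup { U | ¬ p U }
  have h₀ : ¬ p U₀ := by
    rw [map_sSup]
    simp [Prop.exists_iff]
  have hle : ∀ U, ¬ p U → ∀ s ∈ U, s ∈ U₀ := fun U h => (le_sSup h : U ≤ U₀)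
  have hmem : ∃ t, t ∉ U₀ := by
    by_contra! h
    refine h₀ (hmono (fun t _ => h t) (?_ : p ⊤))
    rw [map_top]
    trivial
  obtain ⟨t, ht⟩ := hmem
  have huniq : ∀ t', t' ∉ U₀ → t' = t := by
    intro t' ht'
    by_contra hne
    obtain ⟨U, V, hU, hV, h1, h2, h3⟩ := t2_separation hne
    have hpU : p ⟨U, hU⟩ := by
      by_contra h
      exact ht' (hle _ h _ h1)
    have hpV : p ⟨V, hV⟩ := by
      by_contra h
      exact ht (hle _ h _ h2)
    have : p (⟨U, hU⟩ ⊓ ⟨V, hV⟩) := by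
      rw [map_inf]
      exact ⟨hpU, hpV⟩
    have hbot : (⟨U, hU⟩ ⊓ ⟨V, hV⟩ : Opens T) = ⊥ := Opens.ext h3.inter_eq
    rw [hbot, map_bot] at this
    exact this
  refine ⟨t, fun U => ⟨fun h => ?_, fun h => ?_⟩⟩
  · by_contra hU
    refine h₀ (hmono (fun s hs => ?_) h)
    by_contra h'
    exact hU (huniq s h' ▸ hs)
  · have : p (U ⊔ U₀) := by
      refine hmono (fun s _ => ?_) (show p ⊤ by rw [map_top]; trivial)
      by_cases hs : s ∈ U₀
      · exact Or.inr hs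
      · exact Or.inl (huniq s hs ▸ h)
    exact ((hsup _ _).1 this).resolve_right h₀

/-- Sobriety of `T` sends each point of `S` to a point of `T`; the given frame homomorphism then
computes preimages, so the resulting function is continuous. -/
lemma topToLocale_map_surjective (S T : TopCat.{u}) [T2Space T] (g : Om S ⟶ Om T) :
    ∃ f : S ⟶ T, topToLocale.map f = g := by
  choose f hf using fun s : S => exists_point
    ((Locale.localePointOfSpacePoint S s).comp (pull g : FrameHom (Opens T) (Opens S)))
  have hpre : ∀ U : Opens T, f ⁻¹' U = ((show Opens S from pull g U) : Set S) := fun U => Set.ext fun s => (hf s U).symm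
  refine ⟨TopCat.ofHom ⟨f, continuous_def.2 fun U hU => ?_⟩, hom_ext_pull fun U => Opens.ext (hpre U)⟩
  have h := hpre ⟨U, hU⟩
  change f ⁻¹' U = _ at h
  rw [h]
  exact Opens.isOpen _

lemma topToLocale_map_injective {S T : TopCat.{u}} [T2Space T] {f g : S ⟶ T}
    (h : topToLocale.map f = topToLocale.map g) : f = g := by
  ext s
  by_contra hne
  obtain ⟨U, V, hU, hV, h1, h2, h3⟩ := t2_separation hne
  have h4 : Opens.comap f.hom ⟨U, hU⟩ = Opens.comap g.hom ⟨U, hU⟩ :=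
    congrArg (fun k => pull k (⟨U, hU⟩ : Opens T)) h
  have h5 : s ∈ Opens.comap g.hom ⟨U, hU⟩ := h4 ▸ h1
  exact h3.le_bot ⟨h5, h2⟩

end Sober

/-! ### Pairs of disjoint opens -/

/-- The frame freely generated by two disjoint elements. It turns extension of disjoint opens into a
lifting property and, when the second open is empty, opens into maps. -/
lemma exists_separator : ∃ (D : Locale.{u}) (a b : D), a ⊓ b = ⊥ ∧
    ∀ (X : Locale.{u}) (x y : X), x ⊓ y = ⊥ → ∃! f : X ⟶ D, pull f a = x ∧ pull f b = y := by
  obtain ⟨U, η, h, hU⟩ := exists_universal_model (G := ULift.{u} Bool)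
    (fun L φ => φ ⟨true⟩ ⊓ φ ⟨false⟩ = ⊥) (by
      intro L φ ι M f hf h
      refine le_bot_iff.1 (hf _ _ fun i => ?_)
      rw [map_inf, h i]
      exact bot_le)
  refine ⟨Locale.of U, η ⟨true⟩, η ⟨false⟩, h, fun X x y hxy => ?_⟩
  obtain ⟨f, hf, huniq⟩ := hU (Frm.of X) (fun g => if g.down then x else y) (by simpa using hxy)
  refine ⟨mkHom (Y := Locale.of U) f, ⟨hf ⟨true⟩, hf ⟨false⟩⟩, ?_⟩
  rintro g ⟨h1, h2⟩
  have := huniq (pull g) (by rintro ⟨_ | _⟩; exacts [h2, h1])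
  exact hom_ext_pull fun z => congrArg (fun k : FrameHom U X => k z) this

/-- A locale classifying pairs of disjoint opens. -/
def separator : Locale.{u} := exists_separator.choose

lemma separator_spec : ∃ a b : separator.{u}, a ⊓ b = ⊥ ∧
    ∀ (X : Locale.{u}) (x y : X), x ⊓ y = ⊥ → ∃! f : X ⟶ separator, pull f a = x ∧ pull f b = y :=
  exists_separator.choose_spec

/-- Disjoint opens extend along `f`. -/
def disjointExt : MorphismProperty Locale.{u} := fun X Z f =>
  ∀ x y : X, x ⊓ y = ⊥ → ∃ x' y' : Z, x' ⊓ y' = ⊥ ∧ pull f x' = x ∧ pull f y' = y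

lemma pull_disjoint {X Y : Locale.{u}} (f : X ⟶ Y) {x y : Y} (h : x ⊓ y = ⊥) :
    pull f x ⊓ pull f y = ⊥ := by rw [← map_inf, h, map_bot]

/-- Extending a disjoint pair along `f` is extending a map to `separator`. The stability properties
of `disjointExt` are therefore those of any class defined by left lifting. -/
lemma disjointExt_eq_llp :
    disjointExt.{u} = (MorphismProperty.ofHoms fun _ : Unit => terminal.from separator.{u}).llp := by
  obtain ⟨a, b, hab, hD⟩ := separator_spec.{u}
  have hD' : ∀ (X : Locale.{u}) (f g : X ⟶ separator.{u}), pull f a = pull g a →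
      pull f b = pull g b → f = g := fun X f g h1 h2 =>
    (hD X _ _ (pull_disjoint g hab)).unique ⟨h1, h2⟩ ⟨rfl, rfl⟩
  ext X Z f
  constructor
  · rintro hf _ _ _ ⟨⟨⟩⟩
    refine ⟨fun {u v} sq => ?_⟩
    obtain ⟨x', y', h, h1, h2⟩ := hf (pull u a) (pull u b) (pull_disjoint u hab)
    obtain ⟨g, ⟨hg1, hg2⟩, -⟩ := hD Z x' y' h
    exact ⟨⟨⟨g, hD' _ _ _ (by rw [pull_comp, hg1, h1]) (by rw [pull_comp, hg2, h2]),
      Subsingleton.elim _ _⟩⟩⟩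
  · intro hf x y hxy
    obtain ⟨g, ⟨hg1, hg2⟩, -⟩ := hD X x y hxy
    have hlift := hf (terminal.from separator.{u}) (MorphismProperty.ofHoms.mk ())
    have sq : CommSq g f (terminal.from separator.{u}) (terminal.from Z) :=
      ⟨Subsingleton.elim _ _⟩
    have := hlift.sq_hasLift sq
    refine ⟨pull sq.lift a, pull sq.lift b, pull_disjoint _ hab, ?_, ?_⟩
    · rw [← pull_comp, sq.fac_left, hg1]
    · rw [← pull_comp, sq.fac_left, hg2]

instance : MorphismProperty.IsStableUnderTransfiniteComposition.{u} disjointExt.{u} := by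
  rw [disjointExt_eq_llp]
  infer_instance

instance : disjointExt.{u}.IsMultiplicative := by
  rw [disjointExt_eq_llp]
  infer_instance

instance : disjointExt.{u}.IsStableUnderCobaseChange := by
  rw [disjointExt_eq_llp]
  infer_instance

instance : MorphismProperty.IsStableUnderCoproducts.{u} disjointExt.{u} := by
  rw [disjointExt_eq_llp]
  infer_instance

lemma disjointExt.surjective {X Z : Locale.{u}} {f : X ⟶ Z} (hf : disjointExt f) :
    Function.Surjective (pull f) := fun x => by
  obtain ⟨x', -, -, h, -⟩ := hf x ⊥ (by simp)
  exact ⟨x', h⟩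

lemma disjointExt.mono {X Z : Locale.{u}} {f : X ⟶ Z} (hf : disjointExt f) : Mono f :=
  ⟨fun {W} k k' hk => hom_ext_pull fun s => by
    obtain ⟨z, rfl⟩ := hf.surjective s
    exact congrArg (fun f => pull f z) hk⟩

/-! ### Opens of a colimit of locales -/

section Colimit

variable {J : Type w} [Category.{v} J] {F : J ⥤ Locale.{u}} {c : Cocone F}

/-- An open `x` is coded by the disjoint pair `(x, ⊥)`, hence by a map to a fixed locale, and maps
out of a colimit are determined on its components. -/
lemma colimit_ext (hc : IsColimit c) {x y : c.pt}
    (h : ∀ j, pull (c.ι.app j) x = pull (c.ι.app j) y) : x = y := by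
  obtain ⟨D, a, b, hab, hD⟩ := exists_separator.{u}
  obtain ⟨f, ⟨hf1, hf2⟩, -⟩ := hD c.pt x ⊥ (by simp)
  obtain ⟨g, ⟨hg1, hg2⟩, -⟩ := hD c.pt y ⊥ (by simp)
  have : f = g := hc.hom_ext fun j => (hD _ _ _ (pull_disjoint (c.ι.app j ≫ g) hab)).unique
    ⟨by rw [pull_comp, pull_comp, hf1, hg1, h], by rw [pull_comp, pull_comp, hf2, hg2]⟩ ⟨rfl, rfl⟩
  rw [← hf1, this, hg1]

lemma colimit_le (hc : IsColimit c) {x y : c.pt}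
    (h : ∀ j, pull (c.ι.app j) x ≤ pull (c.ι.app j) y) : x ≤ y := by
  rw [← inf_eq_left]
  refine colimit_ext hc fun j => ?_
  rw [map_inf]
  exact inf_eq_left.2 (h j)

/-- With the same coding, a compatible family of opens is a cocone. -/
lemma exists_colimit_open (hc : IsColimit c) (z : ∀ j, F.obj j)
    (hz : ∀ (i j : J) (f : i ⟶ j), pull (F.map f) (z j) = z i) :
    ∃ y : c.pt, ∀ j, pull (c.ι.app j) y = z j := by
  obtain ⟨D, a, b, hab, hD⟩ := exists_separator.{u}
  choose f hf huniq using fun j => hD (F.obj j) (z j) ⊥ (by simp)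
  have hnat : ∀ (i j : J) (k : i ⟶ j), F.map k ≫ f j = f i := fun i j k =>
    (hD (F.obj i) (z i) ⊥ (by simp)).unique
      ⟨by rw [pull_comp, (hf j).1, hz], by rw [pull_comp, (hf j).2, map_bot]⟩ (hf i)
  let s : Cocone F := Cocone.mk D
    { app := f
      naturality := fun i j k => (hnat i j k).trans (Category.comp_id (f i)).symm }
  refine ⟨pull (hc.desc s) a, fun j => ?_⟩
  rw [← pull_comp, hc.fac]
  exact (hf j).1

end Colimit

lemma pushout_le {A B X Z : Locale.{u}} {f : A ⟶ B} {g : A ⟶ X} {g' : B ⟶ Z} {f' : X ⟶ Z}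
    (h : IsPushout g f f' g') {x y : Z} (h1 : pull f' x ≤ pull f' y) (h2 : pull g' x ≤ pull g' y) :
    x ≤ y := by
  refine colimit_le h.isColimit fun j => ?_
  rcases j with _ | _ | _
  · have := OrderHomClass.mono (pull g) h1
    rwa [← pull_comp, ← pull_comp] at this
  · exact h1
  · exact h2

lemma exists_pushout_open {A B X Z : Locale.{u}} {f : A ⟶ B} {g : A ⟶ X} {g' : B ⟶ Z} {f' : X ⟶ Z}
    (h : IsPushout g f f' g') (x : X) (b : B) (hxb : pull g x = pull f b) :
    ∃ z, pull f' z = x ∧ pull g' z = b := by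
  obtain ⟨D, a₀, b₀, hab, hD⟩ := exists_separator.{u}
  obtain ⟨p, ⟨hp1, hp2⟩, -⟩ := hD X x ⊥ (by simp)
  obtain ⟨q, ⟨hq1, hq2⟩, -⟩ := hD B b ⊥ (by simp)
  have w : g ≫ p = f ≫ q := (hD A (pull g x) ⊥ (by simp)).unique
    ⟨by rw [pull_comp, hp1], by rw [pull_comp, hp2, map_bot]⟩
    ⟨by rw [pull_comp, hq1, hxb], by rw [pull_comp, hq2, map_bot]⟩
  exact ⟨pull (h.desc p q w) a₀, by rw [← pull_comp, h.inl_desc, hp1],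
    by rw [← pull_comp, h.inr_desc, hq1]⟩

/-! ### Relatively regular maps -/

/-- The union of the opens that can be separated from the image of `f`. -/
def awayFrom {X Z : Locale.{u}} (f : X ⟶ Z) : Z := sSup { O | ∃ O', pull f O' = ⊤ ∧ O ⊓ O' = ⊥ }

lemma le_awayFrom {X Z : Locale.{u}} {f : X ⟶ Z} {O O' : Z} (h : pull f O' = ⊤)
    (h' : O ⊓ O' = ⊥) : O ≤ awayFrom f := le_sSup ⟨O', h, h'⟩

/-- Maps `f` such that every open of the target is determined by its restriction along `f`, up to
opens that can be separated from the image, and such that disjoint opens extend along `f`. -/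
def sepMaps : MorphismProperty Locale.{u} := fun _ Z f =>
  disjointExt f ∧ ∀ x y : Z, pull f x ≤ pull f y → x ≤ y ⊔ awayFrom f

/-- A disjoint pair separating an open of `Y` from the image of `f` extends along `g` to a pair that
separates in `Z`. This moves the error term of `sepMaps` forward along composites. -/
lemma awayFrom_le_pull {X Y Z : Locale.{u}} (f : X ⟶ Y) {g : Y ⟶ Z} (hg : disjointExt g) :
    awayFrom f ≤ pull g (awayFrom (f ≫ g)) := by
  refine sSup_le ?_
  rintro O ⟨O', h, h'⟩
  obtain ⟨V, V', hV, rfl, rfl⟩ := hg O O' h'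
  exact OrderHomClass.mono (pull g) (le_awayFrom (by rw [pull_comp, h]) hV)

lemma awayFrom_le_comp {X Y Z : Locale.{u}} (f : X ⟶ Y) (g : Y ⟶ Z) :
    awayFrom g ≤ awayFrom (f ≫ g) := by
  refine sSup_le ?_
  rintro O ⟨O', h, h'⟩
  exact le_awayFrom (by rw [pull_comp, h, map_top]) h'

lemma pull_awayFrom {X Z : Locale.{u}} (f : X ⟶ Z) : pull f (awayFrom f) = ⊥ := by
  rw [awayFrom, map_sSup, sSup_eq_bot]
  rintro _ ⟨O, ⟨O', h, h'⟩, rfl⟩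
  have := pull_disjoint f h'
  rwa [h, inf_top_eq] at this

/-- The hypotheses force `v` to be `awayFrom f`; as inequalities they accept whichever description
of the complement is at hand. -/
lemma sepMaps.isClosedImm {X Z : Locale.{u}} {f : X ⟶ Z} (hf : sepMaps f) {v : Z}
    (h0 : awayFrom f ≤ v) (h1 : pull f v = ⊥) : IsClosedImm f v := by
  refine ⟨hf.1.surjective, fun x y => ⟨fun h => (hf.2 x y h).trans (sup_le_sup_left h0 _), fun h => ?_⟩⟩
  have := OrderHomClass.mono (pull f) h
  rwa [map_sup, h1, sup_bot_eq] at this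

instance : sepMaps.{u}.IsMultiplicative where
  id_mem X := ⟨MorphismProperty.id_mem _ _, fun x y h => le_sup_of_le_left h⟩
  comp_mem f g hf hg := by
    refine ⟨MorphismProperty.comp_mem _ _ _ hf.1 hg.1, fun x y h => ?_⟩
    rw [pull_comp, pull_comp] at h
    -- The error term of `f` is bounded by the pullback of one in `Z` because `g` extends disjoint
    -- opens. Thus the regularity condition composes only together with the extension condition.
    have h1 := (hf.2 _ _ h).trans (sup_le_sup_left (awayFrom_le_pull f hg.1) _)
    rw [← map_sup] at h1
    refine (hg.2 _ _ h1).trans ?_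
    exact sup_le le_rfl (le_sup_of_le_right (awayFrom_le_comp f g))

instance : sepMaps.{u}.RespectsIso :=
  MorphismProperty.respectsIso_of_isStableUnderComposition fun _ _ f (hf : IsIso f) =>
    ⟨MorphismProperty.of_isIso _ f, fun x y h => le_sup_of_le_left (by
      have := OrderHomClass.mono (pull (inv f)) h
      rwa [← pull_comp, ← pull_comp, IsIso.inv_hom_id] at this)⟩

/-- Opens of the pushout are pairs of opens of `X` and `B` agreeing on `A`. If `O'` contains the
image of `A` and is disjoint from `O`, then `O` extends by `⊥` and `O'` by `⊤` over `X`, and the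
extensions remain disjoint. -/
lemma sepMaps_of_isPushout {A B X Z : Locale.{u}} {f : A ⟶ B} {g : A ⟶ X} {g' : B ⟶ Z} {f' : X ⟶ Z}
    (h : IsPushout g f f' g') (hf : sepMaps f) : sepMaps f' := by
  refine ⟨MorphismProperty.of_isPushout h hf.1, fun x y hxy => ?_⟩
  have key : awayFrom f ≤ pull g' (awayFrom f') := by
    refine sSup_le ?_
    rintro O ⟨O', h1, h2⟩
    have h3 : pull f O = ⊥ := by
      have := pull_disjoint f h2
      rwa [h1, inf_top_eq] at this
    obtain ⟨V, hV1, rfl⟩ := exists_pushout_open h ⊥ O (by rw [map_bot, h3])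
    obtain ⟨V', hV1', rfl⟩ := exists_pushout_open h ⊤ O' (by rw [map_top, h1])
    refine OrderHomClass.mono (pull g') (le_awayFrom hV1' ?_)
    refine le_bot_iff.1 (pushout_le h ?_ ?_)
    · rw [map_inf, hV1]; simp
    · rw [map_inf, h2]; exact bot_le
  refine pushout_le h ?_ ?_
  · exact hxy.trans (OrderHomClass.mono (pull f') le_sup_left)
  · rw [map_sup]
    refine (hf.2 _ _ ?_).trans (sup_le_sup_left key _)
    have := OrderHomClass.mono (pull g) hxy
    rwa [← pull_comp, ← pull_comp, h.w, pull_comp, pull_comp] at this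

instance : sepMaps.{u}.IsStableUnderCobaseChange where
  of_isPushout h hf := sepMaps_of_isPushout h hf

lemma sepMaps_coproducts_le : MorphismProperty.coproducts.{u} sepMaps.{u} ≤ sepMaps.{u} := by
  intro _ _ φ hφ
  rw [MorphismProperty.coproducts_iff] at hφ
  obtain ⟨J, hφ⟩ := hφ
  refine ⟨MorphismProperty.coproducts_le.{u} disjointExt.{u} _
    (MorphismProperty.colimitsOfShape_le_coproducts _ J _
      (MorphismProperty.colimitsOfShape_monotone (fun _ _ _ h => h.1) _ _ hφ)), ?_⟩
  obtain ⟨X₁, X₂, c₁, c₂, h₁, h₂, f, hf⟩ := hφ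
  set φ := h₁.desc (Cocone.mk _ (f ≫ c₂.ι)) with hφ
  have fac : ∀ j, c₁.ι.app j ≫ φ = f.app j ≫ c₂.ι.app j := fun j => h₁.fac _ j
  intro x y hxy
  have ext : ∀ z : ∀ j, X₂.obj j, ∃ y : c₂.pt, ∀ j, pull (c₂.ι.app j) y = z j := fun z =>
    exists_colimit_open h₂ z (by
      rintro ⟨i⟩ ⟨j⟩ ⟨⟨h⟩⟩
      obtain rfl : i = j := h
      exact congrArg (fun k => pull k (z ⟨i⟩)) (X₂.map_id ⟨i⟩))
  have key : ∀ j, awayFrom (f.app j) ≤ pull (c₂.ι.app j) (awayFrom φ) := by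
    classical
    intro j
    refine sSup_le ?_
    rintro O ⟨O', h1, h2⟩
    -- Extending by `⊥` and by `⊤` on the other summands keeps the pair disjoint and makes the
    -- second open contain the image of all of `φ`.
    obtain ⟨V, hV⟩ := ext (Function.update (fun _ => ⊥) j O)
    obtain ⟨V', hV'⟩ := ext (Function.update (fun _ => ⊤) j O')
    have e : pull (c₂.ι.app j) V = O := by rw [hV, Function.update_self]
    have e' : pull (c₂.ι.app j) V' = O' := by rw [hV', Function.update_self]
    rw [← e]
    refine OrderHomClass.mono (pull (c₂.ι.app j)) (le_awayFrom (O' := V') ?_ ?_)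
    · refine top_le_iff.1 (colimit_le h₁ fun i => ?_)
      rw [← pull_comp, fac, pull_comp, hV', map_top]
      by_cases hij : i = j
      · subst hij; rw [Function.update_self, h1]
      · rw [Function.update_of_ne hij, map_top]
    · refine le_bot_iff.1 (colimit_le h₂ fun i => ?_)
      rw [map_inf]
      by_cases hij : i = j
      · subst hij; rw [e, e', h2]; exact bot_le
      · rw [hV, Function.update_of_ne hij]; exact inf_le_left.trans bot_le
  refine colimit_le h₂ fun j => ?_
  rw [map_sup]
  refine ((hf j).2 _ _ ?_).trans (sup_le_sup_left (key j) _)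
  have := OrderHomClass.mono (pull (c₁.ι.app j)) hxy
  rwa [← pull_comp, ← pull_comp, fac, pull_comp, pull_comp] at this

/-- Opens of the colimit are compared stage by stage. At stage `j` the error term is that of the map
from the initial stage, and it passes to the colimit because disjoint opens of stage `j` extend. -/
lemma sepMaps_colimit {J : Type w} [Preorder J] [OrderBot J] {F : J ⥤ Locale.{u}} {c : Cocone F}
    (hc : IsColimit c) (h : ∀ j, disjointExt (c.ι.app j))
    (h' : ∀ j, sepMaps (F.map (homOfLE (bot_le : ⊥ ≤ j)))) : sepMaps (c.ι.app ⊥) := by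
  refine ⟨h ⊥, fun x y hxy => colimit_le hc fun j => ?_⟩
  have w := c.w (homOfLE (bot_le : ⊥ ≤ j))
  rw [map_sup]
  refine ((h' j).2 _ _ ?_).trans (sup_le_sup_left ?_ _)
  · rwa [← pull_comp, ← pull_comp, w]
  · have := awayFrom_le_pull (F.map (homOfLE (bot_le : ⊥ ≤ j))) (h j)
    rwa [w] at this

section Transfinite

variable {J : Type u} [LinearOrder J] [SuccOrder J] [OrderBot J] [WellFoundedLT J]

/-- Transfinite induction. At a limit, the stage is the colimit of the earlier ones, and extension
of disjoint opens into it is already known since `disjointExt` is defined by lifting. -/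
lemma sepMaps_map_bot {X Y : Locale.{u}} {f : X ⟶ Y} (hf : sepMaps.{u}.TransfiniteCompositionOfShape J f)
    (j : J) : sepMaps (hf.F.map (homOfLE (bot_le : ⊥ ≤ j))) := by
  have hd := hf.ofLE (W' := disjointExt.{u}) fun _ _ _ h => h.1
  induction j using SuccOrder.limitRecOn with
  | isMin j hj =>
    obtain rfl := hj.eq_bot
    have := sepMaps.{u}.id_mem (hf.F.obj ⊥)
    rwa [← hf.F.map_id] at this
  | succ j hj hj' =>
    rw [← homOfLE_comp bot_le (Order.le_succ j), hf.F.map_comp]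
    exact sepMaps.{u}.comp_mem _ _ hj' (hf.map_mem j hj)
  | isSuccLimit j hj hj' =>
    let : OrderBot (Set.Iio j) :=
      { bot := ⟨⊥, Order.IsSuccLimit.bot_lt hj⟩
        bot_le j := bot_le }
    refine sepMaps_colimit (hf.F.isColimitOfIsWellOrderContinuous j hj) (fun k => ?_)
      fun k => hj' _ k.2
    have : (hf.ofLE (W' := disjointExt.{u}) fun _ _ _ h => h.1).F = hf.F := rfl
    exact (hf.ofLE (W' := disjointExt.{u}) fun _ _ _ h => h.1).mem_map (homOfLE k.2.le)

end Transfinite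

instance : MorphismProperty.IsStableUnderTransfiniteComposition.{u} sepMaps.{u} where
  isStableUnderTransfiniteCompositionOfShape J _ _ _ _ := ⟨fun X Y f ⟨hf⟩ =>
    (MorphismProperty.arrow_mk_iso_iff _ (Arrow.isoMk hf.isoBot.symm (Iso.refl _)
      (by simp))).2
      (sepMaps_colimit hf.isColimit
        (fun j => (hf.ofLE (W' := disjointExt.{u}) fun _ _ _ h => h.1).mem_incl_app j)
        (sepMaps_map_bot hf))⟩

lemma cell_le_sepMaps {K : MorphismProperty Locale.{u}} (hK : K ≤ sepMaps) : cell K ≤ sepMaps :=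
  (MorphismProperty.transfiniteCompositions_monotone.{u} ((MorphismProperty.pushouts_monotone
    ((MorphismProperty.coproducts_monotone hK).trans sepMaps_coproducts_le)).trans
      (MorphismProperty.pushouts_le))).trans
    (MorphismProperty.transfiniteCompositions_le _)

/-- Disjoint opens of the subspace are separated in `B`: neither meets the closure of the other.
Complete normality gives them disjoint neighbourhoods, which acquire the right traces after removing
closed images of complements. Regularity separates a point off the subspace from it, giving the
second condition. -/
lemma sepMaps_of_isClosedEmbedding {A B : TopCat.{u}} [CompletelyNormalSpace B] [RegularSpace B]
    (i : A ⟶ B) (hi : Topology.IsClosedEmbedding i) : sepMaps (topToLocale.map i) := by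
  constructor
  · rintro ⟨x, hx⟩ ⟨y, hy⟩ hxy
    have hxy' : x ∩ y = ∅ := congrArg (fun U : Opens A => (U : Set A)) hxy
    have key : ∀ x y : Set A, IsOpen x → x ∩ y = ∅ → Disjoint (i '' x) (closure (i '' y)) := by
      intro x y hx hxy
      obtain ⟨V, hV, rfl⟩ := hi.isInducing.isOpen_iff.1 hx
      rw [Set.disjoint_left]
      rintro _ ⟨a, ha, rfl⟩ h
      obtain ⟨_, hb, ⟨b, hb', rfl⟩⟩ := mem_closure_iff.1 h V hV ha
      exact (Set.eq_empty_iff_forall_notMem.1 hxy) b ⟨hb, hb'⟩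
    have hd := CompletelyNormalSpace.completely_normal
      (key y x hy (by rwa [Set.inter_comm])).symm (key x y hx hxy')
    obtain ⟨U, V, hU, hV, hxU, hyV, hUV⟩ := separatedNhds_iff_disjoint.2 hd
    have hcl : ∀ x : Set A, IsOpen x → IsClosed (i '' xᶜ) := fun x hx =>
      hi.isClosedMap _ hx.isClosed_compl
    have hpre : ∀ (x : Set A) (W : Set B), i '' x ⊆ W → i ⁻¹' (W \ i '' xᶜ) = x := by
      intro x W h
      ext a
      constructor
      · rintro ⟨-, ha⟩
        by_contra hax
        exact ha ⟨a, hax, rfl⟩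
      · intro ha
        refine ⟨h ⟨a, ha, rfl⟩, ?_⟩
        rintro ⟨b, hb, hba⟩
        exact hb (hi.injective hba ▸ ha)
    refine ⟨(⟨U \ i '' xᶜ, hU.sdiff (hcl x hx)⟩ : Opens B), (⟨V \ i '' yᶜ, hV.sdiff (hcl y hy)⟩ : Opens B),
      Opens.ext ?_, Opens.ext (hpre x U hxU), Opens.ext (hpre y V hyV)⟩
    exact (hUV.mono Set.sdiff_subset Set.sdiff_subset).inter_eq
  · intro (x : Opens B) (y : Opens B) hxy b hb
    by_cases hr : b ∈ Set.range i
    · obtain ⟨a, rfl⟩ := hr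
      exact Or.inl (hxy hb)
    · have hd := disjoint_nhdsSet_nhds.2 (hi.isClosed_range.closure_eq.symm ▸ hr)
      rw [← nhdsSet_singleton] at hd
      obtain ⟨U, V, hU, hV, hrU, hbV, hUV⟩ := separatedNhds_iff_disjoint.2 hd
      refine Or.inr ((le_awayFrom (f := topToLocale.map i) (O := (⟨V, hV⟩ : Opens B))
        (O' := (⟨U, hU⟩ : Opens B)) (Opens.ext ?_) (Opens.ext ?_)) (hbV rfl))
      · exact Set.eq_univ_of_forall fun a => hrU ⟨a, rfl⟩
      · exact hUV.symm.inter_eq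

/-! ### Smallness -/

section Small

variable {J : Type u} [LinearOrder J] [SuccOrder J] [OrderBot J] [WellFoundedLT J]

-- Choose for every attained value a stage attaining it. There are fewer than `κ` choices, so they
-- have an upper bound, and past it an antitone function cannot decrease further.
omit [SuccOrder J] [WellFoundedLT J] in
lemma exists_eventually_const {P : Type u} [PartialOrder P] (κ : Cardinal.{u}) [Fact κ.IsRegular]
    [IsCardinalFiltered J κ] (hP : HasCardinalLT P κ) (φ : J → P) (hφ : Antitone φ) :
    ∃ j₀, ∀ j, j₀ ≤ j → φ j = φ j₀ := by
  classical
  let S : P → J := fun p => if h : ∃ j, φ j = p then h.choose else ⊥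
  refine ⟨IsCardinalFiltered.max S hP, fun j hj => le_antisymm (hφ hj) ?_⟩
  have h : ∃ j', φ j' = φ j := ⟨j, rfl⟩
  have hS : φ (S (φ j)) = φ j := by
    change φ (if h : ∃ j', φ j' = φ j then h.choose else ⊥) = φ j
    rw [dif_pos h, h.choose_spec]
  rw [← hS]
  exact hφ (leOfHom (IsCardinalFiltered.toMax S hP (φ j)))

-- Let `v j` be the largest open of the colimit with empty restriction to stage `j`. By cardinality
-- its preimage in `K` is eventually constant. If the constant is empty, `g` lands in the closed
-- sublocale given by a stage. Otherwise some point `y` lies in all late preimages, and separating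
-- its image from a stage produces two disjoint opens whose preimages both contain `y`.
omit [SuccOrder J] [WellFoundedLT J] in
theorem exists_factor_of_chain {F : J ⥤ Locale.{u}} {c : Cocone F} (hc : IsColimit c)
    (hF : ∀ (i j : J) (f : i ⟶ j), sepMaps (F.map f)) (hι : ∀ j, sepMaps (c.ι.app j))
    (K : TopCat.{u}) (κ : Cardinal.{u}) [Fact κ.IsRegular] [IsCardinalFiltered J κ]
    (hK : HasCardinalLT (Opens K) κ) (g : Om K ⟶ c.pt) : ∃ j, ∃ k : Om K ⟶ F.obj j, k ≫ c.ι.app j = g := by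
  have w : ∀ (i j : J) (h : i ≤ j) (z : c.pt),
      pull (F.map (homOfLE h)) (pull (c.ι.app j) z) = pull (c.ι.app i) z := fun i j h z => by
    rw [← pull_comp, c.w]
  let v : J → c.pt := fun j => sSup { x | pull (c.ι.app j) x = ⊥ }
  have hv : ∀ j, pull (c.ι.app j) (v j) = ⊥ := fun j => by
    rw [map_sSup, sSup_eq_bot]
    rintro _ ⟨x, hx, rfl⟩
    exact hx
  have hle : ∀ j x, pull (c.ι.app j) x = ⊥ → x ≤ v j := fun j x hx => le_sSup hx
  have hanti : Antitone v := fun i j hij => hle _ _ (by rw [← w i j hij, hv, map_bot])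
  let G : FrameHom c.pt (Opens K) := pull g
  obtain ⟨j₀, hj₀⟩ := exists_eventually_const κ hK (fun j => G (v j))
    fun i j hij => OrderHomClass.mono G (hanti hij)
  by_cases hbot : G (v j₀) = ⊥
  · obtain ⟨k, hk⟩ := ((hι j₀).isClosedImm (hle _ _ (pull_awayFrom _)) (hv j₀)).exists_factor g hbot
    exact ⟨j₀, k, hk⟩
  exfalso
  obtain ⟨y, hy⟩ : ∃ y, y ∈ G (v j₀) := by
    by_contra! h
    exact hbot (Opens.ext (Set.eq_empty_iff_forall_notMem.2 h))
  have hyv : ∀ j, j₀ ≤ j → y ∈ G (v j) := fun j hj => by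
    have : G (v j) = G (v j₀) := hj₀ j hj
    rwa [this]
  let m : c.pt := sSup { x | y ∉ G x }
  have hym : y ∉ G m := by
    have : G m = sSup (G '' { x | y ∉ G x }) := map_sSup G _
    rw [this]
    intro h
    obtain ⟨_, ⟨x, hx, rfl⟩, hyx⟩ := Opens.mem_sSup.1 h
    exact hx hyx
  have hm : ∀ x, ¬ x ≤ m → y ∈ G x := fun x hx => by
    by_contra h
    exact hx (le_sSup h)
  obtain ⟨j, hj, hjm⟩ : ∃ j, j₀ ≤ j ∧ pull (c.ι.app j) m ≠ ⊤ := by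
    by_contra! h
    have : m = ⊤ := top_le_iff.1 (colimit_le hc fun j => by
      rw [← w j (max j j₀) (le_max_left _ _), ← w j (max j j₀) (le_max_left _ _) m,
        h _ (le_max_right _ _), map_top])
    rw [this, map_top] at hym
    exact hym trivial
  obtain ⟨j', hj', hjv⟩ : ∃ j', j ≤ j' ∧ ¬ pull (c.ι.app j') (v j) ≤ pull (c.ι.app j') m := by
    by_contra! h
    have : v j ≤ m := colimit_le hc fun i => by
      rw [← w i (max i j) (le_max_left _ _), ← w i (max i j) (le_max_left _ _) m]
      exact OrderHomClass.mono (pull (F.map _)) (h _ (le_max_right _ _))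
    exact hym (OrderHomClass.mono G this (hyv j hj))
  -- Relative regularity of the map from stage `j` to stage `j'` bounds `v j` by `m` joined with
  -- opens separated from stage `j`, so one such open `O` is not below `m`. Its partner `O'` covers
  -- stage `j`, which `m` does not. Extended to the colimit, neither is below `m`, yet they are
  -- disjoint.
  obtain ⟨O, ⟨O', h1, h2⟩, hO⟩ : ∃ O ∈ { O | ∃ O', pull (F.map (homOfLE hj')) O' = ⊤ ∧ O ⊓ O' = ⊥ },
      ¬ O ≤ pull (c.ι.app j') m := by
    by_contra! h
    refine hjv (((hF _ _ (homOfLE hj')).2 _ (pull (c.ι.app j') m) ?_).trans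
      (sup_le le_rfl (sSup_le h)))
    rw [w, w, hv]
    exact bot_le
  obtain ⟨V, V', hVV', rfl, rfl⟩ := (hι j').1 O O' h2
  have hyV : y ∈ G V := hm V fun h => hO (OrderHomClass.mono (pull (c.ι.app j')) h)
  have hyV' : y ∈ G V' := hm V' fun h => hjm (top_le_iff.1 (by
    rw [← h1, w]
    exact OrderHomClass.mono (pull (c.ι.app j)) h))
  have : y ∈ G (V ⊓ V') := by
    rw [map_inf]
    exact ⟨hyV, hyV'⟩
  rw [hVV', map_bot] at this
  exact this

theorem preservesColimit_coyoneda (K : TopCat.{u}) (κ : Cardinal.{u}) [Fact κ.IsRegular]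
    [IsCardinalFiltered J κ] (hK : HasCardinalLT (Opens K) κ) {X Y : Locale.{u}} {f : X ⟶ Y}
    (hf : sepMaps.{u}.TransfiniteCompositionOfShape J f) :
    PreservesColimit hf.F (coyoneda.obj (Opposite.op (Om K))) := by
  have := isFiltered_of_isCardinalFiltered J κ
  refine preservesColimit_of_preserves_colimit_cocone hf.isColimit
    (Types.FilteredColimit.isColimitOf' _ _ (fun g => ?_) fun j a b hab => ?_)
  · obtain ⟨j, k, hk⟩ := exists_factor_of_chain hf.isColimit (fun i j φ => hf.mem_map φ)
      (fun j => hf.mem_incl_app j) K κ hK g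
    exact ⟨j, k, hk.symm⟩
  · have := (hf.mem_incl_app j).1.mono
    exact ⟨j, 𝟙 j, by rw [(cancel_mono (hf.incl.app j)).1 hab]⟩

end Small

lemma isSmallRelativeTo_of_sepMaps {W : MorphismProperty Locale.{u}} (hW : W ≤ sepMaps)
    (K : TopCat.{u}) : IsSmallRelativeTo (Om K) W := by
  obtain ⟨κ, hκ, h⟩ : ∃ κ : Cardinal.{u}, κ.IsRegular ∧ HasCardinalLT (Opens K) κ := by
    refine ⟨Order.succ (max Cardinal.aleph0 (Cardinal.mk (Opens K))),
      Cardinal.isRegular_succ (le_max_left _ _), ?_⟩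
    rw [hasCardinalLT_iff_cardinal_mk_lt, Order.lt_succ_iff]
    exact le_max_right _ _
  refine ⟨κ, ⟨hκ⟩, fun J _ _ _ _ _ X Y f hf => ?_⟩
  have : Fact κ.IsRegular := ⟨hκ⟩
  exact preservesColimit_coyoneda K κ h (hf.ofLE hW)

/-! ### The small object argument -/

section SmallObject

variable {A B : ℕ → TopCat.{u}} (i : ∀ n, A n ⟶ B n)

theorem exists_isCardinalForSmallObjectArgument
    (h : (MorphismProperty.ofHoms fun n => topToLocale.map (i n)) ≤ sepMaps) :
    ∃ (κ : Cardinal.{u}) (_ : Fact κ.IsRegular) (_ : OrderBot κ.ord.ToType),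
      (MorphismProperty.ofHoms fun n => topToLocale.map (i n)).IsCardinalForSmallObjectArgument κ := by
  -- The disjoint union over `n` provides one cardinal exceeding the number of opens of every
  -- domain.
  let κ : Cardinal.{u} := Order.succ (max Cardinal.aleph0 (Cardinal.mk (Σ n : ℕ, Opens (A n))))
  have hκ : κ.IsRegular := Cardinal.isRegular_succ (le_max_left _ _)
  have hlt : ∀ n, HasCardinalLT (Opens (A n)) κ := fun n => by
    rw [hasCardinalLT_iff_cardinal_mk_lt, Order.lt_succ_iff]
    refine le_max_of_le_right (Cardinal.mk_le_of_injective
      (f := fun U => (⟨n, U⟩ : Σ n : ℕ, Opens (A n))) fun U V h => ?_)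
    simpa using h
  have : Fact κ.IsRegular := ⟨hκ⟩
  have : Nonempty κ.ord.ToType := by simp [κ]
  let _ : OrderBot κ.ord.ToType := WellFoundedLT.toOrderBot _
  have : NoMaxOrder κ.ord.ToType := Cardinal.noMaxOrder hκ.aleph0_le
  refine ⟨κ, inferInstance, inferInstance, { isSmall := ?_, preservesColimit := ?_ }⟩
  · exact MorphismProperty.isSmall_ofHoms.{u} fun n => topToLocale.map (i n)
  · rintro _ _ X Y _ ⟨n⟩ f hf
    let W := MorphismProperty.ofHoms fun n => topToLocale.map (i n)
    have h' : MorphismProperty.ofHoms W.homFamily ≤ sepMaps := by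
      rw [MorphismProperty.ofHoms_homFamily]
      exact h
    have h'' : (MorphismProperty.coproducts.{u} (MorphismProperty.ofHoms W.homFamily)).pushouts ≤
        sepMaps.{u} := (MorphismProperty.pushouts_monotone
      ((MorphismProperty.coproducts_monotone h').trans sepMaps_coproducts_le)).trans
        MorphismProperty.pushouts_le
    exact preservesColimit_coyoneda (A n) κ (hlt n) (hf.transfiniteCompositionOfShape.ofLE h'')

variable (h : (MorphismProperty.ofHoms fun n => topToLocale.map (i n)) ≤ sepMaps)

include h

/-- The small object argument applies because pushouts of coproducts of the generators stay in
`sepMaps`. After this, cofibrations are tested by lifting only. -/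
lemma cof_eq_llp_rlp : cof (MorphismProperty.ofHoms fun n => topToLocale.map (i n)) =
    (MorphismProperty.ofHoms fun n => topToLocale.map (i n)).rlp.llp := by
  obtain ⟨κ, _, _, _⟩ := exists_isCardinalForSmallObjectArgument i h
  refine le_antisymm (MorphismProperty.retracts_transfiniteComposition_pushouts_coproducts_le_llp_rlp _) ?_
  exact (SmallObject.llp_rlp_of_isCardinalForSmallObjectArgument _ κ).le

lemma hasFactorization_llp_rlp : MorphismProperty.HasFactorization
    (MorphismProperty.ofHoms fun n => topToLocale.map (i n)).rlp.llp
    (MorphismProperty.ofHoms fun n => topToLocale.map (i n)).rlp := by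
  obtain ⟨κ, _, _, _⟩ := exists_isCardinalForSmallObjectArgument i h
  have := SmallObject.hasFunctorialFactorization
    (MorphismProperty.ofHoms fun n => topToLocale.map (i n)) κ
  infer_instance

end SmallObject

open scoped unitInterval

/-! ### Gluing continuous functions -/

section Glue

variable {T X : Type*} [TopologicalSpace T] [TopologicalSpace X]

lemma exists_glue {P Q : Set T} (hP : IsClosed P) (hQ : IsClosed Q) {f g : T → X}
    (hf : ContinuousOn f P) (hg : ContinuousOn g Q) (h : ∀ t ∈ P, t ∈ Q → f t = g t) :
    ∃ k : T → X, ContinuousOn k (P ∪ Q) ∧ (∀ t ∈ P, k t = f t) ∧ ∀ t ∈ Q, k t = g t := by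
  classical
  have hkP : ∀ t ∈ P, P.piecewise f g t = f t := fun t ht => Set.piecewise_eq_of_mem _ _ _ ht
  have hkQ : ∀ t ∈ Q, P.piecewise f g t = g t := fun t ht => by
    by_cases htP : t ∈ P
    · rw [hkP t htP, h t htP ht]
    · exact Set.piecewise_eq_of_notMem _ _ _ htP
  exact ⟨P.piecewise f g, (hf.congr hkP).union_of_isClosed (hg.congr hkQ) hP hQ, hkP, hkQ⟩

end Glue

/-! ### Relative lifting properties -/

section RelLift

variable {X Y : Type*} [TopologicalSpace X] [TopologicalSpace Y] (f : C(X, Y))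
  {T T' : Type*} [TopologicalSpace T] [TopologicalSpace T']

/-- `f` has the right lifting property against the inclusion of `S` in `T`. -/
def RelLift (S : Set T) : Prop := ∀ (φ : C(S, X)) (Ψ : C(T, Y)), (∀ s, f (φ s) = Ψ s) →
  ∃ K : C(T, X), (∀ s : S, K s = φ s) ∧ ∀ t, f (K t) = Ψ t

variable {f}

lemma RelLift.exists_lift {S : Set T} (h : RelLift f S) {φ : T → X} (hφ : ContinuousOn φ S)
    (Ψ : C(T, Y)) (w : ∀ s ∈ S, f (φ s) = Ψ s) :
    ∃ K : C(T, X), (∀ s ∈ S, K s = φ s) ∧ ∀ t, f (K t) = Ψ t := by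
  obtain ⟨K, h1, h2⟩ := h ⟨S.domRestrict φ, hφ.domRestrict⟩ Ψ fun s => w s s.2
  exact ⟨K, fun s hs => h1 ⟨s, hs⟩, h2⟩

/-- Maps on a subspace are traded for total functions continuous on it, with arbitrary values
elsewhere, so that gluing becomes a piecewise definition. -/
lemma exists_total [Nonempty X] {S : Set T} (φ : C(S, X)) :
    ∃ φ' : T → X, ContinuousOn φ' S ∧ ∀ s : S, φ' s = φ s := by
  classical
  let φ' : T → X := fun t => if h : t ∈ S then φ ⟨t, h⟩ else Classical.arbitrary X
  have h : ∀ s : S, φ' s = φ s := fun s => dif_pos s.2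
  refine ⟨φ', ?_, h⟩
  rw [continuousOn_iff_continuous_domRestrict]
  have : S.domRestrict φ' = φ := funext h
  rw [this]
  exact φ.continuous

lemma RelLift.of_total [Nonempty X] {S : Set T} (h : ∀ (φ : T → X), ContinuousOn φ S →
    ∀ Ψ : C(T, Y), (∀ s ∈ S, f (φ s) = Ψ s) →
      ∃ K : C(T, X), (∀ s ∈ S, K s = φ s) ∧ ∀ t, f (K t) = Ψ t) : RelLift f S := by
  intro φ Ψ w
  obtain ⟨φ', h1, h2⟩ := exists_total φ
  obtain ⟨K, h3, h4⟩ := h φ' h1 Ψ fun s hs => by rw [h2 ⟨s, hs⟩, w]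
  exact ⟨K, fun s => by rw [h3 s s.2, h2], h4⟩

/-- Transport the problem to `T'` along `r` and restrict the solution along `s`: lifting properties
pass to retracts of pairs. -/
lemma RelLift.of_retract {S : Set T} {S' : Set T'} (h : RelLift f S') (s : C(T, T')) (r : C(T', T))
    (hs : ∀ t ∈ S, s t ∈ S') (hr : ∀ t ∈ S', r t ∈ S) (hrs : ∀ t, r (s t) = t) : RelLift f S := by
  intro φ Ψ w
  obtain ⟨K, h1, h2⟩ := h (φ.comp ⟨fun t => ⟨r t, hr t t.2⟩, by fun_prop⟩) (Ψ.comp r)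
    fun t => w _
  refine ⟨K.comp s, fun t => ?_, fun t => ?_⟩
  · rw [ContinuousMap.comp_apply, h1 ⟨s t, hs t t.2⟩]
    exact congrArg φ (Subtype.ext (hrs t))
  · rw [ContinuousMap.comp_apply, h2, ContinuousMap.comp_apply, hrs]

lemma RelLift.homeomorph {S : Set T} {S' : Set T'} (h : RelLift f S') (e : T ≃ₜ T')
    (he : ∀ t, t ∈ S ↔ e t ∈ S') : RelLift f S :=
  h.of_retract ⟨e, e.continuous⟩ ⟨e.symm, e.symm.continuous⟩ (fun t ht => (he t).1 ht)
    (fun t ht => (he _).2 (by simpa using ht)) fun t => by simp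

variable (f)

/-- The continuous maps with the right lifting property against `∂I^n ⊆ I^n`. -/
def IsTrivFib : Prop := ∀ n, RelLift f (Cube.boundary (Fin n))

/-- The continuous maps with the right lifting property against `I^n × 0 ⊆ I^n × I`. -/
def IsFib : Prop := ∀ n, RelLift f { z : (Fin n → I) × I | z.2 = 0 }

end RelLift

/-! ### Cubes with their boundary -/

/-- `(A, S)` is homeomorphic to a cube with its boundary. -/
def IsCubePair {A : Type*} [TopologicalSpace A] (S : Set A) : Prop :=
  ∃ (n : ℕ) (e : A ≃ₜ (Fin n → I)), ∀ a, a ∈ S ↔ e a ∈ Cube.boundary (Fin n)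

/-- The boundary of `A × I`. -/
def cylBdry {A : Type*} (S : Set A) : Set (A × I) := { z | z.1 ∈ S ∨ z.2 = 0 ∨ z.2 = 1 }

/-- The open box `S × I ∪ A × 0`. -/
def openBox {A : Type*} (S : Set A) : Set (A × I) := { z | z.1 ∈ S ∨ z.2 = 0 }

section CubePair

variable {A B : Type*} [TopologicalSpace A] [TopologicalSpace B] {S : Set A} {S' : Set B}

lemma isCubePair_cube (n : ℕ) : IsCubePair (Cube.boundary (Fin n)) :=
  ⟨n, Homeomorph.refl _, fun _ => Iff.rfl⟩

lemma isClosed_boundary (n : ℕ) : IsClosed (Cube.boundary (Fin n)) := by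
  have : Cube.boundary (Fin n) = ⋃ i : Fin n, { y | y i = 0 ∨ y i = 1 } := by
    ext y; simp [Cube.boundary]
  rw [this]
  refine isClosed_iUnion_of_finite fun i => ?_
  exact (isClosed_eq (continuous_apply i) continuous_const).union
    (isClosed_eq (continuous_apply i) continuous_const)

lemma IsCubePair.isClosed (h : IsCubePair S) : IsClosed S := by
  obtain ⟨n, e, he⟩ := h
  have : S = e ⁻¹' Cube.boundary (Fin n) := Set.ext he
  rw [this]
  exact (isClosed_boundary n).preimage e.continuous

lemma IsCubePair.prod (h : IsCubePair S) (h' : IsCubePair S') :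
    IsCubePair { z : A × B | z.1 ∈ S ∨ z.2 ∈ S' } := by
  obtain ⟨m, e, he⟩ := h
  obtain ⟨n, e', he'⟩ := h'
  refine ⟨m + n, (e.prodCongr e').trans (Fin.appendHomeomorph m n), ?_⟩
  rintro ⟨a, b⟩
  change a ∈ S ∨ b ∈ S' ↔ Fin.append (e a) (e' b) ∈ Cube.boundary (Fin (m + n))
  rw [he, he']
  constructor
  · rintro (⟨i, hi⟩ | ⟨i, hi⟩)
    · exact ⟨Fin.castAdd n i, by simpa using hi⟩
    · exact ⟨Fin.natAdd m i, by simpa using hi⟩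
  · rintro ⟨i, hi⟩
    induction i using Fin.addCases with
    | left i => exact Or.inl ⟨i, by simpa using hi⟩
    | right i => exact Or.inr ⟨i, by simpa using hi⟩

lemma isCubePair_interval : IsCubePair ({0, 1} : Set I) :=
  ⟨1, (Homeomorph.funUnique (Fin 1) I).symm, fun t => by simp [Cube.boundary]⟩

lemma IsCubePair.cyl (h : IsCubePair S) : IsCubePair (cylBdry S) := h.prod isCubePair_interval

variable {X Y : Type*} [TopologicalSpace X] [TopologicalSpace Y] {f : C(X, Y)}

lemma IsTrivFib.relLift (hf : IsTrivFib f) (h : IsCubePair S) : RelLift f S := by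
  obtain ⟨n, e, he⟩ := h
  exact (hf n).homeomorph e he

lemma IsFib.relLift (hf : IsFib f) (h : IsCubePair S) : RelLift f { z : A × I | z.2 = 0 } := by
  obtain ⟨n, e, he⟩ := h
  exact (hf n).homeomorph (e.prodCongr (Homeomorph.refl _)) fun _ => Iff.rfl

end CubePair

/-! ### The open box as a retract -/

section Retract

/-- Truncation of real numbers to the unit interval. -/
abbrev clamp (t : ℝ) : I := Set.projIcc 0 1 zero_le_one t

lemma clamp_coe (t : I) : clamp t = t := Set.projIcc_val _ t

lemma clamp_of_le {t : ℝ} (h : t ≤ 0) : clamp t = 0 := Set.projIcc_of_le_left _ h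

lemma clamp_of_ge {t : ℝ} (h : 1 ≤ t) : clamp t = 1 := Set.projIcc_of_right_le _ h

@[fun_prop]
lemma continuous_clamp : Continuous clamp := continuous_projIcc

variable {n : ℕ}

/-- The distance of a point of the cube from the center, so that the boundary has distance `1`. -/
def radius (x : Fin n → I) : ℝ := ‖fun i => 2 * (x i : ℝ) - 1‖

@[fun_prop]
lemma continuous_radius : Continuous (radius (n := n)) := by
  unfold radius
  fun_prop

lemma abs_two_mul_sub_le (t : I) : |2 * (t : ℝ) - 1| ≤ 1 := by
  rw [abs_le]
  constructor <;> linarith [t.2.1, t.2.2]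

lemma radius_le_one (x : Fin n → I) : radius x ≤ 1 :=
  (pi_norm_le_iff_of_nonneg zero_le_one).2 fun i => abs_two_mul_sub_le (x i)

lemma radius_nonneg (x : Fin n → I) : 0 ≤ radius x := norm_nonneg _

lemma exists_radius_eq (x : Fin n → I) (h : 0 < radius x) : ∃ i, |2 * (x i : ℝ) - 1| = radius x := by
  by_contra! h'
  have : radius x < radius x := by
    conv_lhs => unfold radius
    rw [pi_norm_lt_iff h]
    intro i
    exact lt_of_le_of_ne (norm_le_pi_norm (fun i => 2 * (x i : ℝ) - 1) i) (h' i)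
  exact lt_irrefl _ this

lemma radius_eq_one_iff (x : Fin n → I) : radius x = 1 ↔ x ∈ Cube.boundary (Fin n) := by
  constructor
  · intro h
    obtain ⟨i, hi⟩ := exists_radius_eq x (by rw [h]; exact one_pos)
    rw [h, abs_eq zero_le_one] at hi
    refine ⟨i, ?_⟩
    rcases hi with hi | hi
    · exact Or.inr (Subtype.ext (by rw [Set.Icc.coe_one]; linarith))
    · exact Or.inl (Subtype.ext (by rw [Set.Icc.coe_zero]; linarith))
  · rintro ⟨i, hi⟩
    refine le_antisymm (radius_le_one x) ?_
    have := norm_le_pi_norm (fun i => 2 * (x i : ℝ) - 1) i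
    rcases hi with hi | hi <;> simp only [hi, Set.Icc.coe_one, Set.Icc.coe_zero] at this
    · norm_num at this
      exact this
    · norm_num at this
      exact this

/-- The point obtained by scaling `x` by `c` from the center of the cube. -/
def rescale (c : ℝ) (x : Fin n → I) : Fin n → I := fun i => clamp ((1 + c * (2 * (x i : ℝ) - 1)) / 2)

lemma rescale_one (x : Fin n → I) : rescale 1 x = x :=
  funext fun i => by
    unfold rescale
    rw [show (1 + 1 * (2 * (x i : ℝ) - 1)) / 2 = x i by ring, clamp_coe]

lemma rescale_mem_boundary {c : ℝ} {x : Fin n → I} (hx : 0 < radius x) (h : 1 ≤ c * radius x) :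
    rescale c x ∈ Cube.boundary (Fin n) := by
  obtain ⟨i, hi⟩ := exists_radius_eq x hx
  refine ⟨i, ?_⟩
  rcases abs_choice (2 * (x i : ℝ) - 1) with h' | h'
  · refine Or.inr (clamp_of_ge ?_)
    rw [hi] at h'
    rw [← h']
    linarith
  · refine Or.inl (clamp_of_le ?_)
    rw [hi] at h'
    have : 2 * (x i : ℝ) - 1 = - radius x := by linarith
    rw [this]
    linarith

/-- The gauge of `I^n × I` from the point above the center used to retract onto the open box. -/
def boxGauge (z : (Fin n → I) × I) : ℝ := max (radius z.1) ((2 - z.2) / 2)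

lemma boxGauge_pos (z : (Fin n → I) × I) : 0 < boxGauge z :=
  lt_max_of_lt_right (by linarith [z.2.2.2])

lemma boxGauge_le_one (z : (Fin n → I) × I) : boxGauge z ≤ 1 :=
  max_le (radius_le_one _) (by linarith [z.2.2.1])

@[fun_prop]
lemma continuous_boxGauge : Continuous (boxGauge (n := n)) := by
  unfold boxGauge
  fun_prop

lemma boxGauge_eq_one {z : (Fin n → I) × I} (h : z ∈ openBox (Cube.boundary (Fin n))) :
    boxGauge z = 1 := by
  refine le_antisymm (boxGauge_le_one z) ?_
  rcases h with h | h
  · exact le_max_of_le_left ((radius_eq_one_iff _).2 h).ge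
  · refine le_max_of_le_right ?_
    rw [h]
    norm_num

/-- Radial projection from the apex above the centre of the cube at height `2`. The level set
`boxGauge = 1` is the open box, so scaling `z` from the apex by the inverse of its gauge projects
onto the box. The extra parameter interpolates the scaling factor, and the height `1 - boxGauge z`
used by `s` makes it equal to `1`. Clamping handles points that leave the cube. -/
lemma exists_openBox_retract (n : ℕ) :
    ∃ (s : C((Fin n → I) × I, ((Fin n → I) × I) × I)) (r : C(((Fin n → I) × I) × I, (Fin n → I) × I)),
      (∀ z ∈ openBox (Cube.boundary (Fin n)), (s z).2 = 0) ∧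
      (∀ z, z.2 = 0 → r z ∈ openBox (Cube.boundary (Fin n))) ∧ ∀ z, r (s z) = z := by
  refine ⟨⟨fun z => (z, clamp (1 - boxGauge z)), by fun_prop⟩,
    ⟨fun z => (rescale ((1 - z.2) / boxGauge z.1) z.1.1,
      clamp (2 - (1 - z.2) / boxGauge z.1 * (2 - z.1.2))), ?_⟩, ?_, ?_, ?_⟩
  · unfold rescale
    have : ∀ z : ((Fin n → I) × I) × I, boxGauge z.1 ≠ 0 := fun z => (boxGauge_pos _).ne'
    fun_prop (disch := assumption)
  · intro z hz
    change clamp _ = 0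
    rw [boxGauge_eq_one hz]
    exact clamp_of_le (by simp)
  · rintro ⟨z, s⟩ rfl
    have hpos := boxGauge_pos z
    rcases max_choice (radius z.1) ((2 - z.2) / 2 : ℝ) with h | h
    · left
      refine rescale_mem_boundary ?_ ?_
      · rw [← h]; exact hpos
      · change 1 ≤ (1 - (0 : ℝ)) / boxGauge z * radius z.1
        rw [← h]
        change 1 ≤ (1 - (0 : ℝ)) / boxGauge z * boxGauge z
        field_simp
        norm_num
    · right
      refine clamp_of_le ?_
      change 2 - (1 - (0 : ℝ)) / boxGauge z * (2 - z.2) ≤ 0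
      have : (2 - z.2 : ℝ) = 2 * boxGauge z := by
        unfold boxGauge
        rw [h]
        ring
      rw [this]
      field_simp
      norm_num
  · intro z
    have hpos := boxGauge_pos z
    have h1 : ((clamp (1 - boxGauge z) : I) : ℝ) = 1 - boxGauge z :=
      congrArg Subtype.val (Set.projIcc_of_mem zero_le_one
        ⟨by linarith [boxGauge_le_one z], by linarith⟩)
    have h2 : (1 - ((clamp (1 - boxGauge z) : I) : ℝ)) / boxGauge z = 1 := by
      rw [h1, sub_sub_cancel, div_self hpos.ne']
    simp only [ContinuousMap.coe_mk]
    rw [h2, rescale_one, one_mul, sub_sub_cancel, clamp_coe]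

/-- The cylinder over the cube is embedded at half size around the centre, standing on the bottom.
The retraction doubles it back, and multiplies the height by a cutoff that is `1` up to radius `1 /
2` and vanishes on the sides, so the whole open box goes to the bottom. -/
lemma relLift_zero_of_openBox {X Y : Type*} [TopologicalSpace X] [TopologicalSpace Y] {f : C(X, Y)}
    {n : ℕ} (hf : RelLift f (openBox (Cube.boundary (Fin n)))) :
    RelLift f { z : (Fin n → I) × I | z.2 = 0 } := by
  refine hf.of_retract ⟨fun z => (rescale (1 / 2) z.1, clamp (z.2 / 2)), ?_⟩
    ⟨fun z => (rescale 2 z.1, clamp (min 1 (2 * (z.2 : ℝ)) * min 1 (2 - 2 * radius z.1))), ?_⟩ ?_ ?_ ?_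
  · unfold rescale
    fun_prop
  · unfold rescale
    fun_prop
  · rintro z hz
    right
    change clamp _ = 0
    rw [show z.2 = 0 from hz]
    exact clamp_of_le (by simp)
  · rintro z hz
    change clamp _ = 0
    rcases hz with hz | hz
    · rw [(radius_eq_one_iff _).2 hz]
      exact clamp_of_le (by simp)
    · rw [hz]
      exact clamp_of_le (by simp)
  · rintro ⟨x, t⟩
    have hx : ∀ i, ((rescale (1 / 2) x i : I) : ℝ) = (1 + 1 / 2 * (2 * (x i : ℝ) - 1)) / 2 := fun i =>
      congrArg Subtype.val (Set.projIcc_of_mem zero_le_one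
        ⟨by linarith [(x i).2.1], by linarith [(x i).2.2]⟩)
    have ht : ((clamp ((t : ℝ) / 2) : I) : ℝ) = t / 2 :=
      congrArg Subtype.val (Set.projIcc_of_mem zero_le_one
        ⟨by linarith [t.2.1], by linarith [t.2.2]⟩)
    have hr : radius (rescale (1 / 2) x) ≤ 1 / 2 := by
      refine (pi_norm_le_iff_of_nonneg (by norm_num)).2 fun i => ?_
      rw [hx, show 2 * ((1 + 1 / 2 * (2 * (x i : ℝ) - 1)) / 2) - 1 = 1 / 2 * (2 * (x i : ℝ) - 1) by ring,
        norm_mul, Real.norm_eq_abs (2 * (x i : ℝ) - 1)]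
      have := abs_two_mul_sub_le (x i)
      norm_num
      linarith
    simp only [ContinuousMap.coe_mk]
    refine Prod.ext (funext fun i => ?_) ?_
    · unfold rescale at hx ⊢
      simp only
      rw [hx, show (1 + 2 * (2 * ((1 + 1 / 2 * (2 * (x i : ℝ) - 1)) / 2) - 1)) / 2 = x i by ring, clamp_coe]
    · simp only
      rw [ht, show 2 * ((t : ℝ) / 2) = t by ring, min_eq_right t.2.2,
        min_eq_left (by linarith), mul_one, clamp_coe]

end Retract

/-! ### Fibrations and open boxes -/

section Fib

variable {A B : Type*} [TopologicalSpace A] [TopologicalSpace B] {S : Set A} {S' : Set B}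
  {X Y : Type*} [TopologicalSpace X] [TopologicalSpace Y] {f : C(X, Y)}

lemma IsFib.openBox (hf : IsFib f) (h : IsCubePair S) : RelLift f (openBox S) := by
  obtain ⟨n, e, he⟩ := h
  obtain ⟨s, r, hs, hr, hrs⟩ := exists_openBox_retract n
  exact RelLift.homeomorph ((hf.relLift (isCubePair_cube n).cyl).of_retract s r hs hr hrs)
    (e.prodCongr (Homeomorph.refl _)) fun z => or_congr (he z.1) Iff.rfl

lemma isClosed_openBox (hS : IsClosed S) : IsClosed (openBox S) :=
  (hS.preimage continuous_fst).union (isClosed_eq continuous_snd continuous_const)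

/-- First lift on the lid relative to its boundary, then the whole boundary of the cylinder is
prescribed and a second lift fills it. -/
lemma IsTrivFib.openBox (hf : IsTrivFib f) (h : IsCubePair S) : RelLift f (openBox S) := by
  by_cases hA : Nonempty A
  swap
  · rw [not_nonempty_iff] at hA
    exact fun φ Ψ w => ⟨⟨fun z => isEmptyElim z.1, continuous_of_const fun z => isEmptyElim z.1⟩,
      fun z => isEmptyElim z.1.1, fun z => isEmptyElim z.1⟩
  by_cases hX : Nonempty X
  swap
  · rw [not_nonempty_iff] at hX
    exact fun φ => isEmptyElim (φ ⟨(hA.some, 0), Or.inr rfl⟩)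
  refine RelLift.of_total fun φ hφ Ψ w => ?_
  obtain ⟨k, hk1, hk2⟩ := (hf.relLift h).exists_lift (φ := fun a => φ (a, 1))
    (hφ.comp (by fun_prop) fun a ha => Or.inl ha) (Ψ.comp ⟨fun a => (a, 1), by fun_prop⟩)
    fun a ha => w _ (Or.inl ha)
  obtain ⟨φ', h1, h2, h3⟩ := exists_glue (isClosed_openBox h.isClosed)
    (isClosed_eq (continuous_snd (X := A)) (continuous_const (y := (1 : I)))) hφ
    (k.continuous.comp continuous_fst).continuousOn (by
      rintro ⟨a, t⟩ (ha | rfl) ht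
      · rw [show t = 1 from ht]; exact (hk1 a ha).symm
      · exact absurd ht zero_ne_one)
  obtain ⟨K, hK1, hK2⟩ := (hf.relLift h.cyl).exists_lift (φ := φ')
    (h1.mono (by rintro z (hz | hz | hz); exacts [Or.inl (Or.inl hz), Or.inl (Or.inr hz), Or.inr hz]))
    Ψ (by
      have hb : ∀ z ∈ QModel.openBox S, f (φ' z) = Ψ z := fun z hz => by rw [h2 z hz, w z hz]
      rintro z (hz | hz | hz)
      · exact hb z (Or.inl hz)
      · exact hb z (Or.inr hz)
      · rw [h3 z hz]
        obtain ⟨a, t⟩ := z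
        rw [show t = 1 from hz]
        exact hk2 a)
  refine ⟨K, fun z hz => ?_, hK2⟩
  rw [hK1 z (hz.imp_right Or.inl), h2 z hz]

lemma IsTrivFib.isFib (hf : IsTrivFib f) : IsFib f := fun n =>
  relLift_zero_of_openBox (hf.openBox (isCubePair_cube n))

lemma IsTrivFib.relLift_prod (hf : IsTrivFib f) (h : IsCubePair S) (h' : IsCubePair S') :
    RelLift f { z : A × B | z.1 ∈ S ∨ z.2 ∈ S' } := hf.relLift (h.prod h')

/-- The open box retract is applied in the coordinates `A × I` with `B` carried along. This is
lifting against the pushout-product of a boundary inclusion with a cylinder inclusion. -/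
lemma IsFib.relLift_prod (hf : IsFib f) (h : IsCubePair S) (h' : IsCubePair S') :
    RelLift f { z : A × (B × I) | z.1 ∈ S ∨ z.2.2 = 0 } := by
  obtain ⟨n, e, he⟩ := h
  obtain ⟨s, r, hs, hr, hrs⟩ := exists_openBox_retract n
  refine (hf.relLift ((isCubePair_cube n).cyl.prod h')).of_retract
    ⟨fun z => (((s (e z.1, z.2.2)).1, z.2.1), (s (e z.1, z.2.2)).2), by fun_prop⟩
    ⟨fun z => (e.symm (r (z.1.1, z.2)).1, z.1.2, (r (z.1.1, z.2)).2), by fun_prop⟩ ?_ ?_ ?_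
  · rintro ⟨a, b, t⟩ hz
    exact hs _ (hz.imp_left fun ha => (he a).1 ha)
  · rintro ⟨⟨z, b⟩, t⟩ hz
    exact (hr (z, t) hz).imp_left fun hz => (he _).2 (by simpa using hz)
  · rintro ⟨a, b, t⟩
    simp [hrs]

end Fib

/-! ### Homotopy extension and box filling -/

section Fill

variable {A : Type*} [TopologicalSpace A] {S : Set A} {X : Type*} [TopologicalSpace X]

/-- A map on the bottom extends constantly along the interval. With target a point, lifting results
for fibrations become extension results for maps into arbitrary `X`. -/
lemma isFib_toUnit : IsFib (ContinuousMap.mk (fun _ : X => PUnit.unit.{1})) := fun n φ Ψ w =>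
  ⟨⟨fun z => φ ⟨(z.1, 0), rfl⟩, by fun_prop⟩, by
    rintro ⟨⟨a, t⟩, h⟩
    obtain rfl : t = 0 := h
    rfl, fun _ => rfl⟩

/-- The homotopy extension property. -/
lemma IsCubePair.exists_extension (h : IsCubePair S) (a : C(A, X)) {H : A × I → X}
    (hH : ContinuousOn H { z | z.1 ∈ S }) (w : ∀ x ∈ S, H (x, 0) = a x) :
    ∃ K : C(A × I, X), (∀ x, K (x, 0) = a x) ∧ ∀ x ∈ S, ∀ t, K (x, t) = H (x, t) := by
  obtain ⟨φ, h1, h2, h3⟩ := exists_glue (h.isClosed.preimage continuous_fst)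
    (isClosed_eq (continuous_snd (X := A)) (continuous_const (y := (0 : I)))) hH
    (a.continuous.comp continuous_fst).continuousOn (by
      rintro ⟨x, t⟩ hx ht
      rw [show t = 0 from ht]
      exact w x hx)
  obtain ⟨K, hK, -⟩ := (isFib_toUnit.openBox h).exists_lift h1 (ContinuousMap.const _ PUnit.unit)
    fun _ _ => rfl
  exact ⟨K, fun x => (hK (x, 0) (Or.inr rfl)).trans (h3 (x, 0) rfl),
    fun x hx t => (hK (x, t) (Or.inl hx)).trans (h2 (x, t) hx)⟩

/-- The homotopy extension property, from the other end. -/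
lemma IsCubePair.exists_extension_one (h : IsCubePair S) (a : C(A, X)) {H : A × I → X}
    (hH : ContinuousOn H { z | z.1 ∈ S }) (w : ∀ x ∈ S, H (x, 1) = a x) :
    ∃ K : C(A × I, X), (∀ x, K (x, 1) = a x) ∧ ∀ x ∈ S, ∀ t, K (x, t) = H (x, t) := by
  obtain ⟨K, h1, h2⟩ := h.exists_extension a (H := fun z => H (z.1, σ z.2))
    (hH.comp (by fun_prop) fun z hz => hz) (by simpa using w)
  refine ⟨K.comp ⟨fun z => (z.1, σ z.2), by fun_prop⟩, fun x => ?_, fun x hx t => ?_⟩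
  · simpa using h1 x
  · simpa using h2 x hx (σ t)

/-- Filling of an open box: given a homotopy on `A × I`, homotopies on its ends and a compatible
homotopy on `S × I`, there is a homotopy closing the box. -/
lemma IsCubePair.exists_fill (h : IsCubePair S) (b c₀ c₁ : C(A × I, X)) {v : (A × I) × I → X}
    (hv : ContinuousOn v { z | z.1.1 ∈ S }) (h₀ : ∀ x, c₀ (x, 0) = b (x, 0))
    (h₁ : ∀ x, c₁ (x, 0) = b (x, 1)) (hb : ∀ x ∈ S, ∀ t, v ((x, t), 0) = b (x, t))
    (hv₀ : ∀ x ∈ S, ∀ s, v ((x, 0), s) = c₀ (x, s)) (hv₁ : ∀ x ∈ S, ∀ s, v ((x, 1), s) = c₁ (x, s)) :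
    ∃ M : C(A × I, X), (∀ x, M (x, 0) = c₀ (x, 1)) ∧ (∀ x, M (x, 1) = c₁ (x, 1)) ∧
      ∀ x ∈ S, ∀ t, M (x, t) = v ((x, t), 1) := by
  have hc : ∀ c : I, IsClosed { z : (A × I) × I | z.1.2 = c } := fun c =>
    isClosed_eq (by fun_prop) continuous_const
  obtain ⟨φ, h1, h2, h3⟩ := exists_glue (h.isClosed.preimage (continuous_fst.comp continuous_fst))
    (hc 0) hv (c₀.continuous.comp (by fun_prop : Continuous fun z : (A × I) × I => (z.1.1, z.2))).continuousOn (by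
      rintro ⟨⟨x, t⟩, s⟩ hx ht
      rw [show t = 0 from ht]
      exact hv₀ x hx s)
  obtain ⟨ψ, h4, h5, h6⟩ := exists_glue
    ((h.isClosed.preimage (continuous_fst.comp continuous_fst)).union (hc 0)) (hc 1) h1
    (c₁.continuous.comp (by fun_prop : Continuous fun z : (A × I) × I => (z.1.1, z.2))).continuousOn (by
      rintro ⟨⟨x, t⟩, s⟩ (hx | h0) ht
      · rw [h2 _ hx, show t = 1 from ht]
        exact hv₁ x hx s
      · exact absurd (h0.symm.trans ht) zero_ne_one)
  have e0 : ∀ x s, ψ ((x, 0), s) = c₀ (x, s) := fun x s =>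
    (h5 _ (Or.inr rfl)).trans (h3 _ rfl)
  have e1 : ∀ x s, ψ ((x, 1), s) = c₁ (x, s) := fun x s => h6 _ rfl
  have e2 : ∀ x ∈ S, ∀ t s, ψ ((x, t), s) = v ((x, t), s) := fun x hx t s =>
    (h5 _ (Or.inl hx)).trans (h2 _ hx)
  -- Homotopy extension for `A × I` and its boundary, with `b` as bottom and the walls glued into
  -- `ψ`; the end at `1` closes the box.
  obtain ⟨K, hK1, hK2⟩ := h.cyl.exists_extension b (H := ψ)
    (h4.mono (by rintro z (hz | hz | hz); exacts [Or.inl (Or.inl hz), Or.inl (Or.inr hz), Or.inr hz])) (by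
      rintro ⟨x, t⟩ (hx | ht | ht)
      · rw [e2 x hx, hb x hx]
      · rw [show t = 0 from ht, e0, h₀]
      · rw [show t = 1 from ht, e1, h₁])
  refine ⟨K.comp ⟨fun z => (z, 1), by fun_prop⟩, fun x => ?_, fun x => ?_, fun x hx t => ?_⟩
  · exact (hK2 (x, 0) (Or.inr (Or.inl rfl)) 1).trans (e0 x 1)
  · exact (hK2 (x, 1) (Or.inr (Or.inr rfl)) 1).trans (e1 x 1)
  · exact (hK2 (x, t) (Or.inl hx) 1).trans (e2 x hx t 1)

end Fill

/-! ### Relative homotopies -/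

section HRel

variable {A A' X Y : Type*} [TopologicalSpace A] [TopologicalSpace A'] [TopologicalSpace X]
  [TopologicalSpace Y]

/-- `f` and `g` are homotopic relative to `S`. -/
def HRel (f g : C(A, X)) (S : Set A) : Prop :=
  ∃ K : C(A × I, X), (∀ x, K (x, 0) = f x) ∧ (∀ x, K (x, 1) = g x) ∧ ∀ x ∈ S, ∀ t, K (x, t) = f x

variable {f g k : C(A, X)} {S : Set A}

lemma hRel_iff : HRel f g S ↔ f.HomotopicRel g S := by
  constructor
  · rintro ⟨K, h0, h1, hS⟩
    exact ⟨{ toFun := fun z => K (z.2, z.1)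
             continuous_toFun := by fun_prop
             map_zero_left := h0
             map_one_left := h1
             prop' := fun t x hx => hS x hx t }⟩
  · rintro ⟨F⟩
    exact ⟨⟨fun z => F (z.2, z.1), by fun_prop⟩, by simp, by simp, fun x hx t => F.eq_fst t hx⟩

lemma HRel.symm (h : HRel f g S) : HRel g f S := hRel_iff.2 (hRel_iff.1 h).symm

lemma HRel.trans (h : HRel f g S) (h' : HRel g k S) : HRel f k S :=
  hRel_iff.2 ((hRel_iff.1 h).trans (hRel_iff.1 h'))

lemma HRel.refl (f : C(A, X)) (S : Set A) : HRel f f S := hRel_iff.2 (.refl f)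

lemma HRel.postcomp (h : HRel f g S) (p : C(X, Y)) : HRel (p.comp f) (p.comp g) S := by
  obtain ⟨K, h0, h1, h2⟩ := h
  exact ⟨p.comp K, fun x => congrArg p (h0 x), fun x => congrArg p (h1 x),
    fun x hx t => congrArg p (h2 x hx t)⟩

lemma HRel.precomp {S' : Set A'} (h : HRel f g S) (p : C(A', A)) (hp : ∀ x ∈ S', p x ∈ S) :
    HRel (f.comp p) (g.comp p) S' := by
  obtain ⟨K, h0, h1, h2⟩ := h
  exact ⟨K.comp ⟨fun z => (p z.1, z.2), by fun_prop⟩, fun x => h0 _, fun x => h1 _,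
    fun x hx t => h2 _ (hp x hx) t⟩

end HRel

/-! ### Collapsing the boundary of a cube -/

section MaxMin

variable {n : ℕ}

/-- The largest coordinate. -/
def maxCoord (v : Fin (n + 1) → ℝ) : ℝ := Finset.univ.sup' Finset.univ_nonempty v

/-- The smallest coordinate. -/
def minCoord (v : Fin (n + 1) → ℝ) : ℝ := Finset.univ.inf' Finset.univ_nonempty v

lemma le_maxCoord (v : Fin (n + 1) → ℝ) (i : Fin (n + 1)) : v i ≤ maxCoord v :=
  Finset.le_sup' v (Finset.mem_univ i)

lemma minCoord_le (v : Fin (n + 1) → ℝ) (i : Fin (n + 1)) : minCoord v ≤ v i :=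
  Finset.inf'_le v (Finset.mem_univ i)

lemma exists_eq_maxCoord (v : Fin (n + 1) → ℝ) : ∃ i, v i = maxCoord v := by
  obtain ⟨i, -, hi⟩ := Finset.exists_mem_eq_sup' Finset.univ_nonempty v
  exact ⟨i, hi.symm⟩

lemma exists_eq_minCoord (v : Fin (n + 1) → ℝ) : ∃ i, v i = minCoord v := by
  obtain ⟨i, -, hi⟩ := Finset.exists_mem_eq_inf' Finset.univ_nonempty v
  exact ⟨i, hi.symm⟩

@[fun_prop]
lemma continuous_maxCoord : Continuous (maxCoord (n := n)) :=
  Continuous.finset_sup'_apply _ fun i _ => continuous_apply i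

@[fun_prop]
lemma continuous_minCoord : Continuous (minCoord (n := n)) :=
  Continuous.finset_inf'_apply _ fun i _ => continuous_apply i

lemma maxCoord_affine (v : Fin (n + 1) → ℝ) {c : ℝ} (hc : 0 ≤ c) (d : ℝ) :
    maxCoord (fun i => c * v i + d) = c * maxCoord v + d := by
  obtain ⟨i, hi⟩ := exists_eq_maxCoord v
  obtain ⟨j, hj⟩ := exists_eq_maxCoord fun i => c * v i + d
  refine le_antisymm ?_ ?_
  · rw [← hj]
    gcongr
    exact le_maxCoord v j
  · rw [← hi]
    exact le_maxCoord (fun i => c * v i + d) i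

lemma minCoord_affine (v : Fin (n + 1) → ℝ) {c : ℝ} (hc : 0 ≤ c) (d : ℝ) :
    minCoord (fun i => c * v i + d) = c * minCoord v + d := by
  obtain ⟨i, hi⟩ := exists_eq_minCoord v
  obtain ⟨j, hj⟩ := exists_eq_minCoord fun i => c * v i + d
  refine le_antisymm ?_ ?_
  · rw [← hi]
    exact minCoord_le (fun i => c * v i + d) i
  · rw [← hj]
    gcongr
    exact minCoord_le v j

lemma minCoord_le_maxCoord (v : Fin (n + 1) → ℝ) : minCoord v ≤ maxCoord v :=
  (minCoord_le v 0).trans (le_maxCoord v 0)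

/-- The quotient stays in `[0, 1]`, so at zeros of `c` the product is squeezed by `a`, which
vanishes there. This handles the centre of the cube, where the oscillation is zero. -/
lemma continuous_mul_div {T : Type*} [TopologicalSpace T] {a b c : T → ℝ} (ha : Continuous a)
    (hb : Continuous b) (hc : Continuous c) (h0 : ∀ t, 0 ≤ b t) (hbc : ∀ t, b t ≤ c t)
    (hac : ∀ t, c t = 0 → a t = 0) : Continuous fun t => a t * (b t / c t) := by
  rw [continuous_iff_continuousAt]
  intro t
  by_cases ht : c t = 0
  · have hz : a t * (b t / c t) = 0 := by rw [hac t ht, zero_mul]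
    change Filter.Tendsto _ _ (nhds (a t * (b t / c t)))
    rw [hz]
    refine squeeze_zero_norm (a := fun t => |a t|) (fun t => ?_) ?_
    · rw [norm_mul, Real.norm_eq_abs]
      refine mul_le_of_le_one_right (abs_nonneg _) ?_
      rw [Real.norm_eq_abs, abs_of_nonneg (div_nonneg (h0 t) ((h0 t).trans (hbc t)))]
      exact div_le_one_of_le₀ (hbc t) ((h0 t).trans (hbc t))
    · have := (ha.abs.continuousAt (x := t)).tendsto
      rwa [hac t ht, abs_zero] at this
  · exact ha.continuousAt.mul (hb.continuousAt.div hc.continuousAt ht)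

end MaxMin

section Collapse

variable {n : ℕ}

/-- The coordinates of `x` centered at the center of the cube, followed by `0`. -/
def centered (x : Fin n → I) : Fin (n + 1) → ℝ :=
  Fin.snoc (α := fun _ => ℝ) (fun i => 2 * (x i : ℝ) - 1) 0

@[fun_prop]
lemma continuous_centered : Continuous (centered (n := n)) :=
  Continuous.finSnoc (by fun_prop) continuous_const

lemma centered_castSucc (x : Fin n → I) (i : Fin n) : centered x i.castSucc = 2 * (x i : ℝ) - 1 :=
  Fin.snoc_castSucc (α := fun _ => ℝ) 0 _ i

lemma centered_last (x : Fin n → I) : centered x (Fin.last n) = 0 :=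
  Fin.snoc_last (α := fun _ => ℝ) 0 _

/-- The oscillation of the coordinates. -/
def osc (v : Fin (n + 1) → ℝ) : ℝ := maxCoord v - minCoord v

lemma osc_nonneg (v : Fin (n + 1) → ℝ) : 0 ≤ osc v := sub_nonneg.2 (minCoord_le_maxCoord v)

@[fun_prop]
lemma continuous_osc : Continuous (osc (n := n)) := by unfold osc; fun_prop

lemma eq_of_osc_eq_zero {v : Fin (n + 1) → ℝ} (h : osc v = 0) (i j : Fin (n + 1)) : v i = v j := by
  have := sub_eq_zero.1 h
  linarith [minCoord_le v i, le_maxCoord v i, minCoord_le v j, le_maxCoord v j]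

/-- Thanks to the appended coordinate `0`, equal coordinates of `centered x` must all be zero. -/
lemma radius_eq_zero {x : Fin n → I} (h : osc (centered x) = 0) : radius x = 0 := by
  unfold radius
  have : (fun i => 2 * (x i : ℝ) - 1) = 0 := funext fun i => by
    have := eq_of_osc_eq_zero h i.castSucc (Fin.last n)
    rwa [centered_castSucc, centered_last] at this
  rw [this, norm_zero]

/-- The distance along a ray from the center to the boundary, reflected at the half way point. -/
def profile (x : Fin n → I) : ℝ := min (2 * radius x) (2 - 2 * radius x)

lemma profile_nonneg (x : Fin n → I) : 0 ≤ profile x :=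
  le_min (by linarith [radius_nonneg x]) (by linarith [radius_le_one x])

lemma profile_eq_zero {x : Fin n → I} (h : osc (centered x) = 0) : profile x = 0 := by
  unfold profile
  rw [radius_eq_zero h]
  norm_num

/-- The map collapsing the boundary of the cube onto a vertex of a cube of one dimension more, in
such a way that the halves of each ray go to the faces meeting, respectively not meeting, at that
vertex, and become parallel after projection along the diagonal. -/
def collapseCoord (x : Fin n → I) (i : Fin (n + 1)) : ℝ :=
  profile x / osc (centered x) * centered x i +
    (max 0 (1 - 2 * radius x) - profile x / osc (centered x) * minCoord (centered x))

lemma profile_div_nonneg (x : Fin n → I) : 0 ≤ profile x / osc (centered x) :=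
  div_nonneg (profile_nonneg x) (osc_nonneg _)

lemma profile_div_mul (x : Fin n → I) : profile x / osc (centered x) * osc (centered x) = profile x := by
  by_cases h : osc (centered x) = 0
  · rw [h, mul_zero, profile_eq_zero h]
  · exact div_mul_cancel₀ _ h

lemma minCoord_collapseCoord (x : Fin n → I) :
    minCoord (collapseCoord x) = max 0 (1 - 2 * radius x) := by
  unfold collapseCoord
  rw [minCoord_affine _ (profile_div_nonneg x)]
  ring

lemma maxCoord_collapseCoord (x : Fin n → I) :
    maxCoord (collapseCoord x) = profile x + max 0 (1 - 2 * radius x) := by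
  have := profile_div_mul x
  unfold collapseCoord
  rw [maxCoord_affine _ (profile_div_nonneg x)]
  unfold osc at this ⊢
  linarith

lemma collapse_cases (x : Fin n → I) :
    (profile x = 2 * radius x ∧ max 0 (1 - 2 * radius x) = 1 - 2 * radius x ∧ radius x ≤ 1 / 2) ∨
      (profile x = 2 - 2 * radius x ∧ max 0 (1 - 2 * radius x) = 0) := by
  unfold profile
  rcases le_total (radius x) (1 / 2) with h | h
  · exact Or.inl ⟨min_eq_left (by linarith), max_eq_right (by linarith), h⟩
  · exact Or.inr ⟨min_eq_right (by linarith), max_eq_left (by linarith)⟩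

/-- The radius can be read off from the image point, which is the first half of the injectivity of
the collapse. -/
lemma two_mul_radius (x : Fin n → I) :
    2 * radius x = 2 - maxCoord (collapseCoord x) - minCoord (collapseCoord x) := by
  rw [maxCoord_collapseCoord, minCoord_collapseCoord]
  rcases collapse_cases x with ⟨h1, h2, -⟩ | ⟨h1, h2⟩ <;> rw [h1, h2] <;> ring

lemma continuous_collapseCoord (i : Fin (n + 1)) :
    Continuous fun x : Fin n → I => collapseCoord x i := by
  have : ∀ x : Fin n → I, collapseCoord x i =
      profile x * ((centered x i - minCoord (centered x)) / osc (centered x)) +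
        max 0 (1 - 2 * radius x) := fun x => by unfold collapseCoord; ring
  simp only [this]
  refine Continuous.add (continuous_mul_div (by unfold profile; fun_prop) (by fun_prop) (by fun_prop)
    (fun x => ?_) (fun x => ?_) fun x => profile_eq_zero) (by fun_prop)
  · exact sub_nonneg.2 (minCoord_le _ _)
  · exact sub_le_sub_right (le_maxCoord _ _) _

lemma collapseCoord_mem (x : Fin n → I) (i : Fin (n + 1)) : collapseCoord x i ∈ I := by
  constructor
  · refine le_trans ?_ (minCoord_le _ i)
    rw [minCoord_collapseCoord]
    exact le_max_left _ _
  · refine (le_maxCoord _ i).trans ?_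
    rw [maxCoord_collapseCoord]
    rcases collapse_cases x with ⟨h1, h2, -⟩ | ⟨h1, h2⟩ <;> rw [h1, h2]
    · linarith
    · have : 1 - 2 * radius x ≤ 0 := by rw [← h2]; exact le_max_right _ _
      linarith

/-- The base point of the boundary of the cube. -/
def basePt (n : ℕ) : Cube.boundary (Fin (n + 1)) := ⟨fun _ => 1, 0, Or.inr rfl⟩

/-- `c` exhibits the boundary of `I^(n+1)`, pointed by `(1, …, 1)`, as the quotient `I^n / ∂I^n`. -/
structure IsTopCollapse (c : C(Fin n → I, Cube.boundary (Fin (n + 1)))) : Prop where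
  eq_basePt_iff : ∀ x, c x = basePt n ↔ x ∈ Cube.boundary (Fin n)
  eq_of_eq : ∀ x y, c x = c y → x = y ∨ x ∈ Cube.boundary (Fin n)
  surjective : ∀ b, b = basePt n ∨ ∃ x, c x = b

/-- A map collapsing the boundary of the cube. -/
def collapse (n : ℕ) : C(Fin n → I, Cube.boundary (Fin (n + 1))) where
  toFun x := ⟨fun i => unitInterval.symm ⟨collapseCoord x i, collapseCoord_mem x i⟩, by
    rcases collapse_cases x with ⟨h1, h2, -⟩ | ⟨h1, h2⟩
    · obtain ⟨i, hi⟩ := exists_eq_maxCoord (collapseCoord x)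
      refine ⟨i, Or.inl (Subtype.ext ?_)⟩
      rw [maxCoord_collapseCoord, h1, h2] at hi
      simp [hi]
    · obtain ⟨i, hi⟩ := exists_eq_minCoord (collapseCoord x)
      refine ⟨i, Or.inr (Subtype.ext ?_)⟩
      rw [minCoord_collapseCoord, h2] at hi
      simp [hi]⟩
  continuous_toFun := by
    refine Continuous.subtype_mk (continuous_pi fun i => ?_) _
    exact unitInterval.continuous_symm.comp ((continuous_collapseCoord i).subtype_mk _)

lemma collapse_apply (x : Fin n → I) (i : Fin (n + 1)) :
    (((collapse n x : Fin (n + 1) → I) i : I) : ℝ) = 1 - collapseCoord x i := rfl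

lemma collapse_eq_iff (x : Fin n → I) (b : Cube.boundary (Fin (n + 1))) :
    collapse n x = b ↔ ∀ i, collapseCoord x i = 1 - ((b : Fin (n + 1) → I) i : ℝ) := by
  constructor
  · rintro rfl i
    rw [collapse_apply]
    ring
  · intro h
    refine Subtype.ext (funext fun i => Subtype.ext ?_)
    rw [collapse_apply, h]
    ring

/-- For the reflected image `z = 1 - b`, the extreme coordinates determine the radius, and the
differences from the last coordinate are proportional to the centered coordinates of `x`,
determining the direction. The outer sphere goes to `z = 0`, the base point; both data can be
inverted for every other boundary point. -/
lemma isTopCollapse_collapse (n : ℕ) : IsTopCollapse (collapse n) := by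
  constructor
  · intro x
    rw [collapse_eq_iff, ← radius_eq_one_iff]
    constructor
    · intro h
      have h0 : collapseCoord x = fun _ => 0 := funext fun i => (h i).trans (by simp [basePt])
      have := two_mul_radius x
      obtain ⟨i, hi⟩ := exists_eq_maxCoord (collapseCoord x)
      obtain ⟨j, hj⟩ := exists_eq_minCoord (collapseCoord x)
      rw [← hi, ← hj, h0] at this
      linarith
    · intro h i
      have hp : profile x = 0 := by unfold profile; rw [h]; norm_num
      unfold collapseCoord
      rw [hp, h]
      simp [basePt]
  · intro x y hxy
    have h : collapseCoord x = collapseCoord y := funext fun i => by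
      rw [(collapse_eq_iff x _).1 hxy i, (collapse_eq_iff y _).1 rfl i]
    have hr : radius x = radius y := by
      have h1 := two_mul_radius x
      have h2 := two_mul_radius y
      rw [h] at h1
      linarith
    rw [or_iff_not_imp_right, ← radius_eq_one_iff]
    intro hN
    have hN' : radius x < 1 := lt_of_le_of_ne (radius_le_one x) hN
    have hxy : (fun i => 2 * (x i : ℝ) - 1) = fun i => 2 * (y i : ℝ) - 1 := by
      rcases (radius_nonneg x).eq_or_lt with h0 | h0
      · rw [norm_eq_zero.1 (show ‖fun i => 2 * (x i : ℝ) - 1‖ = 0 from h0.symm),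
          norm_eq_zero.1 (show ‖fun i => 2 * (y i : ℝ) - 1‖ = 0 from hr.symm.trans h0.symm)]
      · have hpos : ∀ x : Fin n → I, 0 < radius x → radius x < 1 → 0 < profile x / osc (centered x) := by
          intro x h0 h1
          refine div_pos (lt_min (by linarith) (by linarith)) ((osc_nonneg _).lt_of_ne fun h => ?_)
          rw [radius_eq_zero h.symm] at h0
          exact lt_irrefl _ h0
        have hdiff : ∀ (x : Fin n → I) (i : Fin n), collapseCoord x i.castSucc -
            collapseCoord x (Fin.last n) = profile x / osc (centered x) * (2 * (x i : ℝ) - 1) := by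
          intro x i
          unfold collapseCoord
          rw [centered_castSucc, centered_last]
          ring
        have e : (profile x / osc (centered x)) • (fun i => 2 * (x i : ℝ) - 1) =
            (profile y / osc (centered y)) • (fun i => 2 * (y i : ℝ) - 1) := funext fun i => by
          simp only [Pi.smul_apply, smul_eq_mul]
          rw [← hdiff x, ← hdiff y, h]
        have e' : profile x / osc (centered x) * radius x =
            profile y / osc (centered y) * radius x := by
          have := congrArg norm e
          rw [norm_smul, norm_smul, Real.norm_of_nonneg (profile_div_nonneg x),
            Real.norm_of_nonneg (profile_div_nonneg y)] at this
          conv_rhs => rw [hr]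
          exact this
        have e'' := mul_right_cancel₀ h0.ne' e'
        rw [← e''] at e
        exact smul_right_injective _ (hpos x h0 hN').ne' e
    exact funext fun i => Subtype.ext (by have := congrFun hxy i; linarith)
  · intro b
    let z : Fin (n + 1) → ℝ := fun i => 1 - ((b : Fin (n + 1) → I) i : ℝ)
    have hz0 : ∀ i, 0 ≤ z i := fun i => sub_nonneg.2 ((b : Fin (n + 1) → I) i).2.2
    have hz1 : ∀ i, z i ≤ 1 := fun i => sub_le_self _ ((b : Fin (n + 1) → I) i).2.1
    have hm0 : 0 ≤ minCoord z := by obtain ⟨i, hi⟩ := exists_eq_minCoord z; rw [← hi]; exact hz0 i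
    have hM1 : maxCoord z ≤ 1 := by obtain ⟨i, hi⟩ := exists_eq_maxCoord z; rw [← hi]; exact hz1 i
    have hbd : minCoord z = 0 ∨ maxCoord z = 1 := by
      obtain ⟨i, hi | hi⟩ := b.2
      · exact Or.inr (le_antisymm hM1 (le_trans (by simp [z, hi]) (le_maxCoord z i)))
      · exact Or.inl (le_antisymm ((minCoord_le z i).trans (by simp [z, hi])) hm0)
    -- If `z` is constant, it is `0`, the base point, or `1`, the image of the centre.
    by_cases hosc : osc z = 0
    · rcases hbd with h | h
      · left
        refine Subtype.ext (funext fun i => Subtype.ext ?_)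
        have : z i = 0 := by
          obtain ⟨j, hj⟩ := exists_eq_minCoord z
          rw [eq_of_osc_eq_zero hosc i j, hj, h]
        simp only [z] at this
        simp only [basePt, Set.Icc.coe_one]
        linarith
      · right
        refine ⟨fun _ => ⟨1 / 2, by norm_num, by norm_num⟩, (collapse_eq_iff _ _).2 fun i => ?_⟩
        have hz : z i = 1 := by
          obtain ⟨j, hj⟩ := exists_eq_maxCoord z
          rw [eq_of_osc_eq_zero hosc i j, hj, h]
        have hr : radius (n := n) (fun _ => ⟨1 / 2, by norm_num, by norm_num⟩) = 0 := by
          unfold radius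
          norm_num
          rfl
        change _ = z i
        unfold collapseCoord profile
        rw [hz, hr]
        norm_num
    · right
      have hpos : 0 < osc z := (osc_nonneg z).lt_of_ne' hosc
      -- The direction of the preimage, read off from differences of coordinates.
      let w : Fin n → ℝ := fun i => z i.castSucc - z (Fin.last n)
      have hw : 0 < ‖w‖ := by
        rw [norm_pos_iff]
        intro h
        have : ∀ i, z i = z (Fin.last n) := fun i => by
          induction i using Fin.lastCases with
          | last => rfl
          | cast i => exact sub_eq_zero.1 (congrFun h i)
        obtain ⟨i, hi⟩ := exists_eq_maxCoord z
        obtain ⟨j, hj⟩ := exists_eq_minCoord z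
        exact hosc (by unfold osc; rw [← hi, ← hj, this i, this j, sub_self])
      -- The radius that `two_mul_radius` forces on any preimage.
      let N : ℝ := (2 - maxCoord z - minCoord z) / 2
      have hN0 : 0 < N := by unfold osc at hpos; simp only [N]; linarith
      have hN1 : N ≤ 1 := by unfold osc at hpos; simp only [N]; linarith
      let c : ℝ := N / ‖w‖
      have hc : 0 < c := div_pos hN0 hw
      have hcw : ∀ i, |c * w i| ≤ 1 := fun i => by
        rw [abs_mul, abs_of_pos hc]
        calc c * |w i| ≤ c * ‖w‖ := mul_le_mul_of_nonneg_left (norm_le_pi_norm w i) hc.le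
          _ = N := div_mul_cancel₀ _ hw.ne'
          _ ≤ 1 := hN1
      let x : Fin n → I := fun i => ⟨(1 + c * w i) / 2,
        by linarith [(abs_le.1 (hcw i)).1], by linarith [(abs_le.1 (hcw i)).2]⟩
      have hx : ∀ i, 2 * (x i : ℝ) - 1 = c * w i := fun i => by simp only [x]; ring
      have hr : radius x = N := by
        unfold radius
        rw [show (fun i => 2 * (x i : ℝ) - 1) = c • w from funext hx, norm_smul,
          Real.norm_of_nonneg hc.le]
        exact div_mul_cancel₀ _ hw.ne'
      have hcent : centered x = fun i => c * z i + -(c * z (Fin.last n)) := funext fun i => by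
        induction i using Fin.lastCases with
        | last => rw [centered_last]; ring
        | cast i => rw [centered_castSucc, hx]; simp only [w]; ring
      have hosc' : osc (centered x) = c * osc z := by
        rw [hcent]
        unfold osc
        rw [maxCoord_affine _ hc.le, minCoord_affine _ hc.le]
        ring
      have hprof : profile x = osc z ∧ max 0 (1 - 2 * radius x) = minCoord z := by
        unfold profile
        rw [hr]
        unfold osc at hpos ⊢
        simp only [N]
        rcases hbd with h | h <;> rw [h] at hpos ⊢
        · exact ⟨by rw [min_eq_right (by linarith)]; ring, by rw [max_eq_left (by linarith)]⟩
        · exact ⟨by rw [min_eq_left (by linarith)]; ring, by rw [max_eq_right (by linarith)]; ring⟩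
      refine ⟨x, (collapse_eq_iff _ _).2 fun i => ?_⟩
      change _ = z i
      unfold collapseCoord
      rw [hprof.1, hprof.2, hosc', hcent, minCoord_affine _ hc.le]
      field_simp
      ring

end Collapse

/-! ### Maps out of the quotient of a cube by its boundary -/

section Descend

variable {n : ℕ} {c : C(Fin n → I, Cube.boundary (Fin (n + 1)))}

instance compactSpace_boundary (n : ℕ) : CompactSpace (Cube.boundary (Fin n)) :=
  isCompact_iff_compactSpace.1 (isClosed_boundary n).isCompact

variable {X : Type*} [TopologicalSpace X]

/-- A continuous surjection from a compact to a Hausdorff space is a quotient map, also after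
multiplying with `Z`. The extra summand `Z` covers the base point, which the cube misses when `n =
0`. -/
lemma IsTopCollapse.exists_desc_prod (hc : IsTopCollapse c) {Z : Type*} [TopologicalSpace Z]
    [CompactSpace Z] [T2Space Z] (φ : C((Fin n → I) × Z, X)) (γ : C(Z, X))
    (h : ∀ x ∈ Cube.boundary (Fin n), ∀ z, φ (x, z) = γ z) :
    ∃ ψ : C(Cube.boundary (Fin (n + 1)) × Z, X),
      (∀ x z, ψ (c x, z) = φ (x, z)) ∧ ∀ z, ψ (basePt n, z) = γ z := by
  let π : C(((Fin n → I) × Z) ⊕ Z, Cube.boundary (Fin (n + 1)) × Z) :=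
    ⟨Sum.elim (fun z => (c z.1, z.2)) fun z => (basePt n, z), by fun_prop⟩
  let Φ : C(((Fin n → I) × Z) ⊕ Z, X) := ⟨Sum.elim φ γ, by fun_prop⟩
  have hπ : Topology.IsQuotientMap π := by
    refine π.continuous.isClosedMap.isQuotientMap π.continuous ?_
    rintro ⟨b, z⟩
    rcases hc.surjective b with rfl | ⟨x, rfl⟩
    · exact ⟨Sum.inr z, rfl⟩
    · exact ⟨Sum.inl (x, z), rfl⟩
  have hΦ : Function.FactorsThrough Φ π := by
    rintro (⟨x, z⟩ | z) (⟨x', z'⟩ | z') hab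
    · obtain ⟨h1, rfl⟩ := Prod.ext_iff.1 hab
      change c x = c x' at h1
      change φ (x, z) = φ (x', z)
      by_cases hx : x ∈ Cube.boundary (Fin n)
      · rw [h x hx, h x' ((hc.eq_basePt_iff x').1 (h1 ▸ (hc.eq_basePt_iff x).2 hx))]
      · rw [(hc.eq_of_eq x x' h1).resolve_right hx]
    · obtain ⟨h1, rfl⟩ := Prod.ext_iff.1 hab
      exact h x ((hc.eq_basePt_iff x).1 h1) z
    · obtain ⟨h1, rfl⟩ := Prod.ext_iff.1 hab
      exact (h x' ((hc.eq_basePt_iff x').1 h1.symm) z).symm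
    · obtain ⟨h1, rfl⟩ := Prod.ext_iff.1 hab
      rfl
  refine ⟨hπ.lift Φ hΦ, fun x z => ?_, fun z => ?_⟩
  · exact DFunLike.congr_fun (hπ.lift_comp Φ hΦ) (Sum.inl (x, z))
  · exact DFunLike.congr_fun (hπ.lift_comp Φ hΦ) (Sum.inr z)

lemma IsTopCollapse.exists_desc (hc : IsTopCollapse c) (φ : C(Fin n → I, X)) (x₀ : X)
    (h : ∀ x ∈ Cube.boundary (Fin n), φ x = x₀) :
    ∃ ψ : C(Cube.boundary (Fin (n + 1)), X), (∀ x, ψ (c x) = φ x) ∧ ψ (basePt n) = x₀ := by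
  obtain ⟨ψ, h1, h2⟩ := hc.exists_desc_prod (Z := PUnit.{1}) (φ.comp ContinuousMap.fst)
    (ContinuousMap.const _ x₀) fun x hx _ => h x hx
  exact ⟨ψ.comp ⟨fun b => (b, PUnit.unit), by fun_prop⟩, fun x => h1 x _, h2 _⟩

lemma IsTopCollapse.apply_boundary (hc : IsTopCollapse c) {x : Fin n → I}
    (hx : x ∈ Cube.boundary (Fin n)) : c x = basePt n := (hc.eq_basePt_iff x).2 hx

omit [TopologicalSpace X] in
lemma IsTopCollapse.ext (hc : IsTopCollapse c) {α β : Cube.boundary (Fin (n + 1)) → X}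
    (h : ∀ x, α (c x) = β (c x)) (h' : α (basePt n) = β (basePt n)) (b) : α b = β b := by
  rcases hc.surjective b with rfl | ⟨x, rfl⟩
  exacts [h', h x]

/-- Based maps on the quotient are homotopic relative to the base point if they are so on the cube,
relative to its boundary. -/
lemma IsTopCollapse.hRel_iff (hc : IsTopCollapse c) {α β : C(Cube.boundary (Fin (n + 1)), X)}
    (h : α (basePt n) = β (basePt n)) :
    HRel α β {basePt n} ↔ HRel (α.comp c) (β.comp c) (Cube.boundary (Fin n)) := by
  constructor
  · exact fun h => h.precomp c fun x hx => hc.apply_boundary hx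
  · rintro ⟨K, h0, h1, h2⟩
    obtain ⟨ψ, hψ1, hψ2⟩ := hc.exists_desc_prod K (ContinuousMap.const _ (α (basePt n)))
      fun x hx z => by
        rw [h2 x hx]
        exact congrArg α (hc.apply_boundary hx)
    refine ⟨ψ, hc.ext (fun x => ?_) (hψ2 _), hc.ext (fun x => ?_) ?_, ?_⟩
    · rw [hψ1, h0]; rfl
    · rw [hψ1, h1]; rfl
    · rw [hψ2, ← h]; rfl
    · rintro _ rfl t
      exact hψ2 t

end Descend

/-! ### Weak equivalences of spaces -/

section WE

variable {X Y Z : Type*} [TopologicalSpace X] [TopologicalSpace Y] [TopologicalSpace Z]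

/-- The weak right lifting property against the boundary inclusions of cubes. -/
def IsWE (f : C(X, Y)) : Prop := ∀ (n : ℕ) (p : C(Cube.boundary (Fin n), X)) (q : C(Fin n → I, Y)),
  (∀ b, f (p b) = q b) → ∃ h : C(Fin n → I, X), (∀ b : Cube.boundary (Fin n), h b = p b) ∧
    HRel (f.comp h) q (Cube.boundary (Fin n))

variable {f : C(X, Y)} {g : C(Y, Z)}

lemma isEmpty_boundary : IsEmpty (Cube.boundary (Fin 0)) := ⟨fun b => by
  obtain ⟨i, -⟩ := b.2
  exact i.elim0⟩

/-- A point of the target is connected by a path to the image of a point. -/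
lemma IsWE.exists_path (hf : IsWE f) (y : Y) :
    ∃ (x : X) (γ : C(I, Y)), γ 0 = f x ∧ γ 1 = y := by
  have := isEmpty_boundary
  obtain ⟨h, -, K, hK0, hK1, -⟩ := hf 0 ⟨fun b => isEmptyElim b, continuous_of_const fun b => isEmptyElim b⟩
    (ContinuousMap.const _ y) fun b => isEmptyElim b
  exact ⟨h Fin.elim0, K.comp ⟨fun t => (Fin.elim0, t), by fun_prop⟩, hK0 _, hK1 _⟩

lemma isWE_of_total (h0 : Nonempty Y → Nonempty X)
    (h : ∀ (n : ℕ) (p : (Fin n → I) → X), ContinuousOn p (Cube.boundary (Fin n)) →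
      ∀ q : C(Fin n → I, Y), (∀ b ∈ Cube.boundary (Fin n), f (p b) = q b) →
      ∃ h : C(Fin n → I, X), (∀ b ∈ Cube.boundary (Fin n), h b = p b) ∧
        HRel (f.comp h) q (Cube.boundary (Fin n))) : IsWE f := by
  intro n p q w
  have := h0 ⟨q fun _ => 0⟩
  obtain ⟨p', hp, hp'⟩ := exists_total p
  obtain ⟨k, hk, hk'⟩ := h n p' hp q fun b hb => by rw [hp' ⟨b, hb⟩, w]
  exact ⟨k, fun b => by rw [hk b b.2, hp'], hk'⟩

section Pair

variable {A : Type*} [TopologicalSpace A] {S : Set A}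

lemma IsWE.exists_lift (hf : IsWE f) (h : IsCubePair S) {p : A → X} (hp : ContinuousOn p S)
    (q : C(A, Y)) (w : ∀ a ∈ S, f (p a) = q a) :
    ∃ k : C(A, X), (∀ a ∈ S, k a = p a) ∧ HRel (f.comp k) q S := by
  obtain ⟨n, e, he⟩ := h
  have he' : ∀ b ∈ Cube.boundary (Fin n), e.symm b ∈ S := fun b hb => (he _).2 (by simpa using hb)
  obtain ⟨k, hk, hk'⟩ := hf n ⟨fun b => p (e.symm b), ContinuousOn.comp_continuous hp
    (e.symm.continuous.comp continuous_subtype_val) fun b => he' b b.2⟩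
    (q.comp ⟨e.symm, e.symm.continuous⟩) fun b => w _ (he' b b.2)
  refine ⟨k.comp ⟨e, e.continuous⟩, fun a ha => ?_, ?_⟩
  · exact (hk ⟨e a, (he a).1 ha⟩).trans (congrArg p (e.symm_apply_apply a))
  · have := hk'.precomp (S' := S) ⟨e, e.continuous⟩ fun a ha => (he a).1 ha
    rwa [ContinuousMap.comp_assoc, ContinuousMap.comp_assoc,
      show (ContinuousMap.mk e.symm e.symm.continuous).comp ⟨e, e.continuous⟩ = ContinuousMap.id A from
        ContinuousMap.ext fun a => e.symm_apply_apply a, ContinuousMap.comp_id] at this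

/-- The weak right lifting property up to a prescribed homotopy on the boundary. -/
lemma IsWE.exists_lift_of_homotopy (hf : IsWE f) (h : IsCubePair S) {p : A → X} (hp : ContinuousOn p S)
    {G : A × I → Y} (hG : ContinuousOn G { z | z.1 ∈ S }) (q : C(A, Y))
    (h0 : ∀ a ∈ S, G (a, 0) = f (p a)) (h1 : ∀ a ∈ S, G (a, 1) = q a) :
    ∃ (k : C(A, X)) (K : C(A × I, Y)), (∀ a ∈ S, k a = p a) ∧ (∀ a, K (a, 0) = f (k a)) ∧
      (∀ a, K (a, 1) = q a) ∧ ∀ a ∈ S, ∀ t, K (a, t) = G (a, t) := by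
  -- Run the boundary homotopy backwards from `q` to obtain a map whose boundary is exactly `f p`,
  -- lift that one, and compose the two homotopies by filling a box.
  obtain ⟨V, hV1, hV⟩ := h.exists_extension_one q hG h1
  obtain ⟨k, hk, H, hH0, hH1, hH⟩ := hf.exists_lift h hp (V.comp ⟨fun a => (a, 0), by fun_prop⟩)
    fun a ha => by rw [← h0 a ha]; exact (hV a ha 0).symm
  obtain ⟨M, hM0, hM1, hM⟩ := h.exists_fill V (H.comp ⟨fun z => (z.1, σ z.2), by fun_prop⟩)
    (q.comp ContinuousMap.fst) (v := fun z => G z.1)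
    (hG.comp continuous_fst.continuousOn fun z hz => hz)
    (fun x => by simpa using hH1 x) (fun x => (hV1 x).symm) (fun x hx t => (hV x hx t).symm)
    (fun x hx s => by
      refine (h0 x hx).trans (Eq.trans ?_ (hH x hx (σ s)).symm)
      exact congrArg f (hk x hx).symm)
    (fun x hx s => h1 x hx)
  refine ⟨k, M, hk, fun a => ?_, hM1, hM⟩
  rw [hM0]
  simpa using hH0 a

end Pair

lemma IsWE.comp (hf : IsWE f) (hg : IsWE g) : IsWE (g.comp f) := by
  refine isWE_of_total (fun ⟨z⟩ => ?_) fun n p hp q w => ?_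
  · obtain ⟨y, -⟩ := hg.exists_path z
    obtain ⟨x, -⟩ := hf.exists_path y
    exact ⟨x⟩
  · obtain ⟨h, hh, hH⟩ := hg.exists_lift (isCubePair_cube n)
      (f.continuous.comp_continuousOn hp) q w
    obtain ⟨k, hk, hK⟩ := hf.exists_lift (isCubePair_cube n) hp h fun a ha => (hh a ha).symm
    exact ⟨k, hk, (hK.postcomp g).trans hH⟩

/-- A weak lift for the composite gives a homotopy from `g f h` to `g q`. Together with `f h`, `q`
and the constant homotopy on the boundary it poses a lifting problem for `g` on the cylinder, whose
solution is the homotopy from `f h` to `q`. -/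
lemma IsWE.of_comp_right (hg : IsWE g) (hgf : IsWE (g.comp f)) : IsWE f := by
  refine isWE_of_total (fun ⟨y⟩ => ?_) fun n p hp q w => ?_
  · obtain ⟨x, -⟩ := hgf.exists_path (g y)
    exact ⟨x⟩
  · have hS := isCubePair_cube n
    obtain ⟨h, hh, K, hK0, hK1, hK⟩ := hgf.exists_lift hS hp (g.comp q)
      fun a ha => congrArg g (w a ha)
    refine ⟨h, hh, ?_⟩
    have hc : ∀ c : I, IsClosed { z : (Fin n → I) × I | z.2 = c } := fun c =>
      isClosed_eq (by fun_prop) continuous_const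
    obtain ⟨φ, h1, h2, h3⟩ := exists_glue ((isClosed_boundary n).preimage continuous_fst) (hc 0)
      (f := fun z => f (p z.1)) (g := fun z => f (h z.1))
      ((f.continuous.comp_continuousOn hp).comp continuous_fst.continuousOn fun z hz => hz)
      (by fun_prop) fun z hz _ => congrArg f (hh z.1 hz).symm
    obtain ⟨ψ, h4, h5, h6⟩ := exists_glue
      (((isClosed_boundary n).preimage continuous_fst).union (hc 0)) (hc 1)
      h1 (g := fun z => q z.1) (by fun_prop) (by
        rintro ⟨x, t⟩ (hx | h0) ht
        · rw [h2 _ hx]; exact w x hx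
        · exact absurd (h0.symm.trans ht) zero_ne_one)
    have e0 : ∀ x, ψ (x, 0) = f (h x) := fun x => (h5 _ (Or.inr rfl)).trans (h3 _ rfl)
    have e1 : ∀ x, ψ (x, 1) = q x := fun x => h6 _ rfl
    have e2 : ∀ x ∈ Cube.boundary (Fin n), ∀ t, ψ (x, t) = f (p x) := fun x hx t =>
      (h5 _ (Or.inl hx)).trans (h2 _ hx)
    obtain ⟨L, hL, -⟩ := hg.exists_lift hS.cyl (p := ψ)
      (h4.mono (by rintro z (hz | hz | hz); exacts [Or.inl (Or.inl hz), Or.inl (Or.inr hz), Or.inr hz]))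
      K (by
        rintro ⟨x, t⟩ (hx | ht | ht)
        · rw [e2 x hx, hK x hx]
          exact congrArg (g.comp f) (hh x hx).symm
        · rw [show t = 0 from ht, e0, hK0]; rfl
        · rw [show t = 1 from ht, e1, hK1]; rfl)
    refine ⟨L, fun x => ?_, fun x => ?_, fun x hx t => ?_⟩
    · rw [hL _ (Or.inr (Or.inl rfl)), e0]; rfl
    · rw [hL _ (Or.inr (Or.inr rfl)), e1]
    · rw [hL _ (Or.inl hx), e2 x hx]
      exact congrArg f (hh x hx).symm

/-- Maps on the boundary of a cube lift up to homotopy along a weak equivalence. -/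
lemma IsWE.exists_lift_boundary (hf : IsWE f) (n : ℕ) (φ : C(Cube.boundary (Fin n), Y)) :
    ∃ φ' : C(Cube.boundary (Fin n), X), HRel (f.comp φ') φ ∅ := by
  rcases n with _ | m
  · have := isEmpty_boundary
    exact ⟨⟨fun b => isEmptyElim b, continuous_of_const fun b => isEmptyElim b⟩,
      ⟨fun b => isEmptyElim b.1, continuous_of_const fun b => isEmptyElim b.1⟩,
      fun b => isEmptyElim b, fun b => isEmptyElim b, fun b => isEmptyElim b⟩
  -- The boundary is a cube with its own boundary collapsed. Join the image of the base point to the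
  -- image of some `x` by a path and lift the cube, following this path on the boundary; lift and
  -- homotopy descend to the quotient.
  · have hc := isTopCollapse_collapse m
    obtain ⟨x, γ, hγ0, hγ1⟩ := hf.exists_path (φ (basePt m))
    obtain ⟨k, K, hk, hK0, hK1, hK⟩ := hf.exists_lift_of_homotopy (isCubePair_cube m)
      (p := fun _ => x) continuousOn_const (G := fun z => γ z.2) (by fun_prop) (φ.comp (collapse m))
      (fun _ _ => hγ0) fun a ha => hγ1.trans (congrArg φ (hc.apply_boundary ha).symm)
    obtain ⟨φ', h1, h2⟩ := hc.exists_desc k x hk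
    obtain ⟨ψ, h3, h4⟩ := hc.exists_desc_prod K γ hK
    refine ⟨φ', ψ, hc.ext (fun a => ?_) ?_, hc.ext (fun a => ?_) ?_, by simp⟩
    · rw [h3, hK0, ContinuousMap.comp_apply, h1]
    · rw [h4, hγ0, ContinuousMap.comp_apply, h2]
    · rw [h3, hK1]; rfl
    · rw [h4, hγ1]

lemma exists_total_prod {A X : Type*} [TopologicalSpace A] [TopologicalSpace X] [Nonempty X]
    {S : Set A} (G : C(S × I, X)) : ∃ G' : A × I → X, ContinuousOn G' { z | z.1 ∈ S } ∧
      ∀ (a : A) (ha : a ∈ S) (t : I), G' (a, t) = G (⟨a, ha⟩, t) := by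
  obtain ⟨G', h1, h2⟩ := exists_total (S := { z : A × I | z.1 ∈ S })
    (G.comp ⟨fun z => (⟨z.1.1, z.2⟩, z.1.2), by fun_prop⟩)
  exact ⟨G', h1, fun a ha t => h2 ⟨(a, t), ha⟩⟩

/-- The boundary datum `φ` lies in `Y`, so it is first deformed by `G` into the image of a map to
`X`. The composite solves the deformed problem, and extending `G` from `f h` back to `φ` corrects
the solution, a filled box correcting the homotopy. -/
lemma IsWE.of_comp_left (hf : IsWE f) (hgf : IsWE (g.comp f)) : IsWE g := by
  intro n φ q w
  have hS := isCubePair_cube n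
  obtain ⟨φ', G, hG0, hG1, -⟩ := hf.exists_lift_boundary n φ
  obtain ⟨x, -⟩ := hgf.exists_path (q fun _ => 0)
  have : Nonempty X := ⟨x⟩
  have : Nonempty Y := ⟨f x⟩
  obtain ⟨p, hp, hp'⟩ := exists_total φ'
  obtain ⟨G', hG', hG''⟩ := exists_total_prod G
  obtain ⟨h, K, hh, hK0, hK1, hK⟩ := hgf.exists_lift_of_homotopy hS hp
    (G := fun z => g (G' z)) (g.continuous.comp_continuousOn hG') q
    (fun a ha => by rw [hG'' a ha, hG0, hp' ⟨a, ha⟩]; rfl)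
    (fun a ha => by rw [hG'' a ha, hG1, w])
  obtain ⟨L, hL0, hL⟩ := hS.exists_extension (f.comp h) hG' fun a ha => by
    rw [hG'' a ha, hG0, ContinuousMap.comp_apply, ContinuousMap.comp_apply, hh a ha, hp' ⟨a, ha⟩]
  obtain ⟨M, hM0, hM1, hM⟩ := hS.exists_fill (((g.comp f).comp h).comp ContinuousMap.fst) (g.comp L) K
    (v := fun z => g (G' (z.1.1, z.2)))
    (g.continuous.comp_continuousOn (hG'.comp (by fun_prop) fun z hz => hz))
    (fun x => congrArg g (hL0 x)) hK0
    (fun x hx t => by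
      change g (G' (x, 0)) = g (f (h x))
      rw [hG'' x hx, hG0, hh x hx, hp' ⟨x, hx⟩]; rfl)
    (fun x hx s => congrArg g (hL x hx s).symm) (fun x hx s => (hK x hx s).symm)
  refine ⟨L.comp ⟨fun x => (x, 1), by fun_prop⟩, fun b => ?_, M, hM0, fun x => (hM1 x).trans (hK1 x),
    fun x hx t => (hM x hx t).trans ?_⟩
  · exact (hL b b.2 1).trans ((hG'' b b.2 1).trans (hG1 b))
  · exact congrArg g (hL x hx 1).symm

lemma IsTrivFib.isWE (hf : IsTrivFib f) : IsWE f := fun n p q w => by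
  obtain ⟨K, h1, h2⟩ := hf n p q w
  refine ⟨K, h1, ?_⟩
  rw [show f.comp K = q from ContinuousMap.ext h2]
  exact HRel.refl _ _

/-- A weak lift fails only by a homotopy relative to the boundary, and a fibration lifts this
homotopy on an open box; its end is a strict lift. -/
lemma IsFib.isTrivFib (hf : IsFib f) (hw : IsWE f) : IsTrivFib f := fun n p q w => by
  obtain ⟨h, hh, K, hK0, hK1, hK⟩ := hw n p q w
  have hS := isCubePair_cube n
  obtain ⟨L, hL, hL'⟩ := (hf.openBox hS).exists_lift (φ := fun z => h z.1) (by fun_prop) K (by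
    rintro ⟨x, t⟩ (hx | ht)
    · exact (hK x hx t).symm
    · rw [show t = 0 from ht]
      exact (hK0 x).symm)
  refine ⟨L.comp ⟨fun x => (x, 1), by fun_prop⟩, fun b => ?_, fun x => ?_⟩
  · exact (hL _ (Or.inl b.2)).trans (hh b)
  · exact (hL' _).trans (hK1 x)

end WE

/-! ### Weak equivalences and maps of spheres -/

section Contraction

variable {E X Y : Type*} [TopologicalSpace E] [TopologicalSpace X] [TopologicalSpace Y] {e : E}

lemma HRel.of_contraction (C : C(E × I, E)) (h0 : ∀ x, C (x, 0) = e) (h1 : ∀ x, C (x, 1) = x)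
    (he : ∀ t, C (e, t) = e) (α β : C(E, X)) (h : α e = β e) : HRel α β {e} := by
  have key : ∀ γ : C(E, X), HRel (.const _ (γ e)) γ {e} := fun γ => by
    refine ⟨γ.comp C, fun x => congrArg γ (h0 x), fun x => congrArg γ (h1 x), ?_⟩
    rintro _ rfl t
    exact congrArg γ (he t)
  have h' := key α
  rw [h] at h'
  exact h'.symm.trans (key β)

/-- Over a contractible pointed space, homotopies that agree over the base point and have the same
ends are homotopic relative to their ends. -/
lemma exists_homotopy_of_contraction [LocallyCompactSpace E] (C : C(E × I, E))
    (h0 : ∀ x, C (x, 0) = e) (h1 : ∀ x, C (x, 1) = x) (M N : C(E × I, Y))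
    (hMN0 : ∀ x, M (x, 0) = N (x, 0)) (hMN1 : ∀ x, M (x, 1) = N (x, 1))
    (hMN : ∀ t, M (e, t) = N (e, t)) :
    ∃ W : C((E × I) × I, Y), (∀ x t, W ((x, t), 0) = M (x, t)) ∧ (∀ x t, W ((x, t), 1) = N (x, t)) ∧
      (∀ x s, W ((x, 0), s) = M (x, 0)) ∧ ∀ x s, W ((x, 1), s) = M (x, 1) := by
  -- A box is filled in the space of maps from `E` to `Y`, along the contraction parameter. At its
  -- start everything is evaluated at `e`, where `M` and `N` agree; at its end the contraction is
  -- the identity and gives back `M` and `N`.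
  let b : C(I × I, C(E, Y)) := ContinuousMap.curry ⟨fun z => M (e, z.1.1), by fun_prop⟩
  let c (F : C(E × I, Y)) : C(I × I, C(E, Y)) :=
    ContinuousMap.curry ⟨fun z => F (C (z.2, z.1.2), z.1.1), by fun_prop⟩
  let v : C((I × I) × I, C(E, Y)) :=
    ContinuousMap.curry ⟨fun z => M (C (z.2, z.1.2), z.1.1.1), by fun_prop⟩
  obtain ⟨W, hW0, hW1, hW⟩ := isCubePair_interval.exists_fill b (c M) (c N) (v := v)
    v.continuous.continuousOn
    (fun t => ContinuousMap.ext fun x => by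
      change M (C (x, 0), t) = M (e, t)
      rw [h0])
    (fun t => ContinuousMap.ext fun x => by
      change N (C (x, 0), t) = M (e, t)
      rw [h0, hMN])
    (fun t _ s => ContinuousMap.ext fun x => by
      change M (C (x, 0), t) = M (e, t)
      rw [h0])
    (fun t _ s => rfl)
    (fun t ht s => ContinuousMap.ext fun x => by
      change M (C (x, s), t) = N (C (x, s), t)
      rcases ht with rfl | rfl
      exacts [hMN0 _, hMN1 _])
  refine ⟨⟨fun z => W (z.1.2, z.2) z.1.1, by fun_prop⟩, fun x t => ?_, fun x t => ?_, fun x s => ?_,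
    fun x s => ?_⟩
  · refine (DFunLike.congr_fun (hW0 t) x).trans ?_
    change M (C (x, 1), t) = _
    rw [h1]
  · refine (DFunLike.congr_fun (hW1 t) x).trans ?_
    change N (C (x, 1), t) = _
    rw [h1]
  · refine (DFunLike.congr_fun (hW 0 (Or.inl rfl) s) x).trans ?_
    change M (C (x, 1), 0) = _
    rw [h1]
  · refine (DFunLike.congr_fun (hW 1 (Or.inr rfl) s) x).trans ?_
    change M (C (x, 1), 1) = _
    rw [h1]

end Contraction

section Spheres

variable {X Y : Type*} [TopologicalSpace X] [TopologicalSpace Y] {f : C(X, Y)}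

lemma IsWE.exists_sphere_lift (hf : IsWE f) {n : ℕ} (d : C(Cube.boundary (Fin (n + 1)), Y)) (x : X)
    (hx : d (basePt n) = f x) : ∃ α : C(Cube.boundary (Fin (n + 1)), X),
      α (basePt n) = x ∧ HRel (f.comp α) d {basePt n} := by
  have hc := isTopCollapse_collapse n
  obtain ⟨k, hk, hk'⟩ := hf.exists_lift (isCubePair_cube n) (p := fun _ => x) continuousOn_const
    (d.comp (collapse n)) fun a ha => hx.symm.trans (congrArg d (hc.apply_boundary ha).symm)
  obtain ⟨α, h1, h2⟩ := hc.exists_desc k x hk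
  refine ⟨α, h2, (hc.hRel_iff ((congrArg f h2).trans hx.symm)).2 ?_⟩
  rwa [show (f.comp α).comp (collapse n) = f.comp k from
    ContinuousMap.ext fun a => congrArg f (h1 a)]

lemma IsWE.hRel_of_comp (hf : IsWE f) {n : ℕ} {α β : C(Cube.boundary (Fin (n + 1)), X)}
    (h : α (basePt n) = β (basePt n)) (hαβ : HRel (f.comp α) (f.comp β) {basePt n}) :
    HRel α β {basePt n} := by
  have hc := isTopCollapse_collapse n
  rw [hc.hRel_iff h]
  obtain ⟨K, hK0, hK1, hK⟩ := (hc.hRel_iff (congrArg f h)).1 hαβ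
  have hcl : ∀ c : I, IsClosed { z : (Fin n → I) × I | z.2 = c } := fun c =>
    isClosed_eq (by fun_prop) continuous_const
  have hbd : ∀ a ∈ Cube.boundary (Fin n), α (collapse n a) = β (collapse n a) := fun a ha => by
    rw [hc.apply_boundary ha, h]
  obtain ⟨φ, h1, h2, h3⟩ := exists_glue
    (((isClosed_boundary n).preimage continuous_fst).union (hcl 0)) (hcl 1)
    (f := fun z => α (collapse n z.1)) (g := fun z => β (collapse n z.1)) (by fun_prop) (by fun_prop)
    (by
      rintro ⟨x, t⟩ (hx | h0) ht
      · exact hbd x hx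
      · exact absurd (h0.symm.trans ht) zero_ne_one)
  obtain ⟨L, hL, -⟩ := hf.exists_lift (isCubePair_cube n).cyl (p := φ)
    (h1.mono (by rintro z (hz | hz | hz); exacts [Or.inl (Or.inl hz), Or.inl (Or.inr hz), Or.inr hz]))
    K (by
      rintro ⟨x, t⟩ (hx | ht | ht)
      · rw [h2 _ (Or.inl hx)]
        exact (hK x hx t).symm
      · rw [h2 _ (Or.inr ht), show t = 0 from ht]
        exact (hK0 x).symm
      · rw [h3 _ ht, show t = 1 from ht]
        exact (hK1 x).symm)
  exact ⟨L, fun x => (hL _ (Or.inr (Or.inl rfl))).trans (h2 _ (Or.inr rfl)),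
    fun x => (hL _ (Or.inr (Or.inr rfl))).trans (h3 _ rfl),
    fun x hx t => (hL _ (Or.inl hx)).trans (h2 _ (Or.inl hx))⟩

/-! ### Deforming a lift of a sphere into a relative lift -/

section Deform

variable {A : Type*} [TopologicalSpace A] {S : Set A}

lemma IsCubePair.exists_openBox_retraction (hS : IsCubePair S) :
    ∃ r : C(A × I, openBox S), ∀ z : openBox S, r z = z := by
  obtain ⟨r, hr, -⟩ := (isFib_toUnit (X := openBox S)).openBox hS (.id _)
    (.const _ PUnit.unit) fun _ => rfl
  exact ⟨r, hr⟩

/-- If the sphere composed of `f h₀` on an open box and of `q` on its lid lifts up to homotopy, then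
`q` lifts up to homotopy relative to the boundary. -/
lemma IsCubePair.exists_deform [CompactSpace A] [T2Space A] (hS : IsCubePair S) {a₀ : A} (ha₀ : a₀ ∈ S)
    (c : C((A × I) × I, A × I)) (hc0 : ∀ z, c (z, 0) = (a₀, 1)) (hc1 : ∀ z, c (z, 1) = z)
    (hc : ∀ t, c ((a₀, 1), t) = (a₀, 1)) (h₀ : C(A, X)) (q : C(A, Y))
    {α : A × I → X} (hα : ContinuousOn α (cylBdry S)) (hα₀ : α (a₀, 1) = h₀ a₀)
    {N : (A × I) × I → Y} (hN : ContinuousOn N { z | z.1 ∈ cylBdry S })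
    (hN0 : ∀ z ∈ cylBdry S, N (z, 0) = f (α z)) (hNbox : ∀ z ∈ openBox S, N (z, 1) = f (h₀ z.1))
    (hNlid : ∀ x, N ((x, 1), 1) = q x) (hN₀ : ∀ t, N ((a₀, 1), t) = f (h₀ a₀)) :
    ∃ h : C(A, X), (∀ x ∈ S, h x = h₀ x) ∧ HRel (f.comp h) q S := by
  have hbox : openBox S ⊆ cylBdry S := fun z hz => hz.imp_right Or.inl
  have : CompactSpace (openBox S) := isCompact_iff_compactSpace.1 (isClosed_openBox hS.isClosed).isCompact
  obtain ⟨r, hr⟩ := hS.exists_openBox_retraction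
  let e : openBox S := ⟨(a₀, 1), Or.inl ha₀⟩
  -- A contraction of the whole cylinder becomes one of the open box after applying the retraction,
  -- and it fixes the base point.
  let C : C(openBox S × I, openBox S) := ⟨fun z => r (c (z.1, z.2)), by fun_prop⟩
  have hC0 : ∀ z, C (z, 0) = e := fun z => by
    change r (c (z, 0)) = e
    rw [hc0]
    exact hr e
  have hC1 : ∀ z, C (z, 1) = z := fun z => by
    change r (c (z, 1)) = z
    rw [hc1, hr]
  have hCe : ∀ t, C (e, t) = e := fun t => by
    change r (c ((a₀, 1), t)) = e
    rw [hc]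
    exact hr e
  let αE : C(openBox S, X) := ⟨fun z => α z, hα.comp_continuous continuous_subtype_val fun z => hbox z.2⟩
  let gE : C(openBox S, X) := ⟨fun z => h₀ z.1.1, by fun_prop⟩
  let NE : C(openBox S × I, Y) := ⟨fun z => N (z.1, z.2), hN.comp_continuous (by fun_prop)
    fun z => hbox z.1.2⟩
  -- The open box being contractible, `α` on it can be deformed to `h₀`, and by the next step the
  -- image of this deformation agrees with `N` up to a homotopy `W` relative to the ends.
  obtain ⟨R, hR0, hR1, hR⟩ := HRel.of_contraction C hC0 hC1 hCe αE gE hα₀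
  obtain ⟨W, hW0, hW1, hW2, hW3⟩ := exists_homotopy_of_contraction C hC0 hC1 (f.comp R) NE
    (fun z => (congrArg f (hR0 z)).trans (hN0 z (hbox z.2)).symm)
    (fun z => (congrArg f (hR1 z)).trans (hNbox z z.2).symm)
    (fun t => ((congrArg f (hR e rfl t)).trans (congrArg f hα₀)).trans (hN₀ t).symm)
  have hr' : ∀ (x) (hx : x ∈ S), r (x, 1) = ⟨(x, 1), Or.inl hx⟩ := fun x hx => hr ⟨(x, 1), Or.inl hx⟩
  have hlid : ∀ x : A, (x, (1 : I)) ∈ cylBdry S := fun x => Or.inr (Or.inr rfl)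
  let a : C(A, X) := ⟨fun x => α (x, 1), hα.comp_continuous (by fun_prop) hlid⟩
  -- Drag the lid of `α` along `R` on its boundary; at the end it equals `h₀` on `S`. The map `W`
  -- supplies the wall of the box comparing its image with `q`.
  obtain ⟨L, hL0, hL⟩ := hS.exists_extension a (H := fun z => R (r (z.1, 1), z.2)) (by fun_prop)
    fun x hx => by
      rw [hr' x hx]
      exact hR0 _
  let c₁ : C(A × I, Y) := ⟨fun z => N ((z.1, 1), z.2), hN.comp_continuous (by fun_prop) fun z => hlid z.1⟩
  obtain ⟨M, hM0, hM1, hM⟩ := hS.exists_fill ((f.comp a).comp .fst) (f.comp L) c₁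
    (v := fun z => W ((r (z.1.1, 1), z.2), z.1.2)) (by fun_prop)
    (fun x => congrArg f (hL0 x)) (fun x => hN0 _ (hlid x))
    (fun x hx t => by
      refine (hW2 _ t).trans ?_
      rw [hr' x hx]
      exact congrArg f (hR0 _))
    (fun x hx s => (hW0 _ s).trans (congrArg f (hL x hx s).symm))
    (fun x hx s => by
      refine (hW1 _ s).trans ?_
      rw [hr' x hx]
      rfl)
  have hLS : ∀ x ∈ S, L (x, 1) = h₀ x := fun x hx => by
    rw [hL x hx, hr' x hx]
    exact hR1 _
  refine ⟨L.comp ⟨fun x => (x, 1), by fun_prop⟩, hLS, M, hM0, fun x => (hM1 x).trans (hNlid x),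
    fun x hx t => ?_⟩
  refine (hM x hx t).trans ((hW3 _ t).trans ?_)
  rw [hr' x hx]
  exact (congrArg f (hR1 _)).trans (congrArg f (hLS x hx).symm)

end Deform

/-- The join with `σ t` contracts a cube to its vertex `(1, …, 1)`. -/
def cubeContract (n : ℕ) : C((Fin n → I) × I, Fin n → I) := ⟨fun z i => z.1 i ⊔ σ z.2, by fun_prop⟩

lemma cubeContract_zero {n : ℕ} (x : Fin n → I) : cubeContract n (x, 0) = fun _ => 1 := by
  ext i
  simp [cubeContract, (x i).2.2]

lemma cubeContract_one {n : ℕ} (x : Fin n → I) : cubeContract n (x, 1) = x := by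
  ext i
  simp [cubeContract]

lemma cubeContract_top {n : ℕ} (t : I) : cubeContract n (fun _ => 1, t) = fun _ => 1 := by
  ext i
  simp [cubeContract, unitInterval.le_one']

lemma mem_cylBdry_init {n : ℕ} {b : Fin (n + 1) → I} (hb : b ∈ Cube.boundary (Fin (n + 1))) :
    ((fun i => b i.castSucc, b (Fin.last n)) : (Fin n → I) × I) ∈ cylBdry (Cube.boundary (Fin n)) := by
  obtain ⟨i, hi⟩ := hb
  induction i using Fin.lastCases with
  | last => exact Or.inr hi
  | cast j => exact Or.inl ⟨j, hi⟩

lemma snoc_mem_boundary {n : ℕ} {z : (Fin n → I) × I} (hz : z ∈ cylBdry (Cube.boundary (Fin n))) :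
    (Fin.snoc z.1 z.2 : Fin (n + 1) → I) ∈ Cube.boundary (Fin (n + 1)) := by
  rcases hz with ⟨j, hj⟩ | h
  · exact ⟨j.castSucc, by simpa using hj⟩
  · exact ⟨Fin.last n, by simpa using h⟩

/-- A map that is bijective on homotopy classes of based maps out of spheres is a weak
equivalence. -/
lemma isWE_of_spheres (h : Nonempty Y → Nonempty X)
    (inj : ∀ (n : ℕ) (α β : C(Cube.boundary (Fin (n + 1)), X)), α (basePt n) = β (basePt n) →
      HRel (f.comp α) (f.comp β) {basePt n} → HRel α β {basePt n})
    (surj : ∀ (n : ℕ) (d : C(Cube.boundary (Fin (n + 1)), Y)) (x : X), d (basePt n) = f x →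
      ∃ α : C(Cube.boundary (Fin (n + 1)), X), α (basePt n) = x ∧ HRel (f.comp α) d {basePt n}) :
    IsWE f := by
  rintro (_ | n) p q w
  · have := isEmpty_boundary
    have hc := isTopCollapse_collapse 0
    obtain ⟨x⟩ := h ⟨q fun _ => 0⟩
    -- In dimension zero, the point `q` and the base point `f x` form a map on the two points of
    -- `∂I`.
    obtain ⟨d, hd, hd'⟩ := hc.exists_desc q (f x) fun a ha => isEmptyElim (⟨a, ha⟩ : Cube.boundary _)
    obtain ⟨α, -, hα⟩ := surj 0 d x hd'
    refine ⟨α.comp (collapse 0), fun b => isEmptyElim b, ?_⟩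
    have h' := hα.precomp (S' := Cube.boundary (Fin 0)) (collapse 0) fun a ha => hc.apply_boundary ha
    rwa [show d.comp (collapse 0) = q from ContinuousMap.ext hd] at h'
  · have hS := isCubePair_cube (n + 1)
    have : Nonempty X := ⟨p (basePt n)⟩
    have : Nonempty Y := ⟨f (p (basePt n))⟩
    have hb : (basePt n : Fin (n + 1) → I) = fun _ => 1 := rfl
    -- Since `q` fills `f p`, the latter is null homotopic; injectivity makes `p` null homotopic, so
    -- by homotopy extension `p` extends to a map `h₀` of the cube.
    have hnull : HRel p (.const _ (p (basePt n))) {basePt n} := by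
      refine inj n _ _ rfl ⟨q.comp ⟨fun z => cubeContract (n + 1) (z.1, σ z.2), by fun_prop⟩,
        fun b => ?_, fun b => ?_, ?_⟩
      · refine Eq.trans (congrArg q ?_) (w b).symm
        simpa using cubeContract_one (b : Fin (n + 1) → I)
      · refine Eq.trans (congrArg q ?_) (w (basePt n)).symm
        simpa [hb] using cubeContract_zero (b : Fin (n + 1) → I)
      · rintro _ rfl t
        exact (congrArg q (cubeContract_top (σ t))).trans (w (basePt n)).symm
    obtain ⟨K, hK0, hK1, -⟩ := hnull
    obtain ⟨K', hK', hK''⟩ := exists_total_prod K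
    obtain ⟨V, -, hV⟩ := hS.exists_extension_one (.const _ (p (basePt n))) hK'
      fun a ha => (hK'' a ha 1).trans (hK1 _)
    let h₀ : C(Fin (n + 1) → I, X) := V.comp ⟨fun x => (x, 0), by fun_prop⟩
    have hh₀ : ∀ b : Cube.boundary (Fin (n + 1)), h₀ b = p b := fun b =>
      ((hV b b.2 0).trans (hK'' b b.2 0)).trans (hK0 b)
    -- The difference sphere of `f h₀` and `q`: the first on the open box, the second on the lid.
    -- Surjectivity lifts it up to homotopy.
    obtain ⟨D, hD, hD1, hD2⟩ := exists_glue (isClosed_openBox hS.isClosed)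
      (isClosed_eq (continuous_snd (X := Fin (n + 1) → I)) (continuous_const (y := (1 : I))))
      (f := fun z => f (h₀ z.1)) (g := fun z => q z.1) (by fun_prop) (by fun_prop) (by
        rintro ⟨x, t⟩ (hx | h0) ht
        · exact (congrArg f (hh₀ ⟨x, hx⟩)).trans (w ⟨x, hx⟩)
        · exact absurd (h0.symm.trans ht) zero_ne_one)
    let d : C(Cube.boundary (Fin (n + 2)), Y) := ⟨fun b => D (fun i => b.1 i.castSucc, b.1 (Fin.last _)),
      hD.comp_continuous ((continuous_pi fun i => (continuous_apply _).comp continuous_subtype_val).prodMk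
        ((continuous_apply _).comp continuous_subtype_val)) fun b => by
        rcases mem_cylBdry_init b.2 with h | h | h
        exacts [Or.inl (Or.inl h), Or.inl (Or.inr h), Or.inr h]⟩
    have hbS : (fun _ => 1 : Fin (n + 1) → I) ∈ Cube.boundary (Fin (n + 1)) := (basePt n).2
    obtain ⟨α, hα, N, hN0, hN1, hN⟩ := surj (n + 1) d (h₀ fun _ => 1) (hD1 _ (Or.inl hbS))
    let m : C(cylBdry (Cube.boundary (Fin (n + 1))), Cube.boundary (Fin (n + 2))) :=
      ⟨fun z => ⟨Fin.snoc z.1.1 z.1.2, snoc_mem_boundary z.2⟩,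
        (Continuous.finSnoc (by fun_prop) (by fun_prop)).subtype_mk _⟩
    have hdm : ∀ z, d (m z) = D z := fun z => congrArg D (Prod.ext (by
      funext i
      exact Fin.snoc_castSucc (α := fun _ => I) z.1.2 z.1.1 i)
      (Fin.snoc_last (α := fun _ => I) z.1.2 z.1.1))
    have hmb : m ⟨(fun _ => 1, 1), Or.inl hbS⟩ = basePt (n + 1) := Subtype.ext (by
      funext i
      induction i using Fin.lastCases with
      | last => exact Fin.snoc_last (α := fun _ => I) _ _
      | cast j => exact Fin.snoc_castSucc (α := fun _ => I) _ _ _)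
    obtain ⟨α', hα', hα''⟩ := exists_total (α.comp m)
    obtain ⟨N', hN', hN''⟩ := exists_total_prod (N.comp ⟨fun z => (m z.1, z.2), by fun_prop⟩)
    have e1 : ∀ z (hz : z ∈ cylBdry (Cube.boundary (Fin (n + 1)))), N' (z, 1) = D z := fun z hz =>
      ((hN'' z hz 1).trans (hN1 _)).trans (hdm ⟨z, hz⟩)
    let c : C(((Fin (n + 1) → I) × I) × I, (Fin (n + 1) → I) × I) :=
      ⟨fun z => (cubeContract _ (z.1.1, z.2), z.1.2 ⊔ σ z.2), by fun_prop⟩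
    obtain ⟨k, hk, hk'⟩ := hS.exists_deform (f := f) hbS c
      (fun z => Prod.ext (cubeContract_zero _) (by simp [c, unitInterval.le_one']))
      (fun z => Prod.ext (cubeContract_one _) (by simp [c]))
      (fun t => Prod.ext (cubeContract_top _) (by simp [c, unitInterval.le_one'])) h₀ q hα'
      ((hα'' ⟨(fun _ => 1, 1), Or.inl hbS⟩).trans ((congrArg α hmb).trans hα)) hN'
      (fun z hz => (hN'' z hz 0).trans ((hN0 _).trans (congrArg f (hα'' ⟨z, hz⟩).symm)))
      (fun z hz => (e1 z (hz.imp_right Or.inl)).trans (hD1 z hz))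
      (fun x => (e1 _ (Or.inr (Or.inr rfl))).trans (hD2 _ rfl))
      (fun t => (hN'' _ (Or.inl hbS) t).trans (by
        refine (congrArg (fun y => N (y, t)) hmb).trans ((hN _ rfl t).trans ?_)
        exact congrArg f hα))
    exact ⟨k, fun b => (hk b b.2).trans (hh₀ b), hk'⟩

end Spheres

/-! ### Maps from spaces to locales are maps to the spaces of points -/

section Points

/-- The space of points of a locale. -/
abbrev Pts (X : Locale.{u}) : TopCat.{u} := Locale.pt.obj X

/-- The map induced on points. -/
abbrev ptsMap {X Y : Locale.{u}} (f : X ⟶ Y) : C(Pts X, Pts Y) := (Locale.pt.map f).hom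

variable {S T A B : Type} [TopologicalSpace S] [TopologicalSpace T] [TopologicalSpace A]
  [TopologicalSpace B]

/-- A space of the lowest universe, lifted. -/
abbrev up (S : Type) [TopologicalSpace S] : TopCat.{u} := TopCat.of (ULift.{u} S)

/-- A map of spaces of the lowest universe, lifted. -/
abbrev upMap (a : C(S, T)) : up.{u} S ⟶ up.{u} T := TopCat.ofHom ⟨fun x => ⟨a x.down⟩, by fun_prop⟩

/-- The map of locales given by a continuous map. -/
abbrev omMap (a : C(S, T)) : Om (up.{u} S) ⟶ Om (up.{u} T) := topToLocale.map (upMap a)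

lemma omMap_comp (a : C(S, T)) (b : C(T, A)) : omMap.{u} (b.comp a) = omMap a ≫ omMap b := rfl

lemma omMap_id : omMap.{u} (ContinuousMap.id S) = 𝟙 _ := rfl

variable {X Y : Locale.{u}}

/-- The continuous map to the space of points given by a map of locales. -/
def cts (g : Om (up.{u} S) ⟶ X) : C(S, Pts X) :=
  (Locale.adjunctionTopToLocalePT.homEquiv _ _ g).hom.comp ⟨ULift.up, continuous_uliftUp⟩

/-- The map of locales given by a continuous map to the space of points. -/
def mor (φ : C(S, Pts X)) : Om (up.{u} S) ⟶ X :=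
  (Locale.adjunctionTopToLocalePT.homEquiv _ _).symm
    (TopCat.ofHom (φ.comp ⟨ULift.down, continuous_uliftDown⟩))

@[simp] lemma cts_mor (φ : C(S, Pts X)) : cts (mor φ) = φ := by
  ext1 s
  have h := (Locale.adjunctionTopToLocalePT.homEquiv (up.{u} S) X).apply_symm_apply
    (TopCat.ofHom (φ.comp ⟨ULift.down, continuous_uliftDown⟩))
  exact congrArg (fun k => k.hom ⟨s⟩) h

@[simp] lemma mor_cts (g : Om (up.{u} S) ⟶ X) : mor (cts g) = g :=
  (Locale.adjunctionTopToLocalePT.homEquiv _ _).symm_apply_apply g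

lemma cts_injective {g g' : Om (up.{u} S) ⟶ X} (h : ∀ s, cts g s = cts g' s) : g = g' := by
  rw [← mor_cts g, ← mor_cts g', ContinuousMap.ext h]

lemma cts_comp (g : Om (up.{u} S) ⟶ X) (f : X ⟶ Y) (s : S) :
    cts (g ≫ f) s = ptsMap f (cts g s) := by
  simp [cts, Adjunction.homEquiv_naturality_right]

lemma cts_omMap_comp (a : C(S, T)) (g : Om (up.{u} T) ⟶ X) (s : S) :
    cts (omMap a ≫ g) s = cts g (a s) :=
  congrArg (fun k => k.hom ⟨s⟩)
    (Locale.adjunctionTopToLocalePT.homEquiv_naturality_left (upMap.{u} a) g)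

/-- Transpose along the adjunction with spaces of points: a square of locales and its diagonals
correspond to a square of continuous maps. -/
lemma hasLiftingProperty_omMap_iff {f : X ⟶ Y} (i : C(A, T)) :
    HasLiftingProperty (omMap.{u} i) f ↔ ∀ (φ : C(A, Pts X)) (Ψ : C(T, Pts Y)),
      (∀ a, ptsMap f (φ a) = Ψ (i a)) →
      ∃ K : C(T, Pts X), (∀ a, K (i a) = φ a) ∧ ∀ t, ptsMap f (K t) = Ψ t := by
  constructor
  · intro h φ Ψ w
    have sq : CommSq (mor φ) (omMap.{u} i) f (mor Ψ) := ⟨cts_injective fun a => by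
      rw [cts_comp, cts_omMap_comp, cts_mor, cts_mor, w]⟩
    refine ⟨cts sq.lift, fun a => ?_, fun t => ?_⟩
    · rw [← cts_omMap_comp, sq.fac_left, cts_mor]
    · rw [← cts_comp, sq.fac_right, cts_mor]
  · intro h
    refine ⟨fun {p q} sq => ?_⟩
    obtain ⟨K, h1, h2⟩ := h (cts p) (cts q) fun a => by
      rw [← cts_comp, ← cts_omMap_comp, sq.w]
    refine ⟨⟨⟨mor K, cts_injective fun a => ?_, cts_injective fun t => ?_⟩⟩⟩
    · rw [cts_omMap_comp, cts_mor, h1]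
    · rw [cts_comp, cts_mor, h2]

/-- The inclusion of a subspace. -/
abbrev inclMap (S : Set T) : C(S, T) := ⟨Subtype.val, continuous_subtype_val⟩

lemma hasLiftingProperty_inclMap_iff {f : X ⟶ Y} (S : Set T) :
    HasLiftingProperty (omMap.{u} (inclMap S)) f ↔ RelLift (ptsMap f) S :=
  hasLiftingProperty_omMap_iff _

/-! ### Products -/

section Prod

variable (S T)

/-- The comparison map for a product. -/
def prodUp : Om (up.{u} (S × T)) ⟶ Om (up.{u} S) ⨯ Om (up.{u} T) :=
  prod.lift (omMap .fst) (omMap .snd)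

lemma prodUp_fst : prodUp.{u} S T ≫ prod.fst = omMap .fst := prod.lift_fst _ _

lemma prodUp_snd : prodUp.{u} S T ≫ prod.snd = omMap .snd := prod.lift_snd _ _

/-- This transfers `spaceFanIsLimit` to the chosen products, so that maps from a product of such
locales are continuous maps on the product space. -/
instance [CompactSpace T] [T2Space T] : IsIso (prodUp.{u} S T) := by
  let e : up.{u} (S × T) ≅ prodSpace (up.{u} T) (up.{u} S) :=
    { hom := TopCat.ofHom ⟨fun x => (⟨x.down.1⟩, ⟨x.down.2⟩), by fun_prop⟩
      inv := TopCat.ofHom ⟨fun x => ⟨(x.1.down, x.2.down)⟩, by fun_prop⟩ }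
  let e' := IsLimit.conePointUniqueUpToIso (spaceFanIsLimit (up.{u} T) (up.{u} S))
    (prodIsProd (Om (up.{u} S)) (Om (up.{u} T)))
  have : prodUp.{u} S T = topToLocale.map e.hom ≫ e'.hom := by
    refine Limits.prod.hom_ext ?_ ?_
    · rw [prodUp_fst, Category.assoc]
      exact congrArg (topToLocale.map e.hom ≫ ·) (IsLimit.conePointUniqueUpToIso_hom_comp
        (spaceFanIsLimit (up.{u} T) (up.{u} S)) (prodIsProd _ _) ⟨WalkingPair.left⟩).symm
    · rw [prodUp_snd, Category.assoc]
      exact congrArg (topToLocale.map e.hom ≫ ·) (IsLimit.conePointUniqueUpToIso_hom_comp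
        (spaceFanIsLimit (up.{u} T) (up.{u} S)) (prodIsProd _ _) ⟨WalkingPair.right⟩).symm
  rw [this]
  exact IsIso.comp_isIso' (topToLocale.mapIso e).isIso_hom e'.isIso_hom

variable {S T}

lemma prodUp_map {S' T' : Type} [TopologicalSpace S'] [TopologicalSpace T'] (a : C(S, S')) (b : C(T, T')) :
    prodUp.{u} S T ≫ prod.map (omMap a) (omMap b) = omMap (a.prodMap b) ≫ prodUp S' T' := by
  refine Limits.prod.hom_ext ?_ ?_
  · rw [Category.assoc, Limits.prod.map_fst, ← Category.assoc, prodUp_fst, Category.assoc, prodUp_fst]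
    rfl
  · rw [Category.assoc, Limits.prod.map_snd, ← Category.assoc, prodUp_snd, Category.assoc, prodUp_snd]
    rfl

/-- Maps from a product of two spaces. -/
def ctsProd (g : Om (up.{u} S) ⨯ Om (up.{u} T) ⟶ X) : C(S × T, Pts X) := cts (prodUp S T ≫ g)

lemma ctsProd_comp (g : Om (up.{u} S) ⨯ Om (up.{u} T) ⟶ X) (f : X ⟶ Y) (z : S × T) :
    ctsProd (g ≫ f) z = ptsMap f (ctsProd g z) := by
  rw [ctsProd, ← Category.assoc, cts_comp, ctsProd]

lemma ctsProd_fst_comp (g : Om (up.{u} S) ⟶ X) (z : S × T) :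
    ctsProd (prod.fst ≫ g : _ ⨯ Om (up.{u} T) ⟶ X) z = cts g z.1 := by
  rw [ctsProd, ← Category.assoc, prodUp_fst, cts_omMap_comp]
  rfl

lemma ctsProd_map_comp {S' T' : Type} [TopologicalSpace S'] [TopologicalSpace T'] (a : C(S, S'))
    (b : C(T, T')) (g : Om (up.{u} S') ⨯ Om (up.{u} T') ⟶ X) (z : S × T) :
    ctsProd (prod.map (omMap a) (omMap b) ≫ g) z = ctsProd g (a z.1, b z.2) := by
  rw [ctsProd, ← Category.assoc, prodUp_map, Category.assoc, cts_omMap_comp]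
  rfl

lemma ctsProd_map_left_comp {S' : Type} [TopologicalSpace S'] (a : C(S, S'))
    (g : Om (up.{u} S') ⨯ Om (up.{u} T) ⟶ X) (z : S × T) :
    ctsProd (prod.map (omMap a) (𝟙 _) ≫ g) z = ctsProd g (a z.1, z.2) :=
  ctsProd_map_comp a (.id T) g z

lemma ctsProd_map_right_comp {T' : Type} [TopologicalSpace T'] (b : C(T, T'))
    (g : Om (up.{u} S) ⨯ Om (up.{u} T') ⟶ X) (z : S × T) :
    ctsProd (prod.map (𝟙 _) (omMap b) ≫ g) z = ctsProd g (z.1, b z.2) :=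
  ctsProd_map_comp (.id S) b g z

variable [CompactSpace T] [T2Space T]

lemma ctsProd_injective {g g' : Om (up.{u} S) ⨯ Om (up.{u} T) ⟶ X}
    (h : ∀ s t, ctsProd g (s, t) = ctsProd g' (s, t)) : g = g' := by
  rw [← cancel_epi (prodUp.{u} S T)]
  exact cts_injective fun z => h z.1 z.2

lemma exists_ctsProd (φ : C(S × T, Pts X)) :
    ∃ g : Om (up.{u} S) ⨯ Om (up.{u} T) ⟶ X, ∀ s t, ctsProd g (s, t) = φ (s, t) :=
  ⟨inv (prodUp S T) ≫ mor φ, fun s t => by rw [ctsProd, IsIso.hom_inv_id_assoc, cts_mor]⟩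

end Prod

/-! ### Homotopies -/

section Homotopies

lemma isHomotopy_iff (H : Om (up.{u} S) ⨯ boxToLocale.obj (Box.I 1) ⟶ X) (f g : Om (up.{u} S) ⟶ X) :
    IsHomotopy boxToLocale H f g ↔
      (∀ s, ctsProd (T := Fin 1 → I) H (s, fun _ => 0) = cts f s) ∧
        ∀ s, ctsProd (T := Fin 1 → I) H (s, fun _ => 1) = cts g s := by
  have key : ∀ (t : I) (f : Om (up.{u} S) ⟶ X),
      prod.map (𝟙 (Om (up.{u} S))) (boxToLocale.map (Box.pt t)) ≫ H = prod.fst ≫ f ↔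
        ∀ s, ctsProd (T := Fin 1 → I) H (s, fun _ => t) = cts f s := by
    intro t f
    have h1 : ∀ s x, ctsProd (T := Fin 0 → I)
        (prod.map (𝟙 (Om (up.{u} S))) (boxToLocale.map (Box.pt t)) ≫ H) (s, x) =
          ctsProd (T := Fin 1 → I) H (s, fun _ => t) := fun s x =>
      ctsProd_map_right_comp (T := Fin 0 → I) (T' := Fin 1 → I) (.const _ fun _ => t) H (s, x)
    have h2 : ∀ s x, ctsProd (T := Fin 0 → I) (prod.fst ≫ f) (s, x) = cts f s := fun s x =>
      ctsProd_fst_comp f (s, x)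
    constructor
    · intro h s
      rw [← h1 s Fin.elim0, ← h2 s Fin.elim0]
      exact congrArg (fun k => ctsProd (T := Fin 0 → I) k (s, Fin.elim0)) h
    · intro h
      exact ctsProd_injective (T := Fin 0 → I) fun s x => (h1 s x).trans ((h s).trans (h2 s x).symm)
  exact and_congr (key 0 f) (key 1 g)

/-- Homotopies of maps of locales are homotopies of maps to the space of points. -/
lemma homotopicRel_iff (i : C(A, S)) (f g : Om (up.{u} S) ⟶ X) :
    HomotopicRel boxToLocale (omMap.{u} i) f g ↔ HRel (cts f) (cts g) (Set.range i) := by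
  constructor
  · rintro ⟨H, hH, hA⟩
    obtain ⟨h0, h1⟩ := (isHomotopy_iff H f g).1 hH
    refine ⟨(ctsProd (T := Fin 1 → I) H).comp ⟨fun z => (z.1, fun _ => z.2), by fun_prop⟩, h0, h1, ?_⟩
    rintro _ ⟨a, rfl⟩ t
    have h := congrArg (fun k => ctsProd (T := Fin 1 → I) k (a, fun _ => t)) hA
    refine (ctsProd_map_left_comp (T := Fin 1 → I) i H (a, fun _ => t)).symm.trans (h.trans ?_)
    exact (ctsProd_fst_comp _ _).trans (cts_omMap_comp _ _ _)
  · rintro ⟨K, h0, h1, hK⟩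
    obtain ⟨H, hH⟩ := exists_ctsProd (T := Fin 1 → I)
      (K.comp ⟨fun z : S × (Fin 1 → I) => (z.1, z.2 0), by fun_prop⟩)
    refine ⟨H, (isHomotopy_iff H f g).2 ⟨fun s => (hH _ _).trans (h0 s), fun s => (hH _ _).trans (h1 s)⟩,
      ctsProd_injective (T := Fin 1 → I) fun a t => ?_⟩
    refine (ctsProd_map_left_comp (T := Fin 1 → I) i H (a, t)).trans ((hH _ _).trans ?_)
    exact ((hK _ ⟨a, rfl⟩ _).trans (cts_omMap_comp _ _ _).symm).trans
      (ctsProd_fst_comp (T := Fin 1 → I) (omMap.{u} i ≫ f) (a, t)).symm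

lemma range_inclMap (S : Set T) : Set.range (inclMap S) = S := Subtype.range_val

lemma weakRLP_inclMap_iff {f : X ⟶ Y} (S : Set T) : WeakRLP boxToLocale f (omMap.{u} (inclMap S)) ↔
    ∀ (p : C(S, Pts X)) (q : C(T, Pts Y)), (∀ b, ptsMap f (p b) = q b) →
      ∃ h : C(T, Pts X), (∀ b : S, h b = p b) ∧ HRel ((ptsMap f).comp h) q S := by
  constructor
  · intro H p q w
    obtain ⟨h, h1, h2⟩ := H (mor p) (mor q) (cts_injective fun a => by
      rw [cts_comp, cts_omMap_comp, cts_mor, cts_mor, w]; rfl)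
    rw [homotopicRel_iff, cts_mor, range_inclMap,
      show cts (h ≫ f) = (ptsMap f).comp (cts h) from ContinuousMap.ext fun s => cts_comp h f s] at h2
    refine ⟨cts h, fun b => ?_, h2⟩
    rw [← cts_mor p, ← h1, cts_omMap_comp]
    rfl
  · intro H p q w
    obtain ⟨h, h1, h2⟩ := H (cts p) (cts q) fun a => by
      rw [← cts_comp, w, cts_omMap_comp]; rfl
    refine ⟨mor h, cts_injective fun a => ?_, ?_⟩
    · rw [cts_omMap_comp, cts_mor]
      exact h1 a
    · rwa [homotopicRel_iff, range_inclMap,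
        show cts (mor h ≫ f) = (ptsMap f).comp h from ContinuousMap.ext fun s => by
          rw [cts_comp, cts_mor]; rfl]

/-- Only cubes, their boundaries and cylinders on them occur in the weak lifting property, so it
sees just the points of `X` and `Y`. -/
theorem weakEquiv_iff_isWE (f : X ⟶ Y) : weakEquiv boxToLocale f ↔ IsWE (ptsMap f) :=
  forall_congr' fun n => weakRLP_inclMap_iff (Cube.boundary (Fin n))

theorem genI_rlp_iff (f : X ⟶ Y) : (genI boxToLocale.{u}).rlp f ↔ IsTrivFib (ptsMap f) := by
  constructor
  · exact fun h n => (hasLiftingProperty_inclMap_iff (Cube.boundary (Fin n))).1 (h _ ⟨n⟩)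
  · rintro h _ _ _ ⟨n⟩
    exact (hasLiftingProperty_inclMap_iff (Cube.boundary (Fin n))).2 (h n)

/-- The identification `I^n × I = I^(n+1)`. -/
def snocHomeo (n : ℕ) : (Fin n → I) × I ≃ₜ (Fin (n + 1) → I) where
  toFun z := Fin.snoc (α := fun _ => I) z.1 z.2
  invFun x := (fun k => x k.castSucc, x (Fin.last n))
  left_inv z := by simp
  right_inv x := by
    funext k
    induction k using Fin.lastCases <;> simp
  continuous_toFun := Continuous.finSnoc continuous_fst continuous_snd
  continuous_invFun := by fun_prop

theorem genJ_rlp_iff (f : X ⟶ Y) : (genJ boxToLocale.{u}).rlp f ↔ IsFib (ptsMap f) := by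
  have key : ∀ n : ℕ, HasLiftingProperty (boxToLocale.{u}.map (Box.j n)) f ↔
      RelLift (ptsMap f) { z : (Fin n → I) × I | z.2 = 0 } := by
    intro n
    let j : C(Fin n → I, Fin (n + 1) → I) := ⟨fun x => snocHomeo n (x, 0), by fun_prop⟩
    refine (hasLiftingProperty_omMap_iff j).trans ⟨fun h φ Ψ w => ?_, fun h φ Ψ w => ?_⟩
    · obtain ⟨K, h1, h2⟩ := h ⟨fun x => φ ⟨(x, 0), rfl⟩, by fun_prop⟩
        (Ψ.comp ⟨(snocHomeo n).symm, (snocHomeo n).symm.continuous⟩) fun a =>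
          (w _).trans (congrArg Ψ ((snocHomeo n).symm_apply_apply (a, 0)).symm)
      refine ⟨K.comp ⟨snocHomeo n, (snocHomeo n).continuous⟩, ?_, fun z => (h2 _).trans ?_⟩
      · rintro ⟨⟨x, t⟩, ht⟩
        obtain rfl : t = 0 := ht
        exact h1 x
      · exact congrArg Ψ ((snocHomeo n).symm_apply_apply z)
    · obtain ⟨K, h1, h2⟩ := h ⟨fun z => φ z.1.1, by fun_prop⟩
        (Ψ.comp ⟨snocHomeo n, (snocHomeo n).continuous⟩) (by
          rintro ⟨⟨x, t⟩, ht⟩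
          obtain rfl : t = 0 := ht
          exact w x)
      refine ⟨K.comp ⟨(snocHomeo n).symm, (snocHomeo n).symm.continuous⟩, fun x => ?_, fun z => (h2 _).trans ?_⟩
      · exact (congrArg K ((snocHomeo n).symm_apply_apply (x, 0))).trans (h1 ⟨(x, 0), rfl⟩)
      · exact congrArg Ψ ((snocHomeo n).apply_symm_apply z)
  constructor
  · exact fun h n => (key n).1 (h _ ⟨n⟩)
  · rintro h _ _ _ ⟨n⟩
    exact (key n).2 (h n)

end Homotopies

end Points

/-! ### The functor from cubes and their boundaries to locales -/

section Embedding

instance (n : ℕ) : T2Space (cube.{u} n) := inferInstanceAs (T2Space (ULift (Fin n → I)))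

instance (n : ℕ) : CompactSpace (cube.{u} n) := inferInstanceAs (CompactSpace (ULift (Fin n → I)))

instance (n : ℕ) : T2Space (bdry.{u} n) := inferInstanceAs (T2Space (ULift (Cube.boundary (Fin n))))

instance (n : ℕ) : CompactSpace (bdry.{u} n) :=
  inferInstanceAs (CompactSpace (ULift (Cube.boundary (Fin n))))

instance (X : Box.{u}) : T2Space X.obj := by
  obtain ⟨X, n, rfl | rfl⟩ := X <;> infer_instance

instance : boxToLocale.{u}.Full where
  map_surjective {X Y} g := by
    obtain ⟨f, hf⟩ := topToLocale_map_surjective X.obj Y.obj g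
    exact ⟨ObjectProperty.homMk f, hf⟩

instance : boxToLocale.{u}.Faithful where
  map_injective {X Y f g} h := by
    ext1
    exact topToLocale_map_injective h

instance : (boxTwoIncl.{u} ⋙ boxToLocale).Full := inferInstance

instance : (boxTwoIncl.{u} ⋙ boxToLocale).Faithful := inferInstance

end Embedding

/-! ### Initial and terminal locales -/

section Terminal

lemma isInitial_of_bot_eq_top {X : Locale.{u}} (h : (⊥ : X) = ⊤) : Nonempty (IsInitial X) := by
  have hX : ∀ x y : X, x = y := fun x y => by
    rw [← inf_top_eq x, ← inf_top_eq y, ← h, inf_bot_eq, inf_bot_eq]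
  exact ⟨IsInitial.ofUniqueHom (fun Y => mkHom
    { toFun := fun _ => ⊤
      map_inf' := fun _ _ => hX _ _
      map_top' := rfl
      map_sSup' := fun _ => hX _ _ }) fun Y m => hom_ext_pull fun y => hX _ _⟩

lemma bot_eq_top_bdry : (⊥ : Om (bdry.{u} 0)) = ⊤ := by
  have := isEmpty_boundary
  exact Opens.ext (Set.ext fun x => isEmptyElim x.down)

lemma isInitial_bdry : Nonempty (IsInitial (Om (bdry.{u} 0))) := isInitial_of_bot_eq_top bot_eq_top_bdry

/-- The initial locale is strict: a map to the empty locale forces `⊥ = ⊤` in its source. -/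
lemma initial_prod_iso (X : Locale.{u}) [HasInitial Locale.{u}] : Nonempty ((⊥_ Locale.{u}) ⨯ X ≅ ⊥_ Locale.{u}) := by
  let f : (⊥_ Locale.{u}) ⨯ X ⟶ Om (bdry.{u} 0) := prod.fst ≫ initial.to _
  have h : (⊥ : ((⊥_ Locale.{u}) ⨯ X : Locale.{u})) = ⊤ := by
    rw [← map_bot (pull f), ← map_top (pull f)]
    exact congrArg (pull f) bot_eq_top_bdry
  obtain ⟨h⟩ := isInitial_of_bot_eq_top h
  exact ⟨h.uniqueUpToIso initialIsInitial⟩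

lemma isTerminal_cube : Nonempty (IsTerminal (Om (cube.{u} 0))) := by
  have hu : ∀ U V : Opens (cube.{u} 0), (⟨Fin.elim0⟩ ∈ U ↔ ⟨Fin.elim0⟩ ∈ V) → U = V := fun U V h => by
    refine Opens.ext (Set.ext fun x => ?_)
    obtain rfl : x = ⟨Fin.elim0⟩ := ULift.ext _ _ (Subsingleton.elim _ _)
    exact h
  let F (X : Locale.{u}) (U : Opens (cube.{u} 0)) : X := ⨆ _ : ⟨Fin.elim0⟩ ∈ U, ⊤
  have hF1 : ∀ X U, ⟨Fin.elim0⟩ ∈ U → F X U = ⊤ := fun X U h => iSup_pos h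
  have hF0 : ∀ X U, ⟨Fin.elim0⟩ ∉ U → F X U = ⊥ := fun X U h => iSup_neg h
  let φ (X : Locale.{u}) : FrameHom (Opens (cube.{u} 0)) X :=
    { toFun := F X
      map_inf' := fun U V => by
        by_cases h : ⟨Fin.elim0⟩ ∈ U
        · obtain rfl : U = ⊤ := hu U ⊤ (iff_of_true h trivial)
          rw [hF1 X ⊤ trivial, top_inf_eq, top_inf_eq]
        · obtain rfl : U = ⊥ := hu U ⊥ (iff_of_false h fun h => h)
          rw [hF0 X ⊥ fun h => h, bot_inf_eq, bot_inf_eq, hF0 X ⊥ fun h => h]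
      map_top' := hF1 X ⊤ trivial
      map_sSup' := fun s => by
        refine le_antisymm (iSup_le fun h => ?_) (sSup_le ?_)
        · obtain ⟨U, hU, h⟩ := Opens.mem_sSup.1 h
          exact le_sSup_of_le ⟨U, hU, rfl⟩ (hF1 X U h).ge
        · rintro _ ⟨U, hU, rfl⟩
          exact iSup_le fun h => (hF1 X _ (Opens.mem_sSup.2 ⟨U, hU, h⟩)).ge }
  refine ⟨IsTerminal.ofUniqueHom (fun X => mkHom (Y := Om (cube.{u} 0)) (φ X))
    fun X m => hom_ext_pull fun U => ?_⟩
  let V : Opens (cube.{u} 0) := U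
  by_cases h : ⟨Fin.elim0⟩ ∈ V
  · have hV : V = ⊤ := hu V ⊤ (iff_of_true h trivial)
    exact ((congrArg (pull m) hV).trans (map_top (pull m))).trans (hF1 X V h).symm
  · have hV : V = ⊥ := hu V ⊥ (iff_of_false h fun h => h)
    exact ((congrArg (pull m) hV).trans (map_bot (pull m))).trans (hF0 X V h).symm

end Terminal

/-! ### Cubes as products -/

section Cubes

/-- The `k`-th coordinate of a cube. -/
abbrev coordMap (n : ℕ) (k : Fin n) : C(Fin n → I, Fin 1 → I) := ⟨fun x _ => x k, by fun_prop⟩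

/-- Induction on the dimension, splitting off the last coordinate by the isomorphism `prodUp`. -/
lemma existsUnique_cube (n : ℕ) (X : Locale.{u}) (g : Fin n → (X ⟶ Om (up.{u} (Fin 1 → I)))) :
    ∃! m : X ⟶ Om (up.{u} (Fin n → I)), ∀ k, m ≫ omMap (coordMap n k) = g k := by
  induction n with
  | zero =>
    obtain ⟨h⟩ := isTerminal_cube.{u}
    exact ⟨h.from X, fun k => k.elim0, fun m _ => h.hom_ext _ _⟩
  | succ n ih =>
    obtain ⟨m, hm, hm'⟩ := ih fun k => g k.castSucc
    let e : (Fin n → I) × (Fin 1 → I) ≃ₜ (Fin (n + 1) → I) :=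
      ((Homeomorph.refl _).prodCongr (Homeomorph.funUnique (Fin 1) I)).trans (snocHomeo n)
    let a : C((Fin n → I) × (Fin 1 → I), Fin (n + 1) → I) := ⟨e, e.continuous⟩
    let b : C(Fin (n + 1) → I, (Fin n → I) × (Fin 1 → I)) := ⟨e.symm, e.symm.continuous⟩
    have hba : omMap.{u} b ≫ omMap a = 𝟙 _ := by
      rw [← omMap_comp, ← omMap_id]
      exact congrArg omMap (ContinuousMap.ext e.apply_symm_apply)
    let p := prodUp.{u} (Fin n → I) (Fin 1 → I)
    have hc : ∀ k : Fin n, p ≫ prod.fst ≫ omMap (coordMap n k) =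
        omMap a ≫ omMap (coordMap (n + 1) k.castSucc) := fun k => by
      rw [← Category.assoc, prodUp_fst, ← omMap_comp, ← omMap_comp]
      refine congrArg omMap (ContinuousMap.ext fun z => funext fun i => ?_)
      simp [a, e, snocHomeo]
    have hl : p ≫ prod.snd = omMap a ≫ omMap (coordMap (n + 1) (Fin.last n)) := by
      rw [prodUp_snd, ← omMap_comp]
      refine congrArg omMap (ContinuousMap.ext fun z => funext fun i => ?_)
      obtain rfl := Subsingleton.elim 0 i
      simp [a, e, snocHomeo]
    refine ⟨prod.lift m (g (Fin.last n)) ≫ inv p ≫ omMap a, fun k => ?_, fun m' h' => ?_⟩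
    · induction k using Fin.lastCases with
      | last =>
        rw [Category.assoc, Category.assoc, ← hl, IsIso.inv_hom_id_assoc, prod.lift_snd]
      | cast j =>
        rw [Category.assoc, Category.assoc, ← hc, IsIso.inv_hom_id_assoc, prod.lift_fst_assoc, hm]
    · have : m' ≫ omMap b ≫ p = prod.lift m (g (Fin.last n)) := by
        refine Limits.prod.hom_ext ?_ ?_
        · rw [prod.lift_fst]
          refine hm' _ fun k => ?_
          rw [← h' k.castSucc, Category.assoc, Category.assoc, Category.assoc, hc,
            reassoc_of% hba]
        · rw [prod.lift_snd, ← h' (Fin.last n), Category.assoc, Category.assoc, hl,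
            reassoc_of% hba]
      rw [← this, Category.assoc, Category.assoc, IsIso.hom_inv_id_assoc, hba, Category.comp_id]

lemma isLimit_cubeFan (n : ℕ) : Nonempty (IsLimit (Fan.mk (boxToLocale.{u}.obj (Box.I n))
    fun k : Fin n => boxToLocale.{u}.map (ObjectProperty.homMk (coord n k) : Box.I n ⟶ Box.I 1))) :=
  ⟨Fan.IsLimit.mk _ (fun s => (existsUnique_cube n s.pt s.proj).choose)
    (fun s => (existsUnique_cube n s.pt s.proj).choose_spec.1)
    (fun s => (existsUnique_cube n s.pt s.proj).choose_spec.2)⟩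

lemma isLimit_squareFan : Nonempty (IsLimit (BinaryFan.mk
    ((boxTwoIncl ⋙ boxToLocale.{u}).map (BoxTwo.coord 0))
    ((boxTwoIncl ⋙ boxToLocale.{u}).map (BoxTwo.coord 1)))) := by
  have key : ∀ {X : Locale.{u}} (f g : X ⟶ Om (up.{u} (Fin 1 → I))), ∃! m : X ⟶ Om (up.{u} (Fin 2 → I)),
      m ≫ omMap (coordMap 2 0) = f ∧ m ≫ omMap (coordMap 2 1) = g := fun f g => by
    simpa [Fin.forall_fin_two] using existsUnique_cube 2 _ ![f, g]
  exact ⟨BinaryFan.isLimitMk (fun s => (key s.fst s.snd).choose)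
    (fun s => (key s.fst s.snd).choose_spec.1.1) (fun s => (key s.fst s.snd).choose_spec.1.2)
    (fun s m h h' => (key s.fst s.snd).choose_spec.2 m ⟨h, h'⟩)⟩

end Cubes

/-! ### Closed covers of compact spaces -/

section Cover

lemma pull_inf {X Y : Locale.{u}} (f : X ⟶ Y) (a b : Y) : pull f (a ⊓ b) = pull f a ⊓ pull f b :=
  map_inf _ _ _

lemma pull_sup {X Y : Locale.{u}} (f : X ⟶ Y) (a b : Y) : pull f (a ⊔ b) = pull f a ⊔ pull f b :=
  map_sup _ _ _

variable {P A B Z : Type} [TopologicalSpace P] [TopologicalSpace A] [TopologicalSpace B]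
  [TopologicalSpace Z] [CompactSpace P] [CompactSpace A] [CompactSpace B] [T2Space Z]

/-- The complement of the image of a compact space. -/
def coimage (a : C(A, Z)) : Opens (up.{u} Z) :=
  ⟨(Set.range (upMap.{u} a))ᶜ, (isCompact_range (upMap.{u} a).hom.continuous).isClosed.isOpen_compl⟩

lemma isClosedImm_omMap (a : C(A, Z)) (ha : Function.Injective a) :
    IsClosedImm (omMap.{u} a) (coimage a) :=
  IsClosedImm.of_isClosedEmbedding (upMap.{u} a) ((upMap.{u} a).hom.continuous.isClosedEmbedding
    fun _ _ h => ULift.ext _ _ (ha (congrArg ULift.down h)))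

lemma mem_coimage (a : C(A, Z)) (z : up.{u} Z) : z ∈ coimage.{u} a ↔ z.down ∉ Set.range a := by
  refine not_congr ⟨?_, ?_⟩
  · rintro ⟨x, rfl⟩
    exact ⟨x.down, rfl⟩
  · rintro ⟨x, hx⟩
    exact ⟨⟨x⟩, ULift.ext _ _ hx⟩

/-- Images of compact spaces are closed sublocales, so a cover of `Z` by two of them is a pushout.
The argument is stable under `X ⨯ -`, where `X` need not be a space. -/
lemma isPushout_omMap {f : C(P, A)} {g : C(P, B)} {a : C(A, Z)} {b : C(B, Z)}
    (ha : Function.Injective a) (hb : Function.Injective b) (hf : Function.Injective f)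
    (w : a.comp f = b.comp g) (hr : Set.range a ∩ Set.range b ⊆ Set.range (a.comp f))
    (hu : ∀ z, z ∈ Set.range a ∨ z ∈ Set.range b) :
    IsPushout (omMap.{u} f) (omMap g) (omMap a) (omMap b) ∧
      ∀ X : Locale.{u}, IsPushout (prod.map (𝟙 X) (omMap f)) (prod.map (𝟙 X) (omMap g))
        (prod.map (𝟙 X) (omMap a)) (prod.map (𝟙 X) (omMap b)) := by
  have w' : omMap.{u} f ≫ omMap a = omMap g ≫ omMap b := by rw [← omMap_comp, w, omMap_comp]
  have h1 := isClosedImm_omMap.{u} a ha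
  have h2 := isClosedImm_omMap.{u} b hb
  have h12 : coimage.{u} a ⊓ coimage b = ⊥ := Opens.ext (Set.ext fun z => iff_of_false
    (fun ⟨h, h'⟩ => (hu z.down).elim ((mem_coimage a z).1 h) ((mem_coimage b z).1 h')) fun h => h)
  have h3 : IsClosedImm (omMap.{u} f ≫ omMap a) (coimage.{u} a ⊔ coimage b) := by
    have h := isClosedImm_omMap.{u} (a.comp f) (ha.comp hf)
    have e : coimage.{u} (a.comp f) = coimage a ⊔ coimage b := Opens.ext (Set.ext fun z => by
      change z ∈ coimage (a.comp f) ↔ z ∈ coimage a ∨ z ∈ coimage b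
      rw [mem_coimage, mem_coimage, mem_coimage, ← not_and_or, not_iff_not]
      constructor
      · rintro ⟨p, hp⟩
        exact ⟨⟨f p, hp⟩, ⟨g p, (DFunLike.congr_fun w p).symm.trans hp⟩⟩
      · exact fun h => hr h)
    rw [e] at h
    exact h
  refine ⟨IsClosedImm.isPushout w' h1 h2 h3 h12, fun X => IsClosedImm.isPushout ?_ (h1.prodMap X)
    (h2.prodMap X) ?_ ?_⟩
  · rw [prod.map_map, prod.map_map, w']
  · rw [prod.map_map, Category.comp_id]
    exact Eq.mp (congrArg (IsClosedImm (prod.map (𝟙 X) (omMap f ≫ omMap a))) (pull_sup _ _ _))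
      (h3.prodMap X)
  · exact ((pull_inf _ _ _).symm.trans (congrArg (pull (prod.snd : X ⨯ Om (up.{u} Z) ⟶ _)) h12)).trans
      (map_bot _)

lemma isColimit_binaryCofan_omMap {a : C(A, Z)} {b : C(B, Z)} (ha : Function.Injective a)
    (hb : Function.Injective b) (hab : ∀ z, z ∈ Set.range a ↔ z ∉ Set.range b) (X : Locale.{u}) :
    Nonempty (IsColimit (BinaryCofan.mk (prod.map (𝟙 X) (omMap.{u} a)) (prod.map (𝟙 X) (omMap b)))) := by
  refine IsClosedImm.isColimit_binaryCofan ((isClosedImm_omMap a ha).prodMap X)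
    ((isClosedImm_omMap b hb).prodMap X) ?_ ?_
  · refine (pull_inf _ _ _).symm.trans
      ((congrArg (pull (prod.snd : X ⨯ Om (up.{u} Z) ⟶ _)) ?_).trans (map_bot _))
    refine Opens.ext (Set.ext fun z => iff_of_false ?_ fun h => h)
    rintro ⟨h, h'⟩
    exact (mem_coimage a z).1 h ((hab _).2 ((mem_coimage b z).1 h'))
  · refine (pull_sup _ _ _).symm.trans
      ((congrArg (pull (prod.snd : X ⨯ Om (up.{u} Z) ⟶ _)) ?_).trans (map_top _))
    refine Opens.ext (Set.ext fun z => iff_of_true ?_ trivial)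
    change z ∈ coimage a ∨ z ∈ coimage b
    rw [mem_coimage, mem_coimage, hab]
    exact (em _).symm

end Cover

/-! ### Intervals -/

section Interval

/-- A self-map of the interval, as a self-map of the one-dimensional cube. -/
abbrev intervalMap (g : C(I, I)) : C(Fin 1 → I, Fin 1 → I) := ⟨fun x _ => g (x 0), by fun_prop⟩

/-- A point of the interval, as a point of the one-dimensional cube. -/
abbrev ptMap (t : I) : C(Fin 0 → I, Fin 1 → I) := .const _ fun _ => t

lemma range_intervalMap (g : C(I, I)) (x : Fin 1 → I) :
    x ∈ Set.range (intervalMap g) ↔ x 0 ∈ Set.range g := by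
  constructor
  · rintro ⟨y, rfl⟩
    exact ⟨y 0, rfl⟩
  · rintro ⟨t, ht⟩
    refine ⟨fun _ => t, funext fun i => ?_⟩
    rw [Subsingleton.elim i 0]
    exact ht

lemma injective_intervalMap {g : C(I, I)} (hg : Function.Injective g) :
    Function.Injective (intervalMap g) := fun x y h => funext fun i => by
  rw [Subsingleton.elim i 0]
  exact hg (congrFun h 0)

lemma isPushout_halves : IsPushout (omMap.{u} (ptMap 0)) (omMap (ptMap 1))
      (omMap (intervalMap upperHalf)) (omMap (intervalMap lowerHalf)) ∧
    ∀ X : Locale.{u}, IsPushout (prod.map (𝟙 X) (omMap (ptMap 0))) (prod.map (𝟙 X) (omMap (ptMap 1)))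
      (prod.map (𝟙 X) (omMap (intervalMap upperHalf)))
      (prod.map (𝟙 X) (omMap (intervalMap lowerHalf))) := by
  have hl : ∀ t, t ∈ Set.range lowerHalf ↔ (t : ℝ) ≤ 1 / 2 := fun t => by
    constructor
    · rintro ⟨s, rfl⟩
      change (s : ℝ) / 2 ≤ 1 / 2
      linarith [s.2.2]
    · exact fun h => ⟨⟨2 * t, by linarith [t.2.1], by linarith⟩, Subtype.ext (by simp [lowerHalf])⟩
  have hu : ∀ t, t ∈ Set.range upperHalf ↔ 1 / 2 ≤ (t : ℝ) := fun t => by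
    constructor
    · rintro ⟨s, rfl⟩
      change 1 / 2 ≤ (1 + (s : ℝ)) / 2
      linarith [s.2.1]
    · exact fun h => ⟨⟨2 * t - 1, by linarith, by linarith [t.2.2]⟩, Subtype.ext (by simp [upperHalf])⟩
  refine isPushout_omMap (injective_intervalMap ?_) (injective_intervalMap ?_)
    (fun x y _ => Subsingleton.elim x y) ?_ ?_ ?_
  · intro s t h
    have : (1 + (s : ℝ)) / 2 = (1 + (t : ℝ)) / 2 := congrArg Subtype.val h
    exact Subtype.ext (by linarith)
  · intro s t h
    have : (s : ℝ) / 2 = (t : ℝ) / 2 := congrArg Subtype.val h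
    exact Subtype.ext (by linarith)
  · ext x i
    simp [upperHalf, lowerHalf]
  · rintro x ⟨h1, h2⟩
    rw [range_intervalMap, hu] at h1
    rw [range_intervalMap, hl] at h2
    refine ⟨Fin.elim0, funext fun i => Subtype.ext ?_⟩
    rw [Subsingleton.elim i 0]
    change (1 + (0 : ℝ)) / 2 = x 0
    linarith
  · intro x
    rw [range_intervalMap, range_intervalMap, hl, hu]
    exact le_total _ _

lemma isCategoryWithIntervals [HasLimits Locale.{u}] [HasColimits Locale.{u}] :
    IsCategoryWithIntervals (boxTwoIncl ⋙ boxToLocale.{u}) where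
  full := inferInstance
  faithful := inferInstance
  initial := isInitial_bdry
  terminal := isTerminal_cube
  square := isLimit_squareFan
  gluing := by
    let a : BoxTwo.interval.{u} ⟶ BoxTwo.interval.{u} :=
      ObjectProperty.homMk (cubeMap (intervalMap lowerHalf))
    let b : BoxTwo.interval.{u} ⟶ BoxTwo.interval.{u} :=
      ObjectProperty.homMk (cubeMap (intervalMap upperHalf))
    have hab : BoxTwo.pt.{u} 0 ≫ b = BoxTwo.pt 1 ≫ a := by
      refine (boxTwoIncl ⋙ boxToLocale.{u}).map_injective ?_
      rw [Functor.map_comp, Functor.map_comp]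
      exact isPushout_halves.1.w
    refine ⟨a, b, ?_, ?_, ?_, isPushout_halves.1, isPushout_halves.2⟩
    · refine ObjectProperty.hom_ext _ (ConcreteCategory.hom_ext _ _ fun x => ULift.ext _ _ ?_)
      funext i
      exact Subtype.ext (zero_div 2)
    · refine ObjectProperty.hom_ext _ (ConcreteCategory.hom_ext _ _ fun x => ULift.ext _ _ ?_)
      funext i
      exact Subtype.ext (by
        change (1 + (1 : ℝ)) / 2 = 1
        norm_num)
    -- A fully faithful functor reflects the pushout of locales to one of cubes.
    · exact IsPushout.of_map (boxTwoIncl ⋙ boxToLocale.{u}) hab isPushout_halves.1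
  initial_prod X := initial_prod_iso X

lemma isColimit_ends (X : Locale.{u}) : Nonempty (IsColimit (BinaryCofan.mk
    (prod.map (𝟙 X) (boxToLocale.{u}.map Box.e0)) (prod.map (𝟙 X) (boxToLocale.{u}.map (Box.one 0))))) := by
  refine isColimit_binaryCofan_omMap (a := .const (Fin 0 → I) (⟨fun _ => 0, 0, Or.inl rfl⟩ : Cube.boundary (Fin 1)))
    (b := .const (Fin 0 → I) ⟨fun _ => 1, 0, Or.inr rfl⟩)
    (fun x y _ => Subsingleton.elim x y) (fun x y _ => Subsingleton.elim x y) ?_ X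
  have h01 : ∀ z : Cube.boundary (Fin 1), ∀ t : I, ∀ ht,
      z ∈ Set.range (ContinuousMap.const (Fin 0 → I) (⟨fun _ => t, 0, ht⟩ : Cube.boundary (Fin 1))) ↔
        (z : Fin 1 → I) 0 = t := fun z t ht => by
    constructor
    · rintro ⟨x, rfl⟩
      rfl
    · refine fun h => ⟨Fin.elim0, Subtype.ext (funext fun i => ?_)⟩
      rw [Subsingleton.elim i 0]
      exact h.symm
  intro z
  rw [h01 z 0 (Or.inl rfl), h01 z 1 (Or.inr rfl)]
  obtain ⟨i, hi⟩ := z.2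
  rw [Subsingleton.elim i 0] at hi
  rcases hi with h | h <;> simp [h]

end Interval

/-! ### Cofibrations and smallness -/

section Small

/-- Cubes are metrizable, which provides the complete normality used to extend disjoint opens. -/
lemma genI_le_sepMaps : genI boxToLocale.{u} ≤ sepMaps := by
  rintro _ _ _ ⟨n⟩
  have : MetrizableSpace (cube.{u} n) := inferInstanceAs (MetrizableSpace (ULift (Fin n → I)))
  exact sepMaps_of_isClosedEmbedding (bdryIncl.{u} n) ((bdryIncl.{u} n).hom.continuous.isClosedEmbedding
    fun _ _ h => ULift.ext _ _ (Subtype.ext (congrArg ULift.down h)))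

lemma genJ_le_sepMaps : genJ boxToLocale.{u} ≤ sepMaps := by
  rintro _ _ _ ⟨n⟩
  have : MetrizableSpace (cube.{u} (n + 1)) := inferInstanceAs (MetrizableSpace (ULift (Fin (n + 1) → I)))
  refine sepMaps_of_isClosedEmbedding (cylIncl.{u} n) ((cylIncl.{u} n).hom.continuous.isClosedEmbedding
    fun x y h => ULift.ext _ _ ?_)
  have h' : snocHomeo n (x.down, 0) = snocHomeo n (y.down, 0) := congrArg ULift.down h
  exact congrArg Prod.fst ((snocHomeo n).injective h')

lemma cof_genI : cof (genI boxToLocale.{u}) = (genI boxToLocale.{u}).rlp.llp :=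
  cof_eq_llp_rlp bdryIncl.{u} genI_le_sepMaps

lemma cof_genJ : cof (genJ boxToLocale.{u}) = (genJ boxToLocale.{u}).rlp.llp :=
  cof_eq_llp_rlp cylIncl.{u} genJ_le_sepMaps

end Small

/-! ### Pushout-products -/

section PushoutProduct

variable {A B T T' : Type} [TopologicalSpace A] [TopologicalSpace B] [TopologicalSpace T]
  [TopologicalSpace T'] [CompactSpace A] [CompactSpace B] [CompactSpace T] [CompactSpace T'] [T2Space B]
  [T2Space T] [T2Space T']

/-- A map out of the pushout is a compatible pair of continuous maps. By compactness the two pieces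
form a quotient presentation of the union of their images, so the pair is one continuous map on that
subspace, and the problem is `RelLift`. -/
lemma hasLiftingProperty_pushoutProduct
    {X Y : Locale.{u}} {f : X ⟶ Y} {i : C(A, T)} {j : C(B, T')} (hi : Function.Injective i)
    (hj : Function.Injective j)
    (h : RelLift (ptsMap f) { z : T × T' | z.1 ∈ Set.range i ∨ z.2 ∈ Set.range j }) :
    HasLiftingProperty (pushoutProduct (omMap.{u} i) (omMap.{u} j)) f := by
  refine ⟨fun {p q} sq => ?_⟩
  let φ₁ := ctsProd (pushout.inl _ _ ≫ p)
  let φ₂ := ctsProd (pushout.inr _ _ ≫ p)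
  have hφ : ∀ a b, φ₁ (i a, b) = φ₂ (a, j b) := fun a b => by
    refine (ctsProd_map_left_comp i (pushout.inl _ _ ≫ p) (a, b)).symm.trans
      (Eq.trans ?_ (ctsProd_map_right_comp j (pushout.inr _ _ ≫ p) (a, b)))
    rw [← Category.assoc, pushout.condition, Category.assoc]
  have e₁ : pushout.inl _ _ ≫ pushoutProduct (omMap.{u} i) (omMap.{u} j) = prod.map (𝟙 _) (omMap j) :=
    pushout.inl_desc _ _ _
  have e₂ : pushout.inr _ _ ≫ pushoutProduct (omMap.{u} i) (omMap.{u} j) = prod.map (omMap i) (𝟙 _) :=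
    pushout.inr_desc _ _ _
  let π : C((T × B) ⊕ (A × T'), { z : T × T' | z.1 ∈ Set.range i ∨ z.2 ∈ Set.range j }) :=
    ⟨Sum.elim (fun z => ⟨(z.1, j z.2), Or.inr ⟨_, rfl⟩⟩) (fun z => ⟨(i z.1, z.2), Or.inl ⟨_, rfl⟩⟩),
      Continuous.sumElim (by fun_prop) (by fun_prop)⟩
  have hπ : Topology.IsQuotientMap π := by
    refine π.continuous.isClosedMap.isQuotientMap π.continuous ?_
    rintro ⟨⟨t, t'⟩, hz⟩
    rcases (show t ∈ Set.range i ∨ t' ∈ Set.range j from hz) with ⟨a, rfl⟩ | ⟨b, rfl⟩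
    · exact ⟨Sum.inr (a, t'), rfl⟩
    · exact ⟨Sum.inl (t, b), rfl⟩
  let Φ : C((T × B) ⊕ (A × T'), Pts X) := ⟨Sum.elim φ₁ φ₂, by fun_prop⟩
  have hΦ : Function.FactorsThrough Φ π := by
    have hπ' : ∀ {z z'}, π z = π z' → (π z).1.1 = (π z').1.1 ∧ (π z).1.2 = (π z').1.2 := fun h =>
      ⟨by rw [h], by rw [h]⟩
    rintro (⟨t, b⟩ | ⟨a, t'⟩) (⟨s, c⟩ | ⟨a', s'⟩) hz
    · obtain ⟨h1, h2⟩ := hπ' hz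
      obtain rfl : t = s := h1
      obtain rfl : b = c := hj h2
      rfl
    · obtain ⟨h1, h2⟩ := hπ' hz
      obtain rfl : t = i a' := h1
      obtain rfl : j b = s' := h2
      exact hφ _ _
    · obtain ⟨h1, h2⟩ := hπ' hz
      obtain rfl : i a = s := h1
      obtain rfl : t' = j c := h2
      exact (hφ _ _).symm
    · obtain ⟨h1, h2⟩ := hπ' hz
      obtain rfl : a = a' := hi h1
      obtain rfl : t' = s' := h2
      rfl
  have hl₁ : ∀ t b, hπ.lift Φ hΦ (π (Sum.inl (t, b))) = φ₁ (t, b) := fun t b =>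
    DFunLike.congr_fun (hπ.lift_comp Φ hΦ) (Sum.inl (t, b))
  have hl₂ : ∀ a t', hπ.lift Φ hΦ (π (Sum.inr (a, t'))) = φ₂ (a, t') := fun a t' =>
    DFunLike.congr_fun (hπ.lift_comp Φ hΦ) (Sum.inr (a, t'))
  obtain ⟨K, hK1, hK2⟩ := h (hπ.lift Φ hΦ) (ctsProd q) (by
    intro s
    obtain ⟨⟨t, b⟩ | ⟨a, t'⟩, rfl⟩ := hπ.surjective s
    · rw [hl₁]
      refine (ctsProd_comp _ f (t, b)).symm.trans (Eq.trans ?_ (ctsProd_map_right_comp j q (t, b)))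
      rw [Category.assoc, sq.w, ← Category.assoc, e₁]
    · rw [hl₂]
      refine (ctsProd_comp _ f (a, t')).symm.trans (Eq.trans ?_ (ctsProd_map_left_comp i q (a, t')))
      rw [Category.assoc, sq.w, ← Category.assoc, e₂])
  obtain ⟨l, hl⟩ := exists_ctsProd K
  refine ⟨⟨⟨l, pushout.hom_ext ?_ ?_, ctsProd_injective fun t t' => ?_⟩⟩⟩
  · rw [← Category.assoc, e₁]
    refine ctsProd_injective fun t b => (ctsProd_map_right_comp j l (t, b)).trans ?_
    exact ((hl _ _).trans (hK1 (π (Sum.inl (t, b))))).trans (hl₁ t b)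
  · rw [← Category.assoc, e₂]
    refine ctsProd_injective fun a t' => (ctsProd_map_left_comp i l (a, t')).trans ?_
    exact ((hl _ _).trans (hK1 (π (Sum.inr (a, t'))))).trans (hl₂ a t')
  · exact (ctsProd_comp l f (t, t')).trans ((congrArg (ptsMap f) (hl t t')).trans (hK2 _))

lemma pushoutProduct_genI_genI (m n : ℕ) :
    cof (genI boxToLocale.{u}) (pushoutProduct (boxToLocale.{u}.map (Box.i m)) (boxToLocale.{u}.map (Box.i n))) := by
  rw [cof_genI]
  intro X Y f hf
  refine hasLiftingProperty_pushoutProduct (i := inclMap (Cube.boundary (Fin m)))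
    (j := inclMap (Cube.boundary (Fin n))) Subtype.val_injective Subtype.val_injective ?_
  rw [range_inclMap, range_inclMap]
  exact ((genI_rlp_iff f).1 hf).relLift_prod (isCubePair_cube m) (isCubePair_cube n)

lemma pushoutProduct_genI_genJ (m n : ℕ) :
    cof (genJ boxToLocale.{u}) (pushoutProduct (boxToLocale.{u}.map (Box.i m)) (boxToLocale.{u}.map (Box.j n))) := by
  rw [cof_genJ]
  intro X Y f hf
  let j : C(Fin n → I, Fin (n + 1) → I) := ⟨fun x => snocHomeo n (x, 0), by fun_prop⟩
  refine hasLiftingProperty_pushoutProduct (i := inclMap (Cube.boundary (Fin m))) (j := j)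
    Subtype.val_injective (fun x y h => congrArg Prod.fst ((snocHomeo n).injective h)) ?_
  refine (((genJ_rlp_iff f).1 hf).relLift_prod (isCubePair_cube m) (isCubePair_cube n)).homeomorph
    ((Homeomorph.refl _).prodCongr (snocHomeo n).symm) fun z => ?_
  rw [range_inclMap]
  refine or_congr Iff.rfl ⟨?_, fun h => ?_⟩
  · rintro ⟨x, hx⟩
    change ((snocHomeo n).symm z.2).2 = 0
    rw [← hx]
    exact congrArg Prod.snd ((snocHomeo n).symm_apply_apply (x, 0))
  · refine ⟨((snocHomeo n).symm z.2).1, ?_⟩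
    change snocHomeo n (((snocHomeo n).symm z.2).1, 0) = z.2
    rw [← (show ((snocHomeo n).symm z.2).2 = 0 from h)]
    exact (snocHomeo n).apply_symm_apply z.2

lemma genJ_le_cof_genI : genJ boxToLocale.{u} ≤ cof (genI boxToLocale.{u}) := by
  rw [cof_genI]
  intro A B i hi X Y f hf
  exact (genJ_rlp_iff f).2 ((genI_rlp_iff f).1 hf).isFib i hi

end PushoutProduct

/-! ### Boundaries of cubes are cofibrant -/

section Cofibrant

variable {X Y : Type*} [TopologicalSpace X] [TopologicalSpace Y] {f : C(X, Y)}

/-- The sphere is a cube with collapsed boundary: lift the base point first, then the cube with its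
boundary sent to that lift. -/
lemma IsTrivFib.exists_lift_boundary (hf : IsTrivFib f) (n : ℕ) (φ : C(Cube.boundary (Fin n), Y)) :
    ∃ ψ : C(Cube.boundary (Fin n), X), ∀ b, f (ψ b) = φ b := by
  rcases n with _ | n
  · have := isEmpty_boundary
    exact ⟨⟨fun b => isEmptyElim b, continuous_of_const fun b => isEmptyElim b⟩, fun b => isEmptyElim b⟩
  · have hc := isTopCollapse_collapse n
    have := isEmpty_boundary
    obtain ⟨k, -, hk⟩ := hf 0 ⟨fun b => isEmptyElim b, continuous_of_const fun b => isEmptyElim b⟩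
      (.const _ (φ (basePt n))) fun b => isEmptyElim b
    let x := k fun _ => 0
    obtain ⟨K, hK1, hK2⟩ := (hf.relLift (isCubePair_cube n)).exists_lift (φ := fun _ => x)
      continuousOn_const (φ.comp (collapse n)) fun a ha =>
        (hk _).trans (congrArg φ (hc.apply_boundary ha).symm)
    obtain ⟨ψ, h1, h2⟩ := hc.exists_desc K x hK1
    exact ⟨ψ, hc.ext (α := fun b => f (ψ b)) (fun a => (congrArg f (h1 a)).trans (hK2 a))
      ((congrArg f h2).trans (hk _))⟩

lemma cof_initial_bdry (n : ℕ) :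
    cof (genI boxToLocale.{u}) (initial.to (boxToLocale.{u}.obj (Box.B n))) := by
  rw [cof_genI]
  intro X Y f hf
  refine ⟨fun {p q} sq => ?_⟩
  obtain ⟨ψ, hψ⟩ := ((genI_rlp_iff f).1 hf).exists_lift_boundary n (cts (S := Cube.boundary (Fin n)) q)
  refine ⟨⟨⟨mor ψ, initialIsInitial.hom_ext _ _, ?_⟩⟩⟩
  refine cts_injective (S := Cube.boundary (Fin n)) fun b => ?_
  exact (cts_comp (mor ψ) f b).trans ((congrArg (ptsMap f) (DFunLike.congr_fun (cts_mor ψ) b)).trans (hψ b))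

end Cofibrant

/-! ### Collapsing a compact subspace to a point -/

section Collapse

variable {P A Z : Type} [TopologicalSpace P] [TopologicalSpace A] [TopologicalSpace Z] [CompactSpace A]
  [T2Space Z]

/-- By the adjunction the universal property is that of a topological quotient, which holds because
`A` with an extra point maps onto `Z` from a compact to a Hausdorff space. The extra point is needed
when `P` is empty. -/
lemma isPushout_collapse (f : C(P, A)) (a : C(A, Z)) (z₀ : Z)
    (h1 : ∀ x x', a x = a x' → x = x' ∨ a x = z₀) (h2 : ∀ x, a x = z₀ ↔ x ∈ Set.range f)
    (h3 : ∀ z, z = z₀ ∨ ∃ x, a x = z) :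
    IsPushout (omMap.{u} f) (omMap (.const P Fin.elim0 : C(P, Fin 0 → I))) (omMap a)
      (omMap (.const (Fin 0 → I) z₀)) := by
  have w : omMap.{u} f ≫ omMap a = omMap (.const P Fin.elim0 : C(P, Fin 0 → I)) ≫
      omMap (.const (Fin 0 → I) z₀) := by
    rw [← omMap_comp, ← omMap_comp]
    exact congrArg omMap (ContinuousMap.ext fun p => (h2 _).2 ⟨p, rfl⟩)
  have key : ∀ {X : Locale.{u}} (s : Om (up.{u} A) ⟶ X) (t : Om (up.{u} (Fin 0 → I)) ⟶ X),
      omMap.{u} f ≫ s = omMap (.const P Fin.elim0 : C(P, Fin 0 → I)) ≫ t →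
      ∃! m : Om (up.{u} Z) ⟶ X, omMap a ≫ m = s ∧ omMap (.const (Fin 0 → I) z₀) ≫ m = t := by
    intro X s t hst
    have hst' : ∀ p, cts s (f p) = cts t Fin.elim0 := fun p => by
      rw [← cts_omMap_comp, hst, cts_omMap_comp]
      rfl
    let π : C(A ⊕ PUnit.{1}, Z) := ⟨Sum.elim a fun _ => z₀, by fun_prop⟩
    have hπ : Topology.IsQuotientMap π := by
      refine π.continuous.isClosedMap.isQuotientMap π.continuous fun z => ?_
      rcases h3 z with rfl | ⟨x, rfl⟩
      · exact ⟨Sum.inr ⟨⟩, rfl⟩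
      · exact ⟨Sum.inl x, rfl⟩
    let Φ : C(A ⊕ PUnit.{1}, Pts X) := ⟨Sum.elim (cts s) fun _ => cts t Fin.elim0, by fun_prop⟩
    have h2' : ∀ x, a x = z₀ → cts s x = cts t Fin.elim0 := fun x hx => by
      obtain ⟨p, rfl⟩ := (h2 x).1 hx
      exact hst' p
    have hΦ : Function.FactorsThrough Φ π := by
      rintro (x | _) (x' | _) h
      · change a x = a x' at h
        rcases h1 x x' h with rfl | hx
        · rfl
        · exact (h2' x hx).trans (h2' x' (h ▸ hx)).symm
      · exact h2' x h
      · exact (h2' x' h.symm).symm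
      · rfl
    have hl : ∀ x, hπ.lift Φ hΦ (π x) = Φ x := DFunLike.congr_fun (hπ.lift_comp Φ hΦ)
    refine ⟨mor (hπ.lift Φ hΦ), ⟨cts_injective fun x => ?_, cts_injective fun x => ?_⟩,
      fun m ⟨hm1, hm2⟩ => cts_injective fun z => ?_⟩
    · rw [cts_omMap_comp, cts_mor]
      exact hl (Sum.inl x)
    · rw [cts_omMap_comp, cts_mor, Subsingleton.elim x Fin.elim0]
      exact hl (Sum.inr ⟨⟩)
    · rw [cts_mor]
      obtain ⟨x | _, rfl⟩ := hπ.surjective z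
      · rw [hl]
        refine (cts_omMap_comp a m x).symm.trans ?_
        rw [hm1]
        rfl
      · rw [hl]
        refine (cts_omMap_comp (.const (Fin 0 → I) z₀) m Fin.elim0).symm.trans ?_
        rw [hm2]
        rfl
  exact ⟨⟨w⟩, ⟨PushoutCocone.IsColimit.mk w
    (fun s => (key s.inl s.inr s.condition).choose)
    (fun s => (key s.inl s.inr s.condition).choose_spec.1.1)
    (fun s => (key s.inl s.inr s.condition).choose_spec.1.2)
    (fun s m h1 h2 => (key s.inl s.inr s.condition).choose_spec.2 m ⟨h1, h2⟩)⟩⟩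

lemma IsTopCollapse.isCollapse {n : ℕ} {c : C(Fin n → I, Cube.boundary (Fin (n + 1)))}
    (hc : IsTopCollapse c) : IsCollapse boxToLocale.{u} n (omMap.{u} c) := by
  refine isPushout_collapse (inclMap (Cube.boundary (Fin n))) c (basePt n) (fun x x' h => ?_) (fun x => ?_)
    hc.surjective
  · rw [hc.eq_basePt_iff]
    exact (hc.eq_of_eq x x' h)
  · rw [hc.eq_basePt_iff, range_inclMap]

end Collapse

/-! ### The cube as a cone -/

section Cone

variable {n : ℕ}

lemma coe_rescale {c : ℝ} {x : Fin n → I} {i : Fin n} (h : |c * (2 * (x i : ℝ) - 1)| ≤ 1) :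
    2 * (rescale c x i : ℝ) - 1 = c * (2 * (x i : ℝ) - 1) := by
  obtain ⟨h1, h2⟩ := abs_le.1 h
  have : (rescale c x i : ℝ) = (1 + c * (2 * (x i : ℝ) - 1)) / 2 :=
    congrArg Subtype.val (Set.projIcc_of_mem (zero_le_one' ℝ) ⟨by linarith, by linarith⟩)
  rw [this]
  ring

lemma coe_rescale_of_mem {c : ℝ} (h0 : 0 ≤ c) (h1 : c ≤ 1) (x : Fin n → I) (i : Fin n) :
    2 * (rescale c x i : ℝ) - 1 = c * (2 * (x i : ℝ) - 1) :=
  coe_rescale (by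
    rw [abs_mul, abs_of_nonneg h0]
    exact mul_le_one₀ h1 (abs_nonneg _) (abs_two_mul_sub_le _))

lemma radius_rescale {c : ℝ} (h0 : 0 ≤ c) (h1 : c ≤ 1) (x : Fin n → I) :
    radius (rescale c x) = c * radius x := by
  have : (fun i => 2 * (rescale c x i : ℝ) - 1) = c • fun i => 2 * (x i : ℝ) - 1 :=
    funext (coe_rescale_of_mem h0 h1 x)
  rw [radius, this, norm_smul, Real.norm_of_nonneg h0, radius]

lemma eq_rescale_zero_iff (x y : Fin n → I) : x = rescale 0 y ↔ radius x = 0 := by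
  constructor
  · rintro rfl
    rw [radius_rescale le_rfl zero_le_one, zero_mul]
  · intro h
    funext i
    have h1 : 2 * (x i : ℝ) - 1 = 0 := congrFun (norm_eq_zero.1 h) i
    have h2 := coe_rescale_of_mem le_rfl zero_le_one y i
    exact Subtype.ext (by linarith)

lemma rescale_injective {c : ℝ} (h0 : 0 < c) (h1 : c ≤ 1) {x y : Fin n → I}
    (h : rescale c x = rescale c y) : x = y := by
  funext i
  have h2 := coe_rescale_of_mem h0.le h1 x i
  rw [h, coe_rescale_of_mem h0.le h1 y i] at h2
  have := mul_left_cancel₀ h0.ne' h2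
  exact Subtype.ext (by linarith)

lemma exists_rescale_eq (x : Fin n → I) (h : 0 < radius x) :
    ∃ y ∈ Cube.boundary (Fin n), rescale (radius x) y = x := by
  refine ⟨rescale (radius x)⁻¹ x, rescale_mem_boundary h (inv_mul_cancel₀ h.ne').ge, funext fun i => ?_⟩
  have h1 := coe_rescale_of_mem h.le (radius_le_one x) (rescale (radius x)⁻¹ x) i
  have h2 := coe_rescale (c := (radius x)⁻¹) (x := x) (i := i) (by
    rw [abs_mul, abs_inv, abs_of_pos h, inv_mul_le_one₀ h]
    exact norm_le_pi_norm (fun i => 2 * (x i : ℝ) - 1) i)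
  rw [h2, mul_inv_cancel_left₀ h.ne'] at h1
  exact Subtype.ext (by linarith)

/-- The map exhibiting the cube as a cone on its boundary. -/
def coneMap (n : ℕ) : C(Cube.boundary (Fin n) × (Fin 1 → I), Fin n → I) where
  toFun z := rescale (1 - (z.2 0 : ℝ)) z.1
  continuous_toFun := by
    unfold rescale
    refine continuous_pi fun i => continuous_clamp.comp ?_
    have : Continuous fun z : Cube.boundary (Fin n) × (Fin 1 → I) => (z.1 : Fin n → I) i :=
      (continuous_apply i).comp (continuous_subtype_val.comp continuous_fst)
    fun_prop

lemma radius_coneMap (z : Cube.boundary (Fin n) × (Fin 1 → I)) : radius (coneMap n z) = 1 - z.2 0 := by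
  have := radius_rescale (c := 1 - (z.2 0 : ℝ)) (by linarith [(z.2 0).2.2]) (by linarith [(z.2 0).2.1]) (z.1 : Fin n → I)
  rw [(radius_eq_one_iff _).2 z.1.2, mul_one] at this
  exact this

/-- Scaling boundary points towards the centre by `1 - t` is injective except at `t = 1`, as the
radius recovers `t`; every point other than the centre is reached by its own radius. -/
lemma isPushout_cone (n : ℕ) :
    IsPushout (omMap.{u} (⟨fun x => (x, fun _ => 1), by fun_prop⟩ :
        C(Cube.boundary (Fin n), Cube.boundary (Fin n) × (Fin 1 → I))))
      (omMap (.const _ Fin.elim0 : C(_, Fin 0 → I))) (omMap (coneMap n))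
      (omMap (.const (Fin 0 → I) (rescale 0 fun _ => 0))) := by
  have h0 : ∀ z : Cube.boundary (Fin n) × (Fin 1 → I),
      coneMap n z = rescale 0 (fun _ => 0) ↔ (z.2 0 : ℝ) = 1 := fun z => by
    rw [eq_rescale_zero_iff, radius_coneMap, sub_eq_zero, eq_comm]
  refine isPushout_collapse _ _ _ (fun z z' h => ?_) (fun z => ?_) fun x => ?_
  · have ht : (z.2 0 : ℝ) = z'.2 0 := by
      have := radius_coneMap z
      rw [h, radius_coneMap] at this
      linarith
    rw [h0]
    by_cases h1 : (z.2 0 : ℝ) = 1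
    · exact Or.inr h1
    · refine Or.inl (Prod.ext (Subtype.ext ?_) (funext fun i => ?_))
      · have h' : rescale (1 - (z.2 0 : ℝ)) (z.1 : Fin n → I) = rescale (1 - (z.2 0 : ℝ)) z'.1 := by
          conv_rhs => rw [ht]
          exact h
        exact rescale_injective (sub_pos.2 (lt_of_le_of_ne (z.2 0).2.2 h1)) (by linarith [(z.2 0).2.1]) h'
      · rw [Subsingleton.elim i 0]
        exact Subtype.ext ht
  · rw [h0]
    constructor
    · refine fun h => ⟨z.1, Prod.ext rfl (funext fun i => ?_)⟩
      rw [Subsingleton.elim i 0]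
      exact Subtype.ext h.symm
    · rintro ⟨y, rfl⟩
      rfl
  · rcases (radius_nonneg x).eq_or_lt with h | h
    · exact Or.inl ((eq_rescale_zero_iff _ _).2 h.symm)
    · obtain ⟨y, hy, hxy⟩ := exists_rescale_eq x h
      refine Or.inr ⟨(⟨y, hy⟩, fun _ => ⟨1 - radius x, by linarith [radius_le_one x], by linarith⟩), ?_⟩
      refine Eq.trans ?_ hxy
      exact congrArg (fun c => rescale c y) (sub_sub_cancel 1 (radius x))

/-- The end `t` of the cylinder on the boundary of the cube. -/
abbrev bdryEnd (n : ℕ) (t : I) : C(Cube.boundary (Fin n), Cube.boundary (Fin n) × (Fin 1 → I)) :=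
  ⟨fun x => (x, fun _ => t), by fun_prop⟩

lemma lift_eq_bdryEnd (n : ℕ) (t : I) : prod.lift (𝟙 (Om (up.{u} (Cube.boundary (Fin n)))))
    (omMap (.const _ fun _ => t)) = omMap.{u} (bdryEnd n t) ≫ prodUp _ (Fin 1 → I) := by
  refine Limits.prod.hom_ext ?_ ?_
  · rw [prod.lift_fst, Category.assoc, prodUp_fst, ← omMap_comp, ← omMap_id]
    rfl
  · rw [prod.lift_snd, Category.assoc, prodUp_snd, ← omMap_comp]
    rfl

lemma exists_cone_aux (n : ℕ) :
    ∃ (c : Om (up.{u} (Fin 0 → I)) ⟶ Om (up.{u} (Fin n → I)))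
      (ρ : Om (up.{u} (Cube.boundary (Fin n))) ⨯ Om (up.{u} (Fin 1 → I)) ⟶ Om (up.{u} (Fin n → I))),
      IsPushout (prod.lift (𝟙 (Om (up.{u} (Cube.boundary (Fin n))))) (omMap (.const _ fun _ => 1)))
        (omMap (.const _ Fin.elim0 : C(_, Fin 0 → I))) ρ c ∧
      prod.lift (𝟙 (Om (up.{u} (Cube.boundary (Fin n))))) (omMap (.const _ fun _ => 0)) ≫ ρ =
        omMap (inclMap (Cube.boundary (Fin n))) := by
  let e := asIso (prodUp.{u} (Cube.boundary (Fin n)) (Fin 1 → I))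
  refine ⟨omMap (.const (Fin 0 → I) (rescale 0 fun _ => 0)), e.inv ≫ omMap (coneMap n), ?_, ?_⟩
  · refine (isPushout_cone n).of_iso (Iso.refl _) e (Iso.refl _) (Iso.refl _) ?_ ?_ ?_ ?_
    · exact (lift_eq_bdryEnd n 1).symm.trans (Category.id_comp _).symm
    · exact (Category.comp_id _).trans (Category.id_comp _).symm
    · exact (Category.comp_id _).trans (e.hom_inv_id_assoc _).symm
    · exact (Category.comp_id _).trans (Category.id_comp _).symm
  · rw [lift_eq_bdryEnd, Category.assoc]
    refine (congrArg (omMap (bdryEnd n 0) ≫ ·) (e.hom_inv_id_assoc _)).trans ?_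
    refine congrArg omMap (a₁ := (coneMap n).comp (bdryEnd n 0)) (ContinuousMap.ext fun x => ?_)
    change rescale (1 - ((0 : I) : ℝ)) (x : Fin n → I) = x
    rw [Set.Icc.coe_zero, sub_zero, rescale_one]

lemma exists_cone (n : ℕ) :
    ∃ (c : boxToLocale.{u}.obj (Box.I 0) ⟶ boxToLocale.obj (Box.I n))
      (ρ : boxToLocale.{u}.obj (Box.B n) ⨯ boxToLocale.obj (Box.I 1) ⟶ boxToLocale.obj (Box.I n)),
      IsPushout (cylEnd boxToLocale (Box.B n) 1) (boxToLocale.map (Box.toPt (Box.B n))) ρ c ∧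
        cylEnd boxToLocale (Box.B n) 0 ≫ ρ = boxToLocale.map (Box.i n) :=
  exists_cone_aux n

end Cone

theorem isGoodQStructure :
    IsGoodQStructure boxToLocale.{u} where
  full := inferInstance
  faithful := inferInstance
  intervals := isCategoryWithIntervals
  coproduct := isColimit_ends
  pushoutProduct_I_I := pushoutProduct_genI_genI
  pushoutProduct_I_J := pushoutProduct_genI_genJ
  genJ_le := genJ_le_cof_genI
  bdry_cofibrant := cof_initial_bdry
  exponentiable_bdry n := isExponentiable_of_compactHausdorff (bdry.{u} n)
  exponentiable_cube n := isExponentiable_of_compactHausdorff (cube.{u} n)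
  small_bdry n := isSmallRelativeTo_of_sepMaps (cell_le_sepMaps genI_le_sepMaps) (bdry.{u} n)
  small_cube n := isSmallRelativeTo_of_sepMaps (cell_le_sepMaps genJ_le_sepMaps) (cube.{u} n)
  cube_product n _ := isLimit_cubeFan n
  cone := exists_cone
  collapse n := ⟨_, (isTopCollapse_collapse n).isCollapse⟩

/-! ### Path objects -/

section Paths

/-- The interval, as a locale. -/
abbrev Iv : Locale.{u} := Om (up.{u} (Fin 1 → I))

/-- The map to the point. -/
def toPoint (X : Locale.{u}) : X ⟶ Om (up.{u} (Fin 0 → I)) := isTerminal_cube.some.from X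

lemma hom_ext_point {X : Locale.{u}} (f g : X ⟶ Om (up.{u} (Fin 0 → I))) : f = g :=
  isTerminal_cube.some.hom_ext f g

/-- The point `t` of the interval, as a constant map. -/
def constPt (X : Locale.{u}) (t : I) : X ⟶ Iv.{u} := toPoint X ≫ omMap (ptMap t)

lemma comp_constPt {X Y : Locale.{u}} (f : X ⟶ Y) (t : I) : f ≫ constPt Y t = constPt X t := by
  rw [constPt, ← Category.assoc, hom_ext_point (f ≫ _) (toPoint X), constPt]

lemma constPt_eq_omMap {S : Type} [TopologicalSpace S] (t : I) :
    constPt (Om (up.{u} S)) t = omMap (.const S fun _ => t) := by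
  rw [constPt, hom_ext_point (toPoint _) (omMap (.const S Fin.elim0 : C(S, Fin 0 → I)))]
  rfl

/-- The end `t` of a cylinder. -/
def cylPt (X : Locale.{u}) (t : I) : X ⟶ X ⨯ Iv.{u} := prod.lift (𝟙 X) (constPt X t)

lemma comp_cylPt {X Y : Locale.{u}} (f : X ⟶ Y) (t : I) :
    f ≫ cylPt Y t = cylPt X t ≫ prod.map f (𝟙 _) := by
  refine Limits.prod.hom_ext ?_ ?_
  · simp only [cylPt, Category.assoc, prod.lift_fst, prod.map_fst, prod.lift_fst_assoc,
      Category.comp_id, Category.id_comp]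
  · simp only [cylPt, Category.assoc, prod.lift_snd, prod.map_snd,
      Category.comp_id, comp_constPt]

lemma cylPt_fst (X : Locale.{u}) (t : I) : cylPt X t ≫ prod.fst = 𝟙 X := prod.lift_fst _ _

lemma cts_cylPt_comp {S : Type} [TopologicalSpace S] {X : Locale.{u}} (H : Om (up.{u} S) ⨯ Iv ⟶ X)
    (t : I) (s : S) : cts (cylPt _ t ≫ H) s = ctsProd H (s, fun _ => t) := by
  have : cylPt (Om (up.{u} S)) t =
      omMap (⟨fun s => (s, fun _ => t), by fun_prop⟩ : C(S, S × (Fin 1 → I))) ≫ prodUp S _ := by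
    refine Limits.prod.hom_ext ?_ ?_
    · rw [cylPt_fst, Category.assoc, prodUp_fst]
      rfl
    · rw [cylPt, prod.lift_snd, constPt_eq_omMap, Category.assoc, prodUp_snd]
      rfl
  rw [this, Category.assoc, cts_omMap_comp]
  rfl

lemma isHomotopy_of_cylPt {X Y : Locale.{u}} {H : X ⨯ Iv ⟶ Y} {f g : X ⟶ Y} (h0 : cylPt X 0 ≫ H = f)
    (h1 : cylPt X 1 ≫ H = g) : IsHomotopy boxToLocale H f g := by
  have key : ∀ (t : I), prod.map (𝟙 X) (omMap.{u} (ptMap t)) = prod.fst ≫ cylPt X t := fun t => by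
    refine Limits.prod.hom_ext ?_ ?_
    · rw [prod.map_fst, Category.assoc, cylPt_fst]
    · rw [prod.map_snd, Category.assoc, cylPt, prod.lift_snd, constPt, ← Category.assoc]
      exact congrArg (· ≫ omMap (ptMap t)) (hom_ext_point _ _)
  have key' : ∀ (t : I) (f : X ⟶ Y), cylPt X t ≫ H = f →
      prod.map (𝟙 X) (omMap.{u} (ptMap t)) ≫ H = prod.fst ≫ f := fun t f h => by
    rw [key, Category.assoc, h]
  exact ⟨key' 0 f h0, key' 1 g h1⟩

/-- Filling of the box in `I × I^n × I` whose sides are the two ends of the first and the bottom of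
the last interval. -/
lemma exists_fill_ends {Z : Type*} [TopologicalSpace Z] (n : ℕ) (b : C((Fin n → I) × I, Z))
    (v₀ v₁ : C((Fin n → I) × I, Z)) (h₀ : ∀ x, v₀ (x, 0) = b (x, 0)) (h₁ : ∀ x, v₁ (x, 0) = b (x, 1)) :
    ∃ G : C(I × ((Fin n → I) × I), Z), (∀ x t, G (t, x, 0) = b (x, t)) ∧ (∀ z, G (0, z) = v₀ z) ∧
      ∀ z, G (1, z) = v₁ z := by
  have hc : ∀ c : I, IsClosed { z : I × ((Fin n → I) × I) | z.1 = c } := fun c =>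
    isClosed_eq (by fun_prop) continuous_const
  obtain ⟨φ, h1, h2, h3⟩ := exists_glue (hc 0) (hc 1) (f := fun z => v₀ z.2) (g := fun z => v₁ z.2)
    (by fun_prop) (by fun_prop) fun z hz hz' => absurd (hz.symm.trans hz') zero_ne_one
  obtain ⟨ψ, h4, h5, h6⟩ := exists_glue ((hc 0).union (hc 1))
    (isClosed_eq (f := fun z : I × ((Fin n → I) × I) => z.2.2) (g := fun _ => 0) (by fun_prop) (by fun_prop))
    h1 (g := fun z => b (z.2.1, z.1)) (by fun_prop) (by
      rintro ⟨t, x, s⟩ (h | h) hs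
      · obtain rfl : t = 0 := h
        obtain rfl : s = 0 := hs
        rw [h2 _ rfl, h₀]
      · obtain rfl : t = 1 := h
        obtain rfl : s = 0 := hs
        rw [h3 _ rfl, h₁])
  obtain ⟨G, hG, -⟩ := (isFib_toUnit.relLift_prod isCubePair_interval (isCubePair_cube n)).exists_lift
    h4 (.const _ PUnit.unit) fun _ _ => rfl
  exact ⟨G, fun x t => (hG _ (Or.inr rfl)).trans (h6 _ rfl),
    fun z => (hG _ (Or.inl (Or.inl rfl))).trans ((h5 _ (Or.inl rfl)).trans (h2 _ rfl)),
    fun z => (hG (1, z) (Or.inl (Or.inr rfl))).trans ((h5 (1, z) (Or.inr rfl)).trans (h3 (1, z) rfl))⟩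

/-- The endpoint map of the path object is a fibration. -/
lemma genJ_rlp_endpoints {B E : Locale.{u}} (ε : E ⨯ Iv ⟶ B)
    (hε : ∀ (X : Locale.{u}) (f : X ⨯ Iv ⟶ B), ∃! g : X ⟶ E, prod.map g (𝟙 _) ≫ ε = f) :
    (genJ boxToLocale.{u}).rlp (prod.lift (cylPt E 0 ≫ ε) (cylPt E 1 ≫ ε)) := by
  have key : ∀ n : ℕ, HasLiftingProperty
      (omMap.{u} (⟨fun x => snocHomeo n (x, 0), by fun_prop⟩ : C(Fin n → I, Fin (n + 1) → I)))
      (prod.lift (cylPt E 0 ≫ ε) (cylPt E 1 ≫ ε)) := by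
    intro n
    set j : C(Fin n → I, Fin (n + 1) → I) := ⟨fun x => snocHomeo n (x, 0), by fun_prop⟩ with hj
    refine ⟨fun {p q} sq => ?_⟩
    let s : C((Fin n → I) × I, Fin (n + 1) → I) := ⟨snocHomeo n, (snocHomeo n).continuous⟩
    let s' : C(Fin (n + 1) → I, (Fin n → I) × I) := ⟨(snocHomeo n).symm, (snocHomeo n).symm.continuous⟩
    have hs' : ∀ x, s' (j x) = (x, 0) := fun x => (snocHomeo n).symm_apply_apply (x, 0)
    have hss' : ∀ y, s (s' y) = y := (snocHomeo n).apply_symm_apply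
    let P := ctsProd (prod.map p (𝟙 _) ≫ ε)
    have hw0 : ∀ x, cts (q ≫ prod.fst) (j x) = P (x, fun _ => 0) := fun x => by
      rw [← cts_omMap_comp, ← Category.assoc, ← sq.w, Category.assoc, prod.lift_fst, ← Category.assoc,
        comp_cylPt, Category.assoc, cts_cylPt_comp]
    have hw1 : ∀ x, cts (q ≫ prod.snd) (j x) = P (x, fun _ => 1) := fun x => by
      rw [← cts_omMap_comp, ← Category.assoc, ← sq.w, Category.assoc, prod.lift_snd, ← Category.assoc,
        comp_cylPt, Category.assoc, cts_cylPt_comp]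
    -- Transposing `p` gives the bottom `P` of the box, and the two components of `q` prescribe its
    -- ends. The filled box transposes to a lift into `E`.
    obtain ⟨G, hG, hG0, hG1⟩ := exists_fill_ends n (P.comp ⟨fun z => (z.1, fun _ => z.2), by fun_prop⟩)
      ((cts (q ≫ prod.fst)).comp s) ((cts (q ≫ prod.snd)).comp s) hw0 hw1
    obtain ⟨g, hg⟩ := exists_ctsProd (T := Fin 1 → I)
      (G.comp ⟨fun z : (Fin (n + 1) → I) × (Fin 1 → I) => (z.2 0, s' z.1), by fun_prop⟩)
    obtain ⟨l, hl, -⟩ := hε _ g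
    refine ⟨⟨⟨l, ?_, Limits.prod.hom_ext ?_ ?_⟩⟩⟩
    · refine (hε _ (prod.map p (𝟙 _) ≫ ε)).unique ?_ rfl
      rw [← Category.comp_id (𝟙 Iv), ← prod.map_map, Category.assoc, hl]
      refine ctsProd_injective fun x t => (ctsProd_map_left_comp j g (x, t)).trans ((hg _ _).trans ?_)
      have ht : (fun _ => t 0) = t := funext fun i => by rw [Subsingleton.elim i 0]
      change G (t 0, s' (j x)) = P (x, t)
      rw [hs', hG]
      exact congrArg (fun t => P (x, t)) ht
    · rw [Category.assoc, prod.lift_fst, ← Category.assoc, comp_cylPt, Category.assoc, hl]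
      refine cts_injective fun y => (cts_cylPt_comp g 0 y).trans ((hg _ _).trans ((hG0 _).trans ?_))
      exact congrArg (cts (q ≫ prod.fst)) (hss' y)
    · rw [Category.assoc, prod.lift_snd, ← Category.assoc, comp_cylPt, Category.assoc, hl]
      refine cts_injective fun y => (cts_cylPt_comp g 1 y).trans ((hg _ _).trans ((hG1 _).trans ?_))
      exact congrArg (cts (q ≫ prod.snd)) (hss' y)
  rintro _ _ _ ⟨n⟩
  exact key n

end Paths

/-! ### Trivial cofibrations -/

section TrivialCofibrations

/-- Projecting the cylinder to its base retracts the generator, so maps extend. -/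
lemma genJ_rlp_terminal (X : Locale.{u}) : (genJ boxToLocale.{u}).rlp (terminal.from X) := by
  have key : ∀ n : ℕ, HasLiftingProperty
      (omMap.{u} (⟨fun x => snocHomeo n (x, 0), by fun_prop⟩ : C(Fin n → I, Fin (n + 1) → I)))
      (terminal.from X) := fun n => ⟨fun {p q} sq => ⟨⟨⟨
        omMap (⟨fun y => ((snocHomeo n).symm y).1, by fun_prop⟩ : C(Fin (n + 1) → I, Fin n → I)) ≫ p, by
          rw [← Category.assoc, ← omMap_comp]
          refine (congrArg (· ≫ p) (?_ : _ = 𝟙 _)).trans (Category.id_comp p)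
          rw [← omMap_id]
          exact congrArg omMap (ContinuousMap.ext fun x =>
            congrArg Prod.fst ((snocHomeo n).symm_apply_apply (x, 0))), terminal.hom_ext _ _⟩⟩⟩⟩
  rintro _ _ _ ⟨n⟩
  exact key n

/-- A map with the left lifting property against fibrations is the inclusion of a strong deformation
retract. -/
lemma exists_deformation {A B : Locale.{u}} {j : A ⟶ B} (hj : (genJ boxToLocale.{u}).rlp.llp j) :
    ∃ (r : B ⟶ A) (H : B ⨯ Iv ⟶ B), j ≫ r = 𝟙 A ∧ cylPt B 0 ≫ H = r ≫ j ∧ cylPt B 1 ≫ H = 𝟙 B ∧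
      prod.map j (𝟙 _) ≫ H = prod.fst ≫ j := by
  have hlp := hj _ (genJ_rlp_terminal A)
  have sq : CommSq (𝟙 A) j (terminal.from A) (terminal.from B) := ⟨terminal.hom_ext _ _⟩
  have hr : j ≫ sq.lift = 𝟙 A := sq.fac_left
  -- Here `E` is the path object of `B` and `s` the constant paths along `j`. Lifting the endpoint
  -- pair `(r j, 𝟙)` relative to these paths transposes to the deformation.
  obtain ⟨E, ε, hε⟩ := exists_exponential (up.{u} (Fin 1 → I)) B
  obtain ⟨s, hs, -⟩ := hε A (prod.fst ≫ j)
  have hlp' := hj _ (genJ_rlp_endpoints ε hε)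
  have hst : ∀ t, s ≫ cylPt E t ≫ ε = j := fun t => by
    rw [← Category.assoc, comp_cylPt, Category.assoc, hs, ← Category.assoc, cylPt_fst, Category.id_comp]
  have sq' : CommSq s j (prod.lift (cylPt E 0 ≫ ε) (cylPt E 1 ≫ ε)) (prod.lift (sq.lift ≫ j) (𝟙 B)) :=
    ⟨Limits.prod.hom_ext
      (by rw [Category.assoc, Category.assoc, prod.lift_fst, prod.lift_fst, hst, ← Category.assoc, hr,
        Category.id_comp])
      (by rw [Category.assoc, Category.assoc, prod.lift_snd, prod.lift_snd, hst, Category.comp_id])⟩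
  have hl := sq'.fac_right
  refine ⟨sq.lift, prod.map sq'.lift (𝟙 _) ≫ ε, hr, ?_, ?_, ?_⟩
  · rw [← Category.assoc, ← comp_cylPt, Category.assoc]
    have := congrArg (· ≫ prod.fst) hl
    simpa only [Category.assoc, prod.lift_fst] using this
  · rw [← Category.assoc, ← comp_cylPt, Category.assoc]
    have := congrArg (· ≫ prod.snd) hl
    simpa only [Category.assoc, prod.lift_snd] using this
  · rw [← Category.assoc, prod.map_map, sq'.fac_left, Category.comp_id, hs]

/-- For a problem with bottom map `q`, the lift is `q ≫ r`, and the deformation composed with `q` is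
the homotopy. It is relative because the deformation is stationary on `A`; no property of the
left-hand map is needed. -/
lemma weakEquiv_of_llp {A B : Locale.{u}} {j : A ⟶ B} (hj : (genJ boxToLocale.{u}).rlp.llp j) :
    weakEquiv boxToLocale j := by
  obtain ⟨r, H, hr, h0, h1, hA⟩ := exists_deformation hj
  have key : ∀ {P Q : Locale.{u}} (i : P ⟶ Q), WeakRLP boxToLocale j i := by
    intro P Q i p q w
    have hpq : i ≫ q ≫ r = p := by
      rw [← Category.assoc, ← w, Category.assoc, hr, Category.comp_id]
    have h0' : cylPt Q 0 ≫ prod.map q (𝟙 Iv) ≫ H = (q ≫ r) ≫ j := by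
      rw [← Category.assoc, ← comp_cylPt, Category.assoc, h0, Category.assoc]
    have h1' : cylPt Q 1 ≫ prod.map q (𝟙 Iv) ≫ H = q := by
      rw [← Category.assoc, ← comp_cylPt, Category.assoc, h1, Category.comp_id]
    refine ⟨q ≫ r, hpq, prod.map q (𝟙 Iv) ≫ H, isHomotopy_of_cylPt h0' h1', ?_⟩
    · have : prod.map i (𝟙 Iv) ≫ prod.map q (𝟙 Iv) ≫ H = prod.fst ≫ i ≫ (q ≫ r) ≫ j := by
        rw [← Category.assoc i, hpq, ← Category.assoc, prod.map_map, ← w, ← prod.map_map,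
          Category.assoc, hA, ← Category.assoc, prod.map_fst, Category.assoc]
      exact this
  exact fun n => key _

end TrivialCofibrations

/-! ### The model structure -/

section Model

instance : (weakEquiv boxToLocale.{u}).HasTwoOutOfThreeProperty where
  comp_mem f g hf hg := (weakEquiv_iff_isWE _).2
    (((weakEquiv_iff_isWE f).1 hf).comp ((weakEquiv_iff_isWE g).1 hg))
  of_postcomp f g hg hfg := (weakEquiv_iff_isWE _).2
    (((weakEquiv_iff_isWE g).1 hg).of_comp_right ((weakEquiv_iff_isWE (f ≫ g)).1 hfg))
  of_precomp f g hf hfg := (weakEquiv_iff_isWE _).2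
    (((weakEquiv_iff_isWE f).1 hf).of_comp_left ((weakEquiv_iff_isWE (f ≫ g)).1 hfg))

lemma genI_rlp_eq : (genI boxToLocale.{u}).rlp = (genJ boxToLocale.{u}).rlp ⊓ weakEquiv boxToLocale := by
  ext X Y f
  change _ ↔ (genJ boxToLocale.{u}).rlp f ∧ weakEquiv boxToLocale f
  rw [genI_rlp_iff, genJ_rlp_iff, weakEquiv_iff_isWE]
  exact ⟨fun h => ⟨h.isFib, h.isWE⟩, fun h => h.1.isTrivFib h.2⟩

lemma hasFactorization_genI : MorphismProperty.HasFactorization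
    (genI boxToLocale.{u}).rlp.llp (genI boxToLocale.{u}).rlp :=
  hasFactorization_llp_rlp bdryIncl.{u} genI_le_sepMaps

lemma hasFactorization_genJ : MorphismProperty.HasFactorization
    (genJ boxToLocale.{u}).rlp.llp (genJ boxToLocale.{u}).rlp :=
  hasFactorization_llp_rlp cylIncl.{u} genJ_le_sepMaps

/-- The retract argument: factor a cofibration that is a weak equivalence. By two-out-of-three the
right factor is a trivial fibration, so the map lifts against it and is a retract of the left
factor. -/
lemma genJ_rlp_llp_eq :
    (genJ boxToLocale.{u}).rlp.llp = (genI boxToLocale.{u}).rlp.llp ⊓ weakEquiv boxToLocale := by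
  refine le_antisymm (le_inf (fun A B i hi X Y f hf => hi f ?_) fun A B i hi => weakEquiv_of_llp hi) ?_
  · rw [genI_rlp_eq] at hf
    exact hf.1
  · rintro A B i ⟨hi, hw⟩
    have := hasFactorization_genJ.{u}
    have h := MorphismProperty.factorizationData (genJ boxToLocale.{u}).rlp.llp
      (genJ boxToLocale.{u}).rlp i
    have hp : (genI boxToLocale.{u}).rlp h.p := by
      rw [genI_rlp_eq]
      refine ⟨h.hp, MorphismProperty.of_precomp _ h.i h.p (weakEquiv_of_llp h.hi) ?_⟩
      rwa [h.fac]
    have := hi _ hp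
    exact MorphismProperty.of_retract (RetractArrow.ofLeftLiftingProperty h.fac) h.hi

theorem exists_modelCategory : ∃ _ : ModelCategory Locale.{u},
    cofibrations Locale.{u} = cof (genI boxToLocale.{u}) ∧
    fibrations Locale.{u} = (genJ boxToLocale.{u}).rlp ∧
    weakEquivalences Locale.{u} = weakEquiv boxToLocale.{u} := by
  rw [cof_genI]
  let _ : CategoryWithFibrations Locale.{u} := ⟨(genJ boxToLocale.{u}).rlp⟩
  let _ : CategoryWithCofibrations Locale.{u} := ⟨(genI boxToLocale.{u}).rlp.llp⟩
  let _ : CategoryWithWeakEquivalences Locale.{u} := ⟨weakEquiv boxToLocale.{u}⟩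
  have : (weakEquivalences Locale.{u}).HasTwoOutOfThreeProperty :=
    inferInstanceAs (weakEquiv boxToLocale.{u}).HasTwoOutOfThreeProperty
  have hf : trivialFibrations Locale.{u} = (genI boxToLocale.{u}).rlp := genI_rlp_eq.symm
  have hc : trivialCofibrations Locale.{u} = (genJ boxToLocale.{u}).rlp.llp := genJ_rlp_llp_eq.symm
  have : MorphismProperty.IsWeakFactorizationSystem (cofibrations Locale.{u})
      (trivialFibrations Locale.{u}) := by
    rw [hf]
    have := hasFactorization_genI.{u}
    exact MorphismProperty.IsWeakFactorizationSystem.mk' (genI boxToLocale.{u}).rlp.llp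
      (genI boxToLocale.{u}).rlp fun i p hi hp => hi p hp
  have : MorphismProperty.IsWeakFactorizationSystem (trivialCofibrations Locale.{u})
      (fibrations Locale.{u}) := by
    rw [hc]
    have := hasFactorization_genJ.{u}
    exact MorphismProperty.IsWeakFactorizationSystem.mk' (genJ boxToLocale.{u}).rlp.llp
      (genJ boxToLocale.{u}).rlp fun i p hi hp => hi p hp
  exact ⟨ModelCategory.mk' _, rfl, rfl, rfl⟩

end Model

/-! ### Homotopy groups of locales -/

section Groups

variable {X Y : Locale.{u}}

/-- A point of a locale, as a point of its space of points. -/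
def pointPt (x : Point boxToLocale.{u} X) : Pts X := cts (S := Fin 0 → I) x Fin.elim0

lemma pointPt_comp (x : Point boxToLocale.{u} X) (f : X ⟶ Y) : pointPt (x ≫ f) = ptsMap f (pointPt x) :=
  cts_comp (S := Fin 0 → I) x f Fin.elim0

lemma pointPt_injective {x y : Point boxToLocale.{u} X} (h : pointPt x = pointPt y) : x = y :=
  cts_injective (S := Fin 0 → I) fun s => by
    rw [Subsingleton.elim s Fin.elim0]
    exact h

lemma exists_pointPt (p : Pts X) : ∃ x : Point boxToLocale.{u} X, pointPt x = p :=
  ⟨mor (S := Fin 0 → I) (.const _ p), DFunLike.congr_fun (cts_mor (S := Fin 0 → I) (.const _ p)) Fin.elim0⟩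

variable {n : ℕ} {x : Point boxToLocale.{u} X}

/-- A based map out of the boundary of a cube, as a continuous map. -/
def sphereCts (α : SphereMap boxToLocale.{u} n x) : C(Cube.boundary (Fin (n + 1)), Pts X) :=
  cts (S := Cube.boundary (Fin (n + 1))) α.1

lemma one_comp_eq_iff (α : boxToLocale.{u}.obj (Box.B (n + 1)) ⟶ X) :
    boxToLocale.map (Box.one n) ≫ α = x ↔
      cts (S := Cube.boundary (Fin (n + 1))) α (basePt n) = pointPt x := by
  have h : pointPt (boxToLocale.map (Box.one n) ≫ α) =
      cts (S := Cube.boundary (Fin (n + 1))) α (basePt n) :=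
    cts_omMap_comp (.const (Fin 0 → I) (basePt n)) α Fin.elim0
  rw [← h]
  exact ⟨fun h => by rw [h], fun h => pointPt_injective h⟩

lemma sphereCts_basePt (α : SphereMap boxToLocale.{u} n x) : sphereCts α (basePt n) = pointPt x :=
  (one_comp_eq_iff α.1).1 α.2

lemma exists_sphereCts (a : C(Cube.boundary (Fin (n + 1)), Pts X)) (h : a (basePt n) = pointPt x) :
    ∃ α : SphereMap boxToLocale.{u} n x, sphereCts α = a :=
  ⟨⟨mor (S := Cube.boundary (Fin (n + 1))) a, (one_comp_eq_iff _).2 (by rw [cts_mor, h])⟩, cts_mor a⟩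

/-- On these maps homotopy is already an equivalence relation, so the quotient identifies nothing
more. -/
lemma mk_eq_mk_iff (α β : SphereMap boxToLocale.{u} n x) :
    HomotopyGrp.mk boxToLocale α = HomotopyGrp.mk boxToLocale β ↔
      HRel (sphereCts α) (sphereCts β) {basePt n} := by
  have key : ∀ α β : SphereMap boxToLocale.{u} n x,
      HomotopicRel boxToLocale (boxToLocale.map (Box.one n)) α.1 β.1 ↔
        HRel (sphereCts α) (sphereCts β) {basePt n} := fun α β => by
    refine (homotopicRel_iff (.const (Fin 0 → I) (basePt n)) α.1 β.1).trans ?_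
    have hr : Set.range (ContinuousMap.const (Fin 0 → I) (basePt n)) = {basePt n} := Set.range_const
    exact Iff.of_eq (congrArg (HRel (sphereCts α) (sphereCts β)) hr)
  have he : Equivalence fun α β : SphereMap boxToLocale.{u} n x =>
      HomotopicRel boxToLocale (boxToLocale.map (Box.one n)) α.1 β.1 :=
    ⟨fun α => (key _ _).2 (HRel.refl _ _), fun h => (key _ _).2 ((key _ _).1 h).symm,
      fun h h' => (key _ _).2 (((key _ _).1 h).trans ((key _ _).1 h'))⟩
  rw [← key]
  exact Quot.eq.trans he.eqvGen_iff

lemma sphereCts_comp (α : SphereMap boxToLocale.{u} n x) (f : X ⟶ Y)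
    (h : boxToLocale.map (Box.one n) ≫ α.1 ≫ f = x ≫ f) :
    sphereCts (⟨α.1 ≫ f, h⟩ : SphereMap boxToLocale n (x ≫ f)) = (ptsMap f).comp (sphereCts α) :=
  ContinuousMap.ext fun s => cts_comp (S := Cube.boundary (Fin (n + 1))) α.1 f s

lemma map_mk (α : SphereMap boxToLocale.{u} n x) (f : X ⟶ Y) :
    HomotopyGrp.map boxToLocale n f x (HomotopyGrp.mk boxToLocale α) =
      HomotopyGrp.mk boxToLocale ⟨α.1 ≫ f, by rw [← Category.assoc, α.2]⟩ := rfl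

/-- After passing to points, this is the equivalence between the weak lifting property and
bijectivity on classes of based spheres. -/
theorem weakEquiv_iff_bijective (f : X ⟶ Y) : weakEquiv boxToLocale f ↔
    (Nonempty (Point boxToLocale.{u} Y) → Nonempty (Point boxToLocale.{u} X)) ∧
      ∀ (x : Point boxToLocale.{u} X) (n : ℕ), Function.Bijective (HomotopyGrp.map boxToLocale n f x) := by
  rw [weakEquiv_iff_isWE]
  constructor
  · refine fun h => ⟨fun ⟨y⟩ => ?_, fun x n => ⟨?_, ?_⟩⟩
    · obtain ⟨p, -⟩ := h.exists_path (pointPt y)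
      exact ⟨(exists_pointPt p).choose⟩
    · rintro ⟨α⟩ ⟨β⟩ hαβ
      refine (mk_eq_mk_iff α β).2 (h.hRel_of_comp ?_ ?_)
      · rw [sphereCts_basePt, sphereCts_basePt]
      · have := (mk_eq_mk_iff _ _).1 hαβ
        rwa [sphereCts_comp, sphereCts_comp] at this
    · rintro ⟨δ⟩
      obtain ⟨a, ha, ha'⟩ := h.exists_sphere_lift (sphereCts δ) (pointPt x)
        ((sphereCts_basePt δ).trans (pointPt_comp x f))
      obtain ⟨α, rfl⟩ := exists_sphereCts a ha
      refine ⟨HomotopyGrp.mk boxToLocale α, (mk_eq_mk_iff _ _).2 ?_⟩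
      rwa [sphereCts_comp]
  · rintro ⟨h, hb⟩
    refine isWE_of_spheres (fun ⟨p⟩ => ?_) (fun n a b hab hr => ?_) fun n d p hd => ?_
    · obtain ⟨y, -⟩ := exists_pointPt p
      obtain ⟨x⟩ := h ⟨y⟩
      exact ⟨pointPt x⟩
    · obtain ⟨x, hx⟩ := exists_pointPt (a (basePt n))
      obtain ⟨α, rfl⟩ := exists_sphereCts a hx.symm
      obtain ⟨β, rfl⟩ := exists_sphereCts b (hab.symm.trans hx.symm)
      refine (mk_eq_mk_iff α β).1 ((hb x n).1 ?_)
      rw [map_mk, map_mk, mk_eq_mk_iff, sphereCts_comp, sphereCts_comp]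
      exact hr
    · obtain ⟨x, rfl⟩ := exists_pointPt p
      obtain ⟨δ, rfl⟩ := exists_sphereCts d (hd.trans (pointPt_comp x f).symm)
      obtain ⟨⟨α⟩, hα⟩ := (hb x n).2 (HomotopyGrp.mk boxToLocale δ)
      refine ⟨sphereCts α, sphereCts_basePt α, ?_⟩
      have := (mk_eq_mk_iff _ _).1 hα
      rwa [sphereCts_comp] at this

/-- Any collapse of the cube onto a sphere comes from a collapse of spaces. -/
lemma exists_isTopCollapse {s : boxToLocale.{u}.obj (Box.I n) ⟶ boxToLocale.obj (Box.B (n + 1))}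
    (hs : IsCollapse boxToLocale n s) :
    ∃ c : C(Fin n → I, Cube.boundary (Fin (n + 1))), IsTopCollapse c ∧ s = omMap.{u} c := by
  have hmap : ∀ {S T : Type} [TopologicalSpace S] [TopologicalSpace T] [T2Space T]
      (g : Om (up.{u} S) ⟶ Om (up.{u} T)), ∃ c : C(S, T), g = omMap c := by
    intro S T _ _ _ g
    obtain ⟨k, rfl⟩ := topToLocale_map_surjective _ _ g
    exact ⟨⟨fun x => (k ⟨x⟩).down, by fun_prop⟩, rfl⟩
  have hinj : ∀ {S T : Type} [TopologicalSpace S] [TopologicalSpace T] [T2Space T] {c d : C(S, T)},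
      omMap.{u} c = omMap d → c = d := by
    intro S T _ _ _ c d h
    have h' := topToLocale_map_injective h
    exact ContinuousMap.ext fun x => congrArg (fun k => (k.hom ⟨x⟩).down) h'
  obtain ⟨c, rfl⟩ := hmap (S := Fin n → I) (T := Cube.boundary (Fin (n + 1))) s
  -- The given collapse and the explicit one are pushouts of the same span. The comparison
  -- isomorphism comes from continuous maps of spheres, and the properties of the explicit collapse
  -- pass along the injection `k`.
  have hd := isTopCollapse_collapse n
  have hd' := hd.isCollapse.{u}
  let e := hs.isColimit.coconePointUniqueUpToIso hd'.isColimit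
  obtain ⟨k, hk⟩ := hmap (S := Cube.boundary (Fin (n + 1))) (T := Cube.boundary (Fin (n + 1))) e.hom
  obtain ⟨l, hl⟩ := hmap (S := Cube.boundary (Fin (n + 1))) (T := Cube.boundary (Fin (n + 1))) e.inv
  have h1 : k.comp c = collapse n := hinj (by
    rw [omMap_comp, ← hk]
    exact hs.isColimit.comp_coconePointUniqueUpToIso_hom hd'.isColimit WalkingSpan.left)
  have h2 : k (basePt n) = basePt n := by
    have : k.comp (.const (Fin 0 → I) (basePt n)) = .const _ (basePt n) := hinj (by
      rw [omMap_comp, ← hk]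
      exact hs.isColimit.comp_coconePointUniqueUpToIso_hom hd'.isColimit WalkingSpan.right)
    exact DFunLike.congr_fun this Fin.elim0
  have h3 : l.comp k = .id _ := hinj (by
    rw [omMap_comp, ← hk, ← hl]
    exact e.hom_inv_id)
  have hk' : Function.Injective k := fun a b hab => by
    rw [← show l (k a) = a from DFunLike.congr_fun h3 a, hab]
    exact DFunLike.congr_fun h3 b
  have h1' : ∀ y, k (c y) = collapse n y := DFunLike.congr_fun h1
  refine ⟨c, ⟨fun y => ?_, fun _ _ h => ?_, fun b => ?_⟩, rfl⟩
  · rw [← hd.eq_basePt_iff, ← h1', ← hk'.eq_iff, h2]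
  · refine hd.eq_of_eq _ _ ?_
    rw [← h1', ← h1', h]
  · rcases hd.surjective (k b) with h | ⟨y, hy⟩
    · exact Or.inl (hk' (h.trans h2.symm))
    · exact Or.inr ⟨y, hk' ((h1' y).trans hy)⟩

/-- A based map, as a generalized loop. -/
def sphereLoop {c : C(Fin n → I, Cube.boundary (Fin (n + 1)))} (hc : IsTopCollapse c)
    (α : SphereMap boxToLocale.{u} n x) : GenLoop (Fin n) (Pts X) (pointPt x) :=
  ⟨(sphereCts α).comp c, fun _ hy => (congrArg (sphereCts α) (hc.apply_boundary hy)).trans (sphereCts_basePt α)⟩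

lemma mk_eq_mk_iff_homotopic {c : C(Fin n → I, Cube.boundary (Fin (n + 1)))} (hc : IsTopCollapse c)
    (α β : SphereMap boxToLocale.{u} n x) :
    HomotopyGrp.mk boxToLocale α = HomotopyGrp.mk boxToLocale β ↔
      GenLoop.Homotopic (sphereLoop hc α) (sphereLoop hc β) := by
  rw [mk_eq_mk_iff, hc.hRel_iff (by rw [sphereCts_basePt, sphereCts_basePt]), hRel_iff]
  rfl

lemma exists_sphereLoop {c : C(Fin n → I, Cube.boundary (Fin (n + 1)))} (hc : IsTopCollapse c)
    (p : GenLoop (Fin n) (Pts X) (pointPt x)) : ∃ α : SphereMap boxToLocale.{u} n x, sphereLoop hc α = p := by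
  obtain ⟨a, h1, h2⟩ := hc.exists_desc p.1 (pointPt x) p.2
  obtain ⟨α, rfl⟩ := exists_sphereCts a h2
  exact ⟨α, Subtype.ext (ContinuousMap.ext h1)⟩

variable (x) in
/-- The comparison with the homotopy groups of the space of points. -/
def homotopyGrpEquiv {c : C(Fin n → I, Cube.boundary (Fin (n + 1)))} (hc : IsTopCollapse c) :
    HomotopyGrp boxToLocale.{u} n x ≃ HomotopyGroup (Fin n) (Pts X) (pointPt x) :=
  Equiv.ofBijective (Quot.lift (fun α => (⟦sphereLoop hc α⟧ : HomotopyGroup _ _ _)) fun α β h =>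
      Quotient.sound ((mk_eq_mk_iff_homotopic hc α β).1 (Quot.sound h))) <| by
    constructor
    · rintro ⟨α⟩ ⟨β⟩ h
      exact (mk_eq_mk_iff_homotopic hc α β).2 (Quotient.exact h)
    · rintro ⟨p⟩
      obtain ⟨α, rfl⟩ := exists_sphereLoop hc p
      exact ⟨HomotopyGrp.mk boxToLocale α, rfl⟩

lemma homotopyGrpEquiv_mk {c : C(Fin n → I, Cube.boundary (Fin (n + 1)))} (hc : IsTopCollapse c)
    (α : SphereMap boxToLocale.{u} n x) :
    homotopyGrpEquiv x hc (HomotopyGrp.mk boxToLocale α) = ⟦sphereLoop hc α⟧ := rfl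

end Groups

/-! ### Concatenation -/

section Concatenation

variable {X Y : Locale.{u}} {n : ℕ} {x : Point boxToLocale.{u} X}

lemma map_lastCoordMap_comp_eq_iff (g : C(I, I)) {c : C(Fin (n + 1) → I, Cube.boundary (Fin (n + 2)))}
    (hc : IsTopCollapse c) (α γ : SphereMap boxToLocale.{u} (n + 1) x) :
    boxToLocale.map (ObjectProperty.homMk (lastCoordMap n g) : Box.I (n + 1) ⟶ Box.I (n + 1)) ≫
        omMap.{u} c ≫ γ.1 = omMap c ≫ α.1 ↔
      ∀ y, sphereLoop hc γ (Function.update y (Fin.last n) (g (y (Fin.last n)))) = sphereLoop hc α y := by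
  let l : C(Fin (n + 1) → I, Fin (n + 1) → I) :=
    ⟨fun y => Fin.snoc (α := fun _ => I) (fun k => y k.castSucc) (g (y (Fin.last n))),
      Continuous.finSnoc (by fun_prop) (by fun_prop)⟩
  have hl : ∀ y, l y = Function.update y (Fin.last n) (g (y (Fin.last n))) := fun y => by
    refine funext fun k => ?_
    induction k using Fin.lastCases with
    | last => simp [l]
    | cast k => simp [l]
  have h1 : ∀ y, cts (S := Fin (n + 1) → I) (omMap.{u} l ≫ omMap c ≫ γ.1) y =
      sphereLoop hc γ (Function.update y (Fin.last n) (g (y (Fin.last n)))) := fun y => by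
    rw [← hl]
    exact (cts_omMap_comp l (omMap c ≫ γ.1) y).trans (cts_omMap_comp c γ.1 _)
  have h2 : ∀ y, cts (S := Fin (n + 1) → I) (omMap.{u} c ≫ α.1) y = sphereLoop hc α y :=
    cts_omMap_comp c α.1
  refine ⟨fun h y => ?_, fun h => ?_⟩
  · rw [← h1, ← h2]
    exact congrArg (fun k => cts (S := Fin (n + 1) → I) k y) h
  · exact cts_injective (S := Fin (n + 1) → I) fun y => ((h1 y).trans (h y)).trans (h2 y).symm

lemma isConcat_iff {c : C(Fin (n + 1) → I, Cube.boundary (Fin (n + 2)))} (hc : IsTopCollapse c)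
    (α β γ : SphereMap boxToLocale.{u} (n + 1) x) :
    IsConcat boxToLocale (omMap.{u} c ≫ α.1) (omMap c ≫ β.1) (omMap c ≫ γ.1) ↔
      sphereLoop hc γ = GenLoop.transAt (Fin.last n) (sphereLoop hc α) (sphereLoop hc β) := by
  refine (and_congr (map_lastCoordMap_comp_eq_iff lowerHalf hc α γ)
    (map_lastCoordMap_comp_eq_iff upperHalf hc β γ)).trans ?_
  have ht : ∀ y, GenLoop.transAt (Fin.last n) (sphereLoop hc α) (sphereLoop hc β) y =
      if (y (Fin.last n) : ℝ) ≤ 1 / 2 then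
        sphereLoop hc α (Function.update y (Fin.last n)
          (Set.projIcc 0 1 zero_le_one (2 * (y (Fin.last n) : ℝ))))
      else sphereLoop hc β (Function.update y (Fin.last n)
          (Set.projIcc 0 1 zero_le_one (2 * (y (Fin.last n) : ℝ) - 1))) := fun _ => rfl
  constructor
  · rintro ⟨hα, hβ⟩
    refine GenLoop.ext _ _ fun y => ?_
    rw [ht]
    split_ifs with h
    · rw [← hα]
      congr 1
      have h' : lowerHalf (Set.projIcc 0 1 zero_le_one (2 * (y (Fin.last n) : ℝ))) = y (Fin.last n) := by
        rw [Set.projIcc_of_mem zero_le_one ⟨by linarith [(y (Fin.last n)).2.1], by linarith⟩]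
        exact Subtype.ext (by simp [lowerHalf])
      simp [h']
    · rw [← hβ]
      congr 1
      have h' : upperHalf (Set.projIcc 0 1 zero_le_one (2 * (y (Fin.last n) : ℝ) - 1)) =
          y (Fin.last n) := by
        rw [Set.projIcc_of_mem zero_le_one ⟨by linarith, by linarith [(y (Fin.last n)).2.2]⟩]
        exact Subtype.ext (by simp [upperHalf])
      simp [h']
  · intro h
    rw [h]
    refine ⟨fun y => ?_, fun y => ?_⟩
    · have h' : ((lowerHalf (y (Fin.last n)) : I) : ℝ) ≤ 1 / 2 := by
        simp only [lowerHalf, ContinuousMap.coe_mk]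
        linarith [(y (Fin.last n)).2.2]
      have h'' : 2 * ((lowerHalf (y (Fin.last n)) : I) : ℝ) = y (Fin.last n) := by
        simp only [lowerHalf, ContinuousMap.coe_mk]
        ring
      rw [ht, Function.update_self, if_pos h', h'', Set.projIcc_val, Function.update_idem,
        Function.update_eq_self]
    · have h'' : 2 * ((upperHalf (y (Fin.last n)) : I) : ℝ) - 1 = y (Fin.last n) := by
        simp only [upperHalf, ContinuousMap.coe_mk]
        ring
      rw [ht, Function.update_self, h'', Set.projIcc_val, Function.update_idem, Function.update_idem,
        Function.update_eq_self]
      split_ifs with h'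
      -- The midpoint belongs to the first branch of `transAt`; there both loops take the base
      -- value.
      · have h0 : y (Fin.last n) = 0 := Subtype.ext (le_antisymm
          (by rw [← h'']; simp only [Set.Icc.coe_zero]; linarith) (y (Fin.last n)).2.1)
        have h1 : Set.projIcc 0 1 zero_le_one (2 * ((upperHalf (y (Fin.last n)) : I) : ℝ)) = (1 : I) := by
          rw [h0]
          exact Set.projIcc_of_right_le _ (by simp [upperHalf])
        rw [h1]
        exact ((sphereLoop hc α).2 _ ⟨Fin.last n, Or.inr (Function.update_self ..)⟩).trans
          ((sphereLoop hc β).2 _ ⟨Fin.last n, Or.inl h0⟩).symm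
      · rfl

variable (x) in
/-- The group structure on homotopy groups given by concatenation. -/
@[reducible]
def homotopyGrpGroup {c : C(Fin (n + 1) → I, Cube.boundary (Fin (n + 2)))} (hc : IsTopCollapse c) :
    Group (HomotopyGrp boxToLocale.{u} (n + 1) x) :=
  -- The product of `HomotopyGroup` concatenates in reverse order, so the structure is transported
  -- from its opposite.
  ((homotopyGrpEquiv x hc).trans MulOpposite.opEquiv).group

lemma isConcatLaw_homotopyGrpGroup {c : C(Fin (n + 1) → I, Cube.boundary (Fin (n + 2)))}
    (hc : IsTopCollapse c) : IsConcatLaw boxToLocale.{u} n (omMap c) x (homotopyGrpGroup x hc) := by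
  refine fun α β => ⟨?_, fun γ h => ?_⟩
  · obtain ⟨γ, hγ⟩ := exists_sphereLoop hc
      (GenLoop.transAt (Fin.last n) (sphereLoop hc α) (sphereLoop hc β))
    exact ⟨γ, (isConcat_iff hc α β γ).2 hγ⟩
  · refine (homotopyGrpEquiv x hc).eq_symm_apply.2 ?_
    rw [homotopyGrpEquiv_mk, (isConcat_iff hc α β γ).1 h]
    exact HomotopyGroup.mul_spec.symm

/-- The maps induced on homotopy sets are compatible with concatenation. -/
lemma IsConcatLaw.map_mul {s : boxToLocale.{u}.obj (Box.I (n + 1)) ⟶ boxToLocale.obj (Box.B (n + 2))}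
    {f : X ⟶ Y} {G : Group (HomotopyGrp boxToLocale.{u} (n + 1) x)}
    {H : Group (HomotopyGrp boxToLocale.{u} (n + 1) (x ≫ f))}
    (hG : IsConcatLaw boxToLocale.{u} n s x G) (hH : IsConcatLaw boxToLocale.{u} n s (x ≫ f) H)
    (a b : HomotopyGrp boxToLocale.{u} (n + 1) x) :
    HomotopyGrp.map boxToLocale (n + 1) f x (G.mul a b) =
      H.mul (HomotopyGrp.map boxToLocale (n + 1) f x a) (HomotopyGrp.map boxToLocale (n + 1) f x b) := by
  obtain ⟨α⟩ := a
  obtain ⟨β⟩ := b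
  obtain ⟨⟨γ, hγ⟩, h⟩ := hG α β
  refine (congrArg _ (h γ hγ).symm).trans ((map_mk γ f).trans ((hH _ _).2 _ ⟨?_, ?_⟩))
  · simpa only [Category.assoc] using congrArg (· ≫ f) hγ.1
  · simpa only [Category.assoc] using congrArg (· ≫ f) hγ.2

end Concatenation

theorem exists_group_and_weakEquiv_iff (s : ∀ n : ℕ, boxToLocale.{u}.obj (Box.I (n + 1)) ⟶
      boxToLocale.{u}.obj (Box.B (n + 2))) (hs : ∀ n : ℕ, IsCollapse boxToLocale.{u} (n + 1) (s n)) :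
    ∃ G : ∀ (n : ℕ) (X : Locale.{u}) (x : Point boxToLocale.{u} X),
        Group (HomotopyGrp boxToLocale.{u} (n + 1) x),
      (∀ (n : ℕ) (X : Locale.{u}) (x : Point boxToLocale.{u} X),
        IsConcatLaw boxToLocale.{u} n (s n) x (G n X x)) ∧
      ∀ (X Y : Locale.{u}) (f : X ⟶ Y), weakEquiv boxToLocale.{u} f ↔
        (Nonempty (Point boxToLocale.{u} Y) → Nonempty (Point boxToLocale.{u} X)) ∧
          ∀ x : Point boxToLocale.{u} X,
            Function.Bijective (HomotopyGrp.map boxToLocale.{u} 0 f x) ∧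
            ∀ n : ℕ,
              letI := G n X x
              letI := G n Y (x ≫ f)
              ∃ e : HomotopyGrp boxToLocale.{u} (n + 1) x ≃* HomotopyGrp boxToLocale.{u} (n + 1) (x ≫ f),
                ⇑e = HomotopyGrp.map boxToLocale.{u} (n + 1) f x := by
  -- Arbitrary collapses are allowed; each comes from spaces, so the group structure can be
  -- transported through it.
  choose c hc hs using fun n => exists_isTopCollapse (hs n)
  have hG : ∀ (n : ℕ) (X : Locale.{u}) (x : Point boxToLocale.{u} X),
      IsConcatLaw boxToLocale.{u} n (s n) x (homotopyGrpGroup x (hc n)) := fun n X x => by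
    rw [hs n]
    exact isConcatLaw_homotopyGrpGroup (hc n)
  refine ⟨fun n X x => homotopyGrpGroup x (hc n), hG, fun X Y f => ?_⟩
  rw [weakEquiv_iff_bijective]
  refine and_congr_right fun _ => forall_congr' fun x => ⟨fun h => ⟨h 0, fun n => ?_⟩, ?_⟩
  · let := homotopyGrpGroup x (hc n)
    let := homotopyGrpGroup (x ≫ f) (hc n)
    exact ⟨{ Equiv.ofBijective _ (h (n + 1)) with map_mul' := (hG n X x).map_mul (hG n Y (x ≫ f)) }, rfl⟩
  · rintro ⟨h0, h⟩ (_ | n)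
    · exact h0
    · obtain ⟨e, he⟩ := h n
      rw [← he]
      let := homotopyGrpGroup x (hc n)
      let := homotopyGrpGroup (x ≫ f) (hc n)
      exact e.bijective

end QModel

end

theorem mainTheorem2 :
    ∃ (_ : HasLimits Locale.{u}) (_ : HasColimits Locale.{u}),
      QModel.IsGoodQStructure QModel.boxToLocale.{u} ∧
      (∃ _ : ModelCategory Locale.{u},
        cofibrations Locale.{u} = QModel.cof (QModel.genI QModel.boxToLocale.{u}) ∧
        fibrations Locale.{u} = (QModel.genJ QModel.boxToLocale.{u}).rlp ∧
        weakEquivalences Locale.{u} = QModel.weakEquiv QModel.boxToLocale.{u}) ∧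
      ∀ σ : ∀ n : ℕ, QModel.boxToLocale.{u}.obj (QModel.Box.I (n + 1)) ⟶
          QModel.boxToLocale.{u}.obj (QModel.Box.B (n + 2)),
        (∀ n : ℕ, QModel.IsCollapse QModel.boxToLocale.{u} (n + 1) (σ n)) →
        ∃ G : ∀ (n : ℕ) (X : Locale.{u}) (x : QModel.Point QModel.boxToLocale.{u} X),
            Group (QModel.HomotopyGrp QModel.boxToLocale.{u} (n + 1) x),
          (∀ (n : ℕ) (X : Locale.{u}) (x : QModel.Point QModel.boxToLocale.{u} X),
            QModel.IsConcatLaw QModel.boxToLocale.{u} n (σ n) x (G n X x)) ∧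
          ∀ (X Y : Locale.{u}) (f : X ⟶ Y),
            QModel.weakEquiv QModel.boxToLocale.{u} f ↔
              (Nonempty (QModel.Point QModel.boxToLocale.{u} Y) →
                Nonempty (QModel.Point QModel.boxToLocale.{u} X)) ∧
              ∀ x : QModel.Point QModel.boxToLocale.{u} X,
                Function.Bijective (QModel.HomotopyGrp.map QModel.boxToLocale.{u} 0 f x) ∧
                ∀ n : ℕ,
                  letI := G n X x
                  letI := G n Y (x ≫ f)
                  ∃ e : QModel.HomotopyGrp QModel.boxToLocale.{u} (n + 1) x ≃*
                      QModel.HomotopyGrp QModel.boxToLocale.{u} (n + 1) (x ≫ f),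
                    ⇑e = QModel.HomotopyGrp.map QModel.boxToLocale.{u} (n + 1) f x := by
  exact ⟨QModel.hasLimits_locale, QModel.hasColimits_locale, QModel.isGoodQStructure,
    QModel.exists_modelCategory, QModel.exists_group_and_weakEquiv_iff⟩
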